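/- Let $v$ and $w$ be $C^\infty$ vector fields on (Hausdorff, boundaryless) smooth 3-manifolds $M$ and $N$ (for instance, $M$ and $N$ may be small neighbourhoods of the connections below). A zero $p$ of $v$ is a hyperbolic saddle if no eigenvalue of its linear part has zero real part and there are both stable eigenvalues (negative real part) and unstable ones (positive real part); its Morse index is the number of stable eigenvalues, counted with multiplicity. It is $C^1$-linearisable if $v$ is linear in suitable $C^1$ coordinates on a neighbourhood of $p$. The stable manifold $W^s(q)$ (unstable manifold $W^u(p)$) is the set of points whose orbit is defined for all positive (negative) times and tends to $q$ (to $p$) in positive (negative) time. A connection from $p$ to $q$ is the closure $\Gamma$ of an orbit of $v$ which tends to $p$ in negative time and to $q$ in positive time. The connection $\Gamma$ belongs to $(1\text{-}2)^g$ if $p$ and $q$ are $C^1$-linearisable hyperbolic saddles of Morse index $1$ and $2$ respectively, and the two-dimensional manifolds $W^u(p)$ and $W^s(q)$ are transverse along $\Gamma$: $T_xW^u(p)+T_xW^s(q)=T_xM$ for every $x\in\Gamma\setminus\{p,q\}$. **Theorem.** Let $\Gamma$ be a connection of $v$ and $\Delta$ a connection of $w$, both in $(1\text{-}2)^g$. Then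 $\Gamma$ and $\Delta$ are topologically equivalent: there are open neighbourhoods $U$ of $\Gamma$ and $U'$ of $\Delta$ and a homeomorphism $h\colon U\to U'$ with $h(\Gamma)=\Delta$ which maps the orbits of $v|_U$ onto the orbits of $w|_{U'}$, preserving their orientation. -/

import Mathlib

open Set Filter Topology Manifold
open scoped ContDiff

/-- The model space of three-dimensional manifolds. -/
abbrev E3 : Type := EuclideanSpace ℝ (Fin 3)

namespace SaddleConnection

section OneVectorField

variable {M : Type*} [TopologicalSpace M] [ChartedSpace E3 M]

/-- The vector field `v` is smooth (`C^∞`), as a section of the tangent bundle. -/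
def IsSmoothVectorField [IsManifold 𝓘(ℝ, E3) ∞ M]
    (v : (x : M) → TangentSpace 𝓘(ℝ, E3) x) : Prop :=
  ContMDiff 𝓘(ℝ, E3) 𝓘(ℝ, E3).tangent ∞
    (fun x => (⟨x, v x⟩ : TangentBundle 𝓘(ℝ, E3) M))

/-- The linear part of the vector field `v` at `p`: the derivative at `p` of `v` read in the
preferred smooth chart at `p`. -/
noncomputable def linearPart (v : (x : M) → TangentSpace 𝓘(ℝ, E3) x) (p : M) : E3 →L[ℝ] E3 :=
  fderiv ℝ
    (fun y : E3 =>
      (VectorField.mpullback 𝓘(ℝ, E3) 𝓘(ℝ, E3) (extChartAt 𝓘(ℝ, E3) p).symm v y : E3))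
    (extChartAt 𝓘(ℝ, E3) p p)

/-- The complex eigenvalues of the linear part of `v` at `p`, with algebraic multiplicity. -/
noncomputable def eigenvalues (v : (x : M) → TangentSpace 𝓘(ℝ, E3) x) (p : M) : Multiset ℂ :=
  (LinearMap.charpoly (linearPart v p : E3 →ₗ[ℝ] E3)).aroots ℂ

/-- `p` is a hyperbolic saddle of `v`: a zero of `v`, no eigenvalue of which has zero real part,
with at least one stable and at least one unstable eigenvalue. -/
structure IsHyperbolicSaddle (v : (x : M) → TangentSpace 𝓘(ℝ, E3) x) (p : M) : Prop where
  zero : v p = 0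
  hyperbolic : ∀ z ∈ eigenvalues v p, z.re ≠ 0
  stable : ∃ z ∈ eigenvalues v p, z.re < 0
  unstable : ∃ z ∈ eigenvalues v p, 0 < z.re

open Classical in
/-- The Morse index of a zero of `v`: the number of stable eigenvalues, with multiplicity. -/
noncomputable def morseIndex (v : (x : M) → TangentSpace 𝓘(ℝ, E3) x) (p : M) : ℕ :=
  ((eigenvalues v p).filter (fun z => z.re < 0)).card

/-- `v` is `C^1`-linearisable at `p`: on a neighbourhood of `p` there are `C^1` coordinates
(centred at `p`) in which `v` is a linear vector field. -/
def IsC1Linearisable (v : (x : M) → TangentSpace 𝓘(ℝ, E3) x) (p : M) : Prop :=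
  ∃ (φ : OpenPartialHomeomorph M E3) (A : E3 →L[ℝ] E3),
    p ∈ φ.source ∧ φ p = 0 ∧
    ContMDiffOn 𝓘(ℝ, E3) 𝓘(ℝ, E3) 1 φ φ.source ∧
    ContMDiffOn 𝓘(ℝ, E3) 𝓘(ℝ, E3) 1 φ.symm φ.target ∧
    ∀ x ∈ φ.source, mfderiv 𝓘(ℝ, E3) 𝓘(ℝ, E3) φ x (v x) = A (φ x)

/-- The stable manifold of `q`: the points whose orbit is defined for all positive times and
tends to `q`. -/
def stableManifold (v : (x : M) → TangentSpace 𝓘(ℝ, E3) x) (q : M) : Set M :=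
  {x | ∃ δ : ℝ → M, δ 0 = x ∧ IsMIntegralCurveOn δ v (Ici 0) ∧ Tendsto δ atTop (𝓝 q)}

/-- The unstable manifold of `p`: the points whose orbit is defined for all negative times and
tends to `p` in negative time. -/
def unstableManifold (v : (x : M) → TangentSpace 𝓘(ℝ, E3) x) (p : M) : Set M :=
  {x | ∃ δ : ℝ → M, δ 0 = x ∧ IsMIntegralCurveOn δ v (Iic 0) ∧ Tendsto δ atBot (𝓝 p)}

/-- `V` is the tangent space at `x` of the immersed `k`-dimensional manifold `S`: the tangent
space at `x` of an immersed `C^1` disc of dimension `k`, contained in `S` and centred at `x`. -/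
def IsTangentSpaceAt (k : ℕ) (S : Set M) (x : M)
    (V : Submodule ℝ (TangentSpace 𝓘(ℝ, E3) x)) : Prop :=
  ∃ (σ : EuclideanSpace ℝ (Fin k) → M)
    (L : EuclideanSpace ℝ (Fin k) →L[ℝ] TangentSpace 𝓘(ℝ, E3) x),
    σ 0 = x ∧
    ContMDiffAt 𝓘(ℝ, EuclideanSpace ℝ (Fin k)) 𝓘(ℝ, E3) 1 σ 0 ∧
    (∀ᶠ u in 𝓝 0, σ u ∈ S) ∧
    HasMFDerivAt 𝓘(ℝ, EuclideanSpace ℝ (Fin k)) 𝓘(ℝ, E3) σ 0 L ∧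
    Function.Injective L ∧
    V = LinearMap.range (L : EuclideanSpace ℝ (Fin k) →ₗ[ℝ] TangentSpace 𝓘(ℝ, E3) x)

/-- `Γ` is a connection (heteroclinic orbit) from `p` to `q`: the closure of an orbit which tends
to `p` in negative time and to `q` in positive time. -/
def IsConnection (v : (x : M) → TangentSpace 𝓘(ℝ, E3) x) (p q : M) (Γ : Set M) : Prop :=
  ∃ γ : ℝ → M, IsMIntegralCurve γ v ∧ Tendsto γ atBot (𝓝 p) ∧ Tendsto γ atTop (𝓝 q) ∧
    Γ = closure (range γ)

/-- `Γ` is a generic connection of type `(1-2)`: a connection between two `C^1`-linearisable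
hyperbolic saddles `p` and `q`, of Morse indices `1` and `2`, such that the unstable manifold
of `p` and the stable manifold of `q` (both of dimension `2`) are transverse along `Γ`. -/
structure IsGeneric12 (v : (x : M) → TangentSpace 𝓘(ℝ, E3) x) (p q : M) (Γ : Set M) :
    Prop where
  saddle_p : IsHyperbolicSaddle v p
  saddle_q : IsHyperbolicSaddle v q
  linearisable_p : IsC1Linearisable v p
  linearisable_q : IsC1Linearisable v q
  index_p : morseIndex v p = 1
  index_q : morseIndex v q = 2
  connection : IsConnection v p q Γ
  transverse : ∀ x ∈ Γ \ {p, q}, ∀ V W : Submodule ℝ (TangentSpace 𝓘(ℝ, E3) x),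
    IsTangentSpaceAt 2 (unstableManifold v p) x V →
    IsTangentSpaceAt 2 (stableManifold v q) x W → V ⊔ W = ⊤

end OneVectorField

section TwoVectorFields

variable {M : Type*} [TopologicalSpace M] [ChartedSpace E3 M]
  {N : Type*} [TopologicalSpace N] [ChartedSpace E3 N]

/-- The homeomorphism `h` maps orbits of `v` in its domain into orbits of `w`, preserving the
orientation: every compact orbit arc of `v` in the domain of `h` is mapped by `h` onto an orbit
arc of `w`, the parametrisations being related by an increasing homeomorphism. -/
def MapsOrbits (v : (x : M) → TangentSpace 𝓘(ℝ, E3) x)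
    (w : (y : N) → TangentSpace 𝓘(ℝ, E3) y) (h : OpenPartialHomeomorph M N) : Prop :=
  ∀ (a b : ℝ) (γ : ℝ → M), a ≤ b → IsMIntegralCurveOn γ v (Icc a b) →
    (∀ t ∈ Icc a b, γ t ∈ h.source) →
    ∃ (τ : ℝ → ℝ) (δ : ℝ → N), ContinuousOn τ (Icc a b) ∧ StrictMonoOn τ (Icc a b) ∧
      IsMIntegralCurveOn δ w (Icc (τ a) (τ b)) ∧ ∀ t ∈ Icc a b, δ (τ t) = h (γ t)

/-- The connections `Γ` of `v` and `Δ` of `w` are topologically equivalent: there is a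
homeomorphism from an open neighbourhood of `Γ` onto an open neighbourhood of `Δ`, mapping `Γ`
onto `Δ`, and orbits of `v` onto orbits of `w`, preserving their orientation. -/
def TopologicallyEquivalent (v : (x : M) → TangentSpace 𝓘(ℝ, E3) x) (Γ : Set M)
    (w : (y : N) → TangentSpace 𝓘(ℝ, E3) y) (Δ : Set N) : Prop :=
  ∃ h : OpenPartialHomeomorph M N,
    Γ ⊆ h.source ∧ Δ ⊆ h.target ∧ h '' Γ = Δ ∧ MapsOrbits v w h ∧ MapsOrbits w v h.symm

end TwoVectorFields

end SaddleConnection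

/-! Up to homeomorphism, a linear flow with one stable and two unstable eigenvalues has no
invariants: it is conjugate, with time preserved, to the model flow with exponents `-1, 1, 1`. The
point is that the model at `p` and the model at `q` (for the reversed field) can be joined along the
connection by one universal transition map.

Adapted charts. The `C^1` linearising chart at `p` is carried along the orbit by the flow until it
reaches a point `γ 0` in the chart of `q` (`exists_extension`). The linear part splits into a stable
line and an unstable plane; a signed power normalises the line, and a quadratic Lyapunov function
normalises the plane (`exists_planar_conjugacy`). This gives a chart `P = (x, y, y')` conjugating
`v` to the model flow and sending the half orbit to `{0} × (0, 1] × {0}`, and likewise `Q` at `q`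
for `-v` (`exists_isAdapted`).

Matching. Where `y > 0` the model flow has the invariants `u = x y` and `η = y' / y`. Near `γ 0`,
`u_P` vanishes on the unstable manifold of `p` and `u_Q` on the stable manifold of `q`. The charts
are only homeomorphisms, but enough differentiability survives at `γ 0` for transversality to make
`u_P`, `u_Q` and a time coordinate jointly injective (`exists_injOn`). Hence homeomorphisms
commuting with the model flow can replace `η_P` by `u_Q` and `η_Q` by `u_P` (`exists_shear`). What
remains is a time discrepancy `D (u_P, u_Q)`, which is split into two shifts along the flow, one
absorbed at each end (`exists_shift`, `exists_matched`). The transition is then `(x, y, y') ↦ (y', 1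
/ y, x)`.

Since this formula is the same for both connections, the comparison maps built from the charts at
the two ends agree near `γ 0`, and they glue to a homeomorphism near the compact set `Γ`
(`exists_glued_openPartialHomeomorph`). -/

namespace SaddleConnection

/-! ### Families of monotone maps, compact half orbits, gluing of homeomorphisms -/

section Topology

variable {X Y : Type*} [TopologicalSpace X] [TopologicalSpace Y]

/-- A continuous family of increasing bijections of the line has a continuous family of inverses. -/
theorem exists_continuous_inverse_of_strictMono {f : X × ℝ → ℝ} (hf : Continuous f)
    (hm : ∀ x, StrictMono fun t => f (x, t)) (hs : ∀ x, Function.Surjective fun t => f (x, t)) :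
    ∃ g : X × ℝ → ℝ, Continuous g ∧ (∀ x t, g (x, f (x, t)) = t) ∧ ∀ x t, f (x, g (x, t)) = t := by
  choose g hg using hs
  refine ⟨fun z => g z.1 z.2, ?_, fun x t => (hm x).injective (hg x _), fun x t => hg x t⟩
  rw [continuous_iff_continuousAt]
  rintro ⟨x₀, s₀⟩
  refine Metric.continuousAt_iff'.2 fun ε hε => ?_
  -- These strict inequalities persist for nearby parameters, and monotonicity then traps the
  -- inverse within `ε`.
  have h1 : f (x₀, g x₀ s₀ - ε) < s₀ :=
    lt_of_lt_of_eq (hm x₀ (sub_lt_self _ hε)) (hg x₀ s₀)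
  have h2 : s₀ < f (x₀, g x₀ s₀ + ε) :=
    lt_of_eq_of_lt (hg x₀ s₀).symm (hm x₀ (lt_add_of_pos_right _ hε))
  have c1 : ContinuousAt (fun z : X × ℝ => f (z.1, g x₀ s₀ - ε)) (x₀, s₀) := by fun_prop
  have c2 : ContinuousAt (fun z : X × ℝ => f (z.1, g x₀ s₀ + ε)) (x₀, s₀) := by fun_prop
  have c3 : ContinuousAt (fun z : X × ℝ => z.2) (x₀, s₀) := by fun_prop
  filter_upwards [c1.eventually_lt c3 h1, c3.eventually_lt c2 h2] with z hz1 hz2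
  rw [Real.dist_eq, abs_lt]
  constructor
  · have : g x₀ s₀ - ε < g z.1 z.2 := (hm z.1).lt_iff_lt.1 (lt_of_lt_of_eq hz1 (hg z.1 z.2).symm)
    linarith
  · have : g z.1 z.2 < g x₀ s₀ + ε := (hm z.1).lt_iff_lt.1 (lt_of_eq_of_lt (hg z.1 z.2) hz2)
    linarith

/-- A half orbit together with its limit is compact. -/
theorem isCompact_insert_image_Iic {γ : ℝ → X} {p : X} {b : ℝ} (hγ : Continuous γ)
    (hp : Tendsto γ atBot (𝓝 p)) : IsCompact (insert p (γ '' Iic b)) := by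
  -- The substitution `r = exp t` compactifies the half line, with `r = 0` standing for the limit
  -- point.
  have key : ContinuousOn (fun r : ℝ => if r = 0 then p else γ (Real.log r))
      (Icc 0 (Real.exp b)) := by
    intro r hr
    rcases eq_or_ne r 0 with rfl | h0
    · have : Tendsto (fun r : ℝ => if r = 0 then p else γ (Real.log r)) (𝓝[>] 0) (𝓝 p) := by
        refine (hp.comp Real.tendsto_log_nhdsGT_zero).congr' ?_
        filter_upwards [self_mem_nhdsWithin] with r hr
        simp [(ne_of_gt hr : r ≠ 0)]
      have h2 : ContinuousWithinAt (fun r : ℝ => if r = 0 then p else γ (Real.log r)) (Ici 0) 0 := by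
        rw [← continuousWithinAt_Ioi_iff_Ici]
        simpa [ContinuousWithinAt] using this
      exact h2.mono Icc_subset_Ici_self
    · have : (fun r : ℝ => if r = 0 then p else γ (Real.log r)) =ᶠ[𝓝 r]
          fun r => γ (Real.log r) := by
        filter_upwards [isOpen_ne.mem_nhds h0] with r hr
        simp [show r ≠ 0 from hr]
      refine (ContinuousAt.congr ?_ this.symm).continuousWithinAt
      exact hγ.continuousAt.comp (Real.continuousAt_log h0)
  convert isCompact_Icc.image_of_continuousOn key using 1
  ext x
  simp only [mem_insert_iff, mem_image, mem_Iic, mem_Icc]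
  constructor
  · rintro (rfl | ⟨t, ht, rfl⟩)
    · exact ⟨0, ⟨le_rfl, (Real.exp_pos b).le⟩, by simp⟩
    · exact ⟨Real.exp t, ⟨(Real.exp_pos t).le, Real.exp_le_exp.2 ht⟩, by simp⟩
  · rintro ⟨r, ⟨h0, h1⟩, rfl⟩
    rcases eq_or_lt_of_le h0 with rfl | h0
    · simp
    · right
      exact ⟨Real.log r, (Real.log_le_iff_le_exp h0).2 h1, by simp [h0.ne']⟩

/-- Gluing of two homeomorphisms between open sets, given near two compact sets `K₁`, `K₂`, which
agree near `K₁ ∩ K₂`, and whose union is injective on `K₁ ∪ K₂`. -/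
theorem exists_glued_openPartialHomeomorph [T2Space X] [T2Space Y]
    (f₁ f₂ : OpenPartialHomeomorph X Y) {K₁ K₂ : Set X} (hK₁ : IsCompact K₁) (hK₂ : IsCompact K₂)
    (hf₁ : K₁ ⊆ f₁.source) (hf₂ : K₂ ⊆ f₂.source)
    (hagree : ∀ x ∈ K₁ ∩ K₂, f₁ =ᶠ[𝓝 x] f₂)
    (hinj : ∀ x ∈ K₁, ∀ y ∈ K₂, f₁ x = f₂ y → x = y) :
    ∃ H : OpenPartialHomeomorph X Y, K₁ ∪ K₂ ⊆ H.source ∧ (∀ x ∈ K₁, H =ᶠ[𝓝 x] f₁) ∧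
      (∀ x ∈ K₂, H =ᶠ[𝓝 x] f₂) ∧
      ∀ x ∈ H.source, (x ∈ f₁.source ∧ H =ᶠ[𝓝 x] f₁) ∨ (x ∈ f₂.source ∧ H =ᶠ[𝓝 x] f₂) := by
  classical
  rcases isEmpty_or_nonempty X with hX | hX
  · exact ⟨f₁, fun x => (hX.false x).elim, fun x => (hX.false x).elim, fun x => (hX.false x).elim,
      fun x => (hX.false x).elim⟩
  -- Off the open set `O` of agreement the two compact sets are disjoint, hence separated by open
  -- sets, so the map defined by cases is locally `f₁` or `f₂`.
  let O : Set X := {x | f₁ =ᶠ[𝓝 x] f₂}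
  have hO : IsOpen O := isOpen_iff_mem_nhds.2 fun x hx => hx.eventually_nhds
  obtain ⟨A₁, A₂, hA₁, hA₂, hKA₁, hKA₂, hA⟩ : SeparatedNhds (K₁ \ O) (K₂ \ O) :=
    SeparatedNhds.of_isCompact_isCompact (hK₁.diff hO) (hK₂.diff hO) <| by
      rw [Set.disjoint_left]
      rintro x ⟨h1, h2⟩ ⟨h3, -⟩
      exact h2 (hagree x ⟨h1, h3⟩)
  let h : X → Y := fun x => if x ∈ A₁ ∪ O then f₁ x else f₂ x
  have hh₁ : ∀ x ∈ A₁ ∪ O, h =ᶠ[𝓝 x] f₁ := fun x hx => by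
    filter_upwards [(hA₁.union hO).mem_nhds hx] with y hy
    exact if_pos hy
  have hh₂ : ∀ x ∈ A₂ ∪ O, h =ᶠ[𝓝 x] f₂ := fun x hx => by
    filter_upwards [(hA₂.union hO).mem_nhds hx] with y hy
    by_cases hyO : y ∈ O
    · exact (if_pos (Or.inr hyO)).trans (show f₁ =ᶠ[𝓝 y] f₂ from hyO).eq_of_nhds
    · refine if_neg ?_
      rintro (h1 | h1)
      · exact Set.disjoint_left.1 hA h1 (hy.resolve_right hyO)
      · exact hyO h1
  have hK₁' : K₁ ⊆ A₁ ∪ O := fun x hx => by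
    by_cases hxO : x ∈ O
    · exact Or.inr hxO
    · exact Or.inl (hKA₁ ⟨hx, hxO⟩)
  have hK₂' : K₂ ⊆ A₂ ∪ O := fun x hx => by
    by_cases hxO : x ∈ O
    · exact Or.inr hxO
    · exact Or.inl (hKA₂ ⟨hx, hxO⟩)
  let U : Set X := ((A₁ ∪ O) ∩ f₁.source) ∪ ((A₂ ∪ O) ∩ f₂.source)
  have hU : IsOpen U :=
    ((hA₁.union hO).inter f₁.open_source).union ((hA₂.union hO).inter f₂.open_source)
  have hlocal : ∀ x ∈ U, (x ∈ f₁.source ∧ h =ᶠ[𝓝 x] f₁) ∨ (x ∈ f₂.source ∧ h =ᶠ[𝓝 x] f₂) := by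
    rintro x (⟨h1, h2⟩ | ⟨h1, h2⟩)
    · exact Or.inl ⟨h2, hh₁ x h1⟩
    · exact Or.inr ⟨h2, hh₂ x h1⟩
  have hKU : K₁ ∪ K₂ ⊆ U := by
    rintro x (hx | hx)
    · exact Or.inl ⟨hK₁' hx, hf₁ hx⟩
    · exact Or.inr ⟨hK₂' hx, hf₂ hx⟩
  have hcont : ∀ x ∈ U, ContinuousAt h x := by
    intro x hx
    rcases hlocal x hx with ⟨h1, h2⟩ | ⟨h1, h2⟩
    · exact (f₁.continuousAt h1).congr h2.symm
    · exact (f₂.continuousAt h1).congr h2.symm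
  have hinj' : InjOn h (K₁ ∪ K₂) := by
    have e₁ : ∀ x ∈ K₁, h x = f₁ x := fun x hx => (hh₁ x (hK₁' hx)).self_of_nhds
    have e₂ : ∀ x ∈ K₂, h x = f₂ x := fun x hx => (hh₂ x (hK₂' hx)).self_of_nhds
    rintro x (hx | hx) y (hy | hy) hxy
    · exact f₁.injOn (hf₁ hx) (hf₁ hy) (by rw [← e₁ x hx, ← e₁ y hy, hxy])
    · exact hinj x hx y hy (by rw [← e₁ x hx, ← e₂ y hy, hxy])
    · exact (hinj y hy x hx (by rw [← e₁ y hy, ← e₂ x hx, hxy])).symm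
    · exact f₂.injOn (hf₂ hx) (hf₂ hy) (by rw [← e₂ x hx, ← e₂ y hy, hxy])
  have hloc : ∀ x ∈ K₁ ∪ K₂, ∃ u ∈ 𝓝 x, InjOn h u := by
    intro x hx
    rcases hlocal x (hKU hx) with ⟨h1, h2⟩ | ⟨h1, h2⟩
    · refine ⟨_, inter_mem h2 (f₁.open_source.mem_nhds h1), ?_⟩
      rintro y ⟨hy, hy'⟩ z ⟨hz, hz'⟩ hyz
      exact f₁.injOn hy' hz' ((Eq.symm hy).trans (hyz.trans hz))
    · refine ⟨_, inter_mem h2 (f₂.open_source.mem_nhds h1), ?_⟩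
      rintro y ⟨hy, hy'⟩ z ⟨hz, hz'⟩ hyz
      exact f₂.injOn hy' hz' ((Eq.symm hy).trans (hyz.trans hz))
  -- A map injective on a compact set and locally injective at its points is injective on a
  -- neighbourhood of it.
  obtain ⟨W, hW, hKW, hinjW⟩ := hinj'.exists_isOpen_superset (hK₁.union hK₂)
    (fun x hx => hcont x (hKU hx)) hloc
  have hopen : IsOpenMap ((U ∩ W).domRestrict h) := by
    rw [isOpenMap_iff_nhds_le]
    rintro ⟨x, hx⟩
    have hmap : map h (𝓝 x) = 𝓝 (h x) := by
      rcases hlocal x hx.1 with ⟨h1, h2⟩ | ⟨h1, h2⟩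
      · rw [map_congr h2, f₁.map_nhds_eq h1, h2.self_of_nhds]
      · rw [map_congr h2, f₂.map_nhds_eq h1, h2.self_of_nhds]
    have : map ((U ∩ W).domRestrict h) (𝓝 ⟨x, hx⟩) = map h (𝓝 x) := by
      rw [← map_nhds_subtype_coe_eq_nhds hx ((hU.inter hW).mem_nhds hx), Filter.map_map]
      rfl
    rw [this, hmap]
    exact le_rfl
  let e : PartialEquiv X Y := (hinjW.mono inter_subset_right : InjOn h (U ∩ W)).toPartialEquiv
  refine ⟨OpenPartialHomeomorph.ofContinuousOpenRestrict e
    (fun x hx => (hcont x hx.1).continuousWithinAt) hopen (hU.inter hW),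
    fun x hx => ⟨hKU hx, hKW hx⟩, fun x hx => hh₁ x (hK₁' hx), fun x hx => hh₂ x (hK₂' hx),
    fun x hx => hlocal x hx.1⟩

end Topology


/-! ### Differentiability of a local flow in the initial condition -/

section Flow

variable {E : Type*} [NormedAddCommGroup E] [NormedSpace ℝ E]

/-- Along a trajectory `X` of `f`, the solution `Φ` of the variational equation approximates nearby
trajectories to second order. -/
theorem norm_sub_variation_le {f : E → E} {f' : E → E →L[ℝ] E} {s : Set E} (hs : Convex ℝ s)
    {K C : NNReal} (hf : ∀ z ∈ s, HasFDerivAt f (f' z) z) (hK : LipschitzOnWith K f s)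
    (hC : LipschitzOnWith C f' s) {X Y : ℝ → E} {Φ : ℝ → E →L[ℝ] E} {T m : ℝ} {h : E}
    (hX : ∀ t ∈ Icc 0 T, HasDerivAt X (f (X t)) t) (hY : ∀ t ∈ Icc 0 T, HasDerivAt Y (f (Y t)) t)
    (hΦ : ∀ t ∈ Icc 0 T, HasDerivAt Φ ((f' (X t)).comp (Φ t)) t)
    (hXs : ∀ t ∈ Icc 0 T, X t ∈ s) (hYs : ∀ t ∈ Icc 0 T, Y t ∈ s)
    (hXΦ : ∀ t ∈ Icc 0 T, X t + Φ t h ∈ s) (hm : ∀ t ∈ Icc 0 T, ‖Φ t‖ ≤ m)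
    (hΦ0 : Φ 0 = ContinuousLinearMap.id ℝ E) (h0 : Y 0 = X 0 + h) :
    ∀ t ∈ Icc 0 T, ‖Y t - X t - Φ t h‖ ≤ gronwallBound 0 K (C * (m * ‖h‖) ^ 2) t := by
  intro t ht
  have hm0 : 0 ≤ m := (norm_nonneg _).trans (hm t ht)
  -- `X + Φ h` solves the equation up to an error `C (m ‖h‖)²`, because `f'` is `C`-Lipschitz;
  -- Grönwall's inequality then compares it with `Y`.
  have hder : ∀ t ∈ Icc 0 T, HasDerivAt (fun t => X t + Φ t h)
      (f (X t) + f' (X t) (Φ t h)) t := fun t ht =>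
    (hX t ht).add (by simpa using (hΦ t ht).clm_apply (hasDerivAt_const t h))
  have hbound : ∀ t ∈ Icc 0 T, dist (f (X t) + f' (X t) (Φ t h)) (f (X t + Φ t h)) ≤
      C * (m * ‖h‖) ^ 2 := by
    intro t ht
    have hΦh : ‖Φ t h‖ ≤ m * ‖h‖ :=
      ((Φ t).le_opNorm h).trans (mul_le_mul_of_nonneg_right (hm t ht) (norm_nonneg _))
    have := Convex.norm_image_sub_le_of_norm_hasFDerivWithin_le' (𝕜 := ℝ) (f := f)
      (s := s ∩ Metric.closedBall (X t) (m * ‖h‖)) (f' := f') (φ := f' (X t))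
      (C := C * (m * ‖h‖)) (x := X t) (y := X t + Φ t h)
      (fun z hz => (hf z hz.1).hasFDerivWithinAt)
      (fun z hz => by
        rw [← dist_eq_norm]
        exact (hC.dist_le_mul z hz.1 (X t) (hXs t ht)).trans
          (mul_le_mul_of_nonneg_left hz.2 C.2))
      (hs.inter (convex_closedBall _ _))
      ⟨hXs t ht, Metric.mem_closedBall_self (by positivity)⟩
      ⟨hXΦ t ht, by simpa [Metric.mem_closedBall, dist_eq_norm] using hΦh⟩
    rw [dist_comm, dist_eq_norm]
    calc ‖f (X t + Φ t h) - (f (X t) + f' (X t) (Φ t h))‖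
        = ‖f (X t + Φ t h) - f (X t) - f' (X t) (X t + Φ t h - X t)‖ := by
          congr 1; simp only [add_sub_cancel_left]; abel
      _ ≤ C * (m * ‖h‖) * ‖X t + Φ t h - X t‖ := this
      _ ≤ C * (m * ‖h‖) * (m * ‖h‖) := by
          gcongr
          simpa using hΦh
      _ = C * (m * ‖h‖) ^ 2 := by ring
  have hIco : ∀ {t : ℝ}, t ∈ Ico (0 : ℝ) T → t ∈ Icc (0 : ℝ) T := fun h => Ico_subset_Icc_self h
  have := dist_le_of_approx_trajectories_ODE_of_mem (v := fun _ => f) (s := fun _ => s) (K := K)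
    (f := Y) (g := fun t => X t + Φ t h) (f' := fun t => f (Y t))
    (g' := fun t => f (X t) + f' (X t) (Φ t h)) (a := 0) (b := T) (εf := 0)
    (εg := C * (m * ‖h‖) ^ 2) (δ := 0)
    (fun _ _ => hK) (fun t ht => (hY t ht).continuousAt.continuousWithinAt)
    (fun t ht => (hY t (hIco ht)).hasDerivWithinAt) (fun t ht => by simp)
    (fun t ht => hYs t (hIco ht)) (fun t ht => (hder t ht).continuousAt.continuousWithinAt)
    (fun t ht => (hder t (hIco ht)).hasDerivWithinAt) (fun t ht => hbound t (hIco ht))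
    (fun t ht => hXΦ t (hIco ht)) (by simp [h0, hΦ0]) t ht
  simpa [dist_eq_norm, sub_sub] using this

theorem gronwallBound_zero_eq_mul (K ε x : ℝ) :
    gronwallBound 0 K ε x = ε * gronwallBound 0 K 1 x := by
  rcases eq_or_ne K 0 with rfl | hK
  · simp [gronwallBound_K0]
  · simp [gronwallBound_of_K_ne_0 hK]
    ring

/-- A `C^2` vector field has a local flow which is `C^1` in the initial condition. -/
theorem exists_localFlow_contDiffOn [CompleteSpace E] {f : E → E} {x₀ : E}
    (hf : ContDiffAt ℝ 2 f x₀) {W : Set E} (hW : W ∈ 𝓝 x₀) :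
    ∃ (F : E → ℝ → E) (U : Set E) (ε : ℝ), 0 < ε ∧ IsOpen U ∧ x₀ ∈ U ∧ (∀ x ∈ U, F x 0 = x) ∧
      (∀ x ∈ U, ∀ t ∈ Ioo (-ε) ε, F x t ∈ W ∧ HasDerivAt (F x) (f (F x t)) t) ∧
      ContinuousOn (fun z : E × ℝ => F z.1 z.2) (U ×ˢ Ioo (-ε) ε) ∧
      ∀ t ∈ Ioo (-ε) ε, ContDiffOn ℝ 1 (fun x => F x t) U := by
  have hf1 : ContDiffAt ℝ 1 (fderiv ℝ f) x₀ := hf.fderiv_right (by norm_num)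
  -- The field coupled with its variational equation: it is `C^1` because `f` is `C^2`, so the
  -- Picard–Lindelöf theorem applies, and its second component started at the identity is the
  -- candidate derivative of the flow.
  let g : E × (E →L[ℝ] E) → E × (E →L[ℝ] E) := fun z => (f z.1, (fderiv ℝ f z.1).comp z.2)
  let I : E →L[ℝ] E := ContinuousLinearMap.id ℝ E
  have hg : ContDiffAt ℝ 1 g (x₀, I) := by
    refine ContDiffAt.prodMk ((hf.of_le (by norm_num)).comp (x₀, I) contDiffAt_fst) ?_
    exact ContDiffAt.clm_comp (hf1.comp (x₀, I) contDiffAt_fst) contDiffAt_snd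
  obtain ⟨ε₀, hε₀, a, r, L, K₀, hr, hpl⟩ := IsPicardLindelof.of_contDiffAt_one hg
  obtain ⟨α, hα, hαc⟩ := (hpl 0).exists_forall_mem_closedBall_eq_hasDerivWithinAt_continuousOn
  simp only [zero_sub, zero_add] at hα hαc
  -- a ball on which `f` and its derivative are Lipschitz
  obtain ⟨K, s₁, hs₁, hK⟩ := (hf.of_le (by norm_num : (1 : WithTop ℕ∞) ≤ 2)).exists_lipschitzOnWith
  obtain ⟨C, s₂, hs₂, hC⟩ := hf1.exists_lipschitzOnWith
  have hs₃ : ∀ᶠ z in 𝓝 x₀, DifferentiableAt ℝ f z :=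
    (hf.eventually (by simp)).mono fun z hz => hz.differentiableAt (by norm_num)
  obtain ⟨ρ, hρ, hρs⟩ := Metric.mem_nhds_iff.1 (inter_mem (inter_mem hs₁ hs₂) (inter_mem hs₃ hW))
  -- the trajectories stay in a smaller ball
  have hα0 : ContinuousAt α ((x₀, I), 0) := by
    refine hαc.continuousAt (prod_mem_nhds (Metric.closedBall_mem_nhds _ (by exact_mod_cast hr))
      (Icc_mem_nhds (by linarith) hε₀))
  have hα00 : α ((x₀, I), 0) = (x₀, I) :=
    (hα (x₀, I) (Metric.mem_closedBall_self r.2)).1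
  have hcont : ContinuousAt (fun z : E × ℝ => α ((z.1, I), z.2)) (x₀, 0) := by
    have : ContinuousAt (fun z : E × ℝ => ((z.1, I), z.2)) (x₀, 0) := by fun_prop
    exact ContinuousAt.comp (f := fun z : E × ℝ => ((z.1, I), z.2)) (g := α) hα0 this
  have hnear : ∀ᶠ z : E × ℝ in 𝓝 (x₀, 0), (α ((z.1, I), z.2)).1 ∈ Metric.ball x₀ (ρ / 2) ∧
      ‖(α ((z.1, I), z.2)).2‖ < ‖I‖ + 1 := by
    refine Eventually.and ?_ ?_
    · refine hcont.fst.eventually_mem (Metric.isOpen_ball.mem_nhds ?_)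
      rw [hα00]; exact Metric.mem_ball_self (by positivity)
    · refine hcont.snd.norm.eventually_lt continuousAt_const ?_
      rw [hα00]; simp
  obtain ⟨r₁, hr₁, hnear⟩ := Metric.eventually_nhds_iff_ball.1 hnear
  have hr' : (0 : ℝ) < r := by exact_mod_cast hr
  set ε := min r₁ ε₀ with hε
  have hεpos : 0 < ε := lt_min hr₁ hε₀
  set U := Metric.ball x₀ (min r₁ r) with hU
  have hUr : ∀ x ∈ U, (x, I) ∈ Metric.closedBall (x₀, I) (r : ℝ) := fun x hx => by
    rw [Metric.mem_closedBall, Prod.dist_eq]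
    simp only [dist_self]
    exact max_le ((Metric.mem_ball.1 hx).le.trans (min_le_right _ _)) r.2
  have hIoo : ∀ t ∈ Ioo (-ε) ε, t ∈ Icc (-ε₀) ε₀ ∧ Icc (-ε₀) ε₀ ∈ 𝓝 t := fun t ht => by
    have := min_le_right r₁ ε₀
    have h1 : -ε₀ < t := by linarith [ht.1]
    have h2 : t < ε₀ := by linarith [ht.2]
    exact ⟨⟨h1.le, h2.le⟩, Icc_mem_nhds h1 h2⟩
  have hnear' : ∀ x ∈ U, ∀ t ∈ Ioo (-ε) ε, (α ((x, I), t)).1 ∈ Metric.ball x₀ (ρ / 2) ∧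
      ‖(α ((x, I), t)).2‖ < ‖I‖ + 1 := fun x hx t ht => by
    refine hnear (x, t) ?_
    rw [Metric.mem_ball, Prod.dist_eq, max_lt_iff]
    refine ⟨(Metric.mem_ball.1 hx).trans_le (min_le_left _ _), ?_⟩
    rw [Real.dist_eq, sub_zero, abs_lt]
    have := min_le_left r₁ ε₀
    exact ⟨by linarith [ht.1], by linarith [ht.2]⟩
  have hder : ∀ x ∈ U, ∀ t ∈ Ioo (-ε) ε, HasDerivAt (fun t => α ((x, I), t))
      (g (α ((x, I), t))) t := fun x hx t ht =>
    ((hα _ (hUr x hx)).2 t (hIoo t ht).1).hasDerivAt (hIoo t ht).2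
  have hder1 : ∀ x ∈ U, ∀ t ∈ Ioo (-ε) ε, HasDerivAt (fun t => (α ((x, I), t)).1)
      (f (α ((x, I), t)).1) t := fun x hx t ht => (hder x hx t ht).fst
  have hder2 : ∀ x ∈ U, ∀ t ∈ Ioo (-ε) ε, HasDerivAt (fun t => (α ((x, I), t)).2)
      ((fderiv ℝ f (α ((x, I), t)).1).comp (α ((x, I), t)).2) t :=
    fun x hx t ht => (hder x hx t ht).snd
  have hinit : ∀ x ∈ U, α ((x, I), 0) = (x, I) := fun x hx => (hα _ (hUr x hx)).1
  have hcontU : ContinuousOn (fun z : E × ℝ => α ((z.1, I), z.2)) (U ×ˢ Ioo (-ε) ε) := by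
    have h1 : Continuous (fun z : E × ℝ => ((z.1, I), z.2)) := by fun_prop
    exact hαc.comp h1.continuousOn fun z hz => ⟨hUr z.1 hz.1, (hIoo z.2 hz.2).1⟩
  have hsub : Metric.ball x₀ (ρ / 2) ⊆ Metric.ball x₀ ρ := Metric.ball_subset_ball (by linarith)
  refine ⟨fun x t => (α ((x, I), t)).1, U, ε, hεpos, Metric.isOpen_ball,
    Metric.mem_ball_self (lt_min hr₁ hr'), fun x hx => by simp [hinit x hx],
    fun x hx t ht => ⟨(hρs (hsub (hnear' x hx t ht).1)).2.2, hder1 x hx t ht⟩, hcontU.fst, ?_⟩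
  -- differentiability in the initial condition
  intro t ht
  have main : ∀ x ∈ U, HasFDerivAt (fun x => (α ((x, I), t)).1) (α ((x, I), t)).2 x := by
    intro x hx
    set m := ‖I‖ + 1 with hm
    have hm0 : 0 < m := by positivity
    have hKs : LipschitzOnWith K f (Metric.ball x₀ ρ) := hK.mono fun z hz => (hρs hz).1.1
    have hCs : LipschitzOnWith C (fderiv ℝ f) (Metric.ball x₀ ρ) :=
      hC.mono fun z hz => (hρs hz).1.2
    have hds : ∀ z ∈ Metric.ball x₀ ρ, HasFDerivAt f (fderiv ℝ f z) z := fun z hz =>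
      ((hρs hz).2.1 : DifferentiableAt ℝ f z).hasFDerivAt
    -- The trajectories stay in the ball of radius `ρ / 2`; the other half of the radius leaves room
    -- for the increment `Φ h`.
    have hh : ∀ᶠ h : E in 𝓝 0, x + h ∈ U ∧ m * ‖h‖ < ρ / 2 := by
      refine Eventually.and ?_ ?_
      · have : ContinuousAt (fun h : E => x + h) 0 := by fun_prop
        exact this.eventually_mem (Metric.isOpen_ball.mem_nhds (by rw [add_zero]; exact hx))
      · have : ContinuousAt (fun h : E => m * ‖h‖) 0 := by fun_prop
        exact this.eventually_lt continuousAt_const (by simpa using hρ)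
    have hbound : ∀ᶠ h : E in 𝓝 0, ‖(α ((x + h, I), t)).1 - (α ((x, I), t)).1 -
        (α ((x, I), t)).2 h‖ ≤ (C * m ^ 2 * gronwallBound 0 K 1 |t|) * ‖h‖ ^ 2 := by
      filter_upwards [hh] with h ⟨hxh, hhρ⟩
      have hin : ∀ τ ∈ Ioo (-ε) ε, (α ((x, I), τ)).1 + (α ((x, I), τ)).2 h ∈
          Metric.ball x₀ ρ := fun τ hτ => by
        have h1 := (hnear' x hx τ hτ).1
        have h2 := (hnear' x hx τ hτ).2.le
        rw [Metric.mem_ball, dist_eq_norm] at h1 ⊢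
        calc ‖(α ((x, I), τ)).1 + (α ((x, I), τ)).2 h - x₀‖
            = ‖((α ((x, I), τ)).1 - x₀) + (α ((x, I), τ)).2 h‖ := by congr 1; abel
          _ ≤ ‖(α ((x, I), τ)).1 - x₀‖ + ‖(α ((x, I), τ)).2 h‖ := norm_add_le _ _
          _ ≤ ‖(α ((x, I), τ)).1 - x₀‖ + m * ‖h‖ := by
              gcongr
              exact ((α ((x, I), τ)).2.le_opNorm h).trans (by gcongr)
          _ < ρ := by linarith
      have key : ‖(α ((x + h, I), t)).1 - (α ((x, I), t)).1 - (α ((x, I), t)).2 h‖ ≤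
          gronwallBound 0 K (C * (m * ‖h‖) ^ 2) |t| := by
        rcases le_total 0 t with h0 | h0
        · rw [abs_of_nonneg h0]
          have hsubI : ∀ τ ∈ Icc 0 t, τ ∈ Ioo (-ε) ε := fun τ hτ =>
            ⟨by linarith [hτ.1], by linarith [hτ.2, ht.2]⟩
          exact norm_sub_variation_le (convex_ball x₀ ρ) hds hKs hCs (T := t)
            (fun τ hτ => hder1 x hx τ (hsubI τ hτ)) (fun τ hτ => hder1 _ hxh τ (hsubI τ hτ))
            (fun τ hτ => hder2 x hx τ (hsubI τ hτ))
            (fun τ hτ => hsub (hnear' x hx τ (hsubI τ hτ)).1)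
            (fun τ hτ => hsub (hnear' _ hxh τ (hsubI τ hτ)).1)
            (fun τ hτ => hin τ (hsubI τ hτ)) (fun τ hτ => (hnear' x hx τ (hsubI τ hτ)).2.le)
            (by simp [hinit x hx, I]) (by simp [hinit x hx, hinit _ hxh]) t ⟨h0, le_rfl⟩
        · rw [abs_of_nonpos h0]
          have hsubI : ∀ τ ∈ Icc 0 (-t), -τ ∈ Ioo (-ε) ε := fun τ hτ =>
            ⟨by linarith [hτ.2, ht.1], by linarith [hτ.1]⟩
          have hneg : ∀ τ : ℝ, HasDerivAt (fun τ : ℝ => -τ) (-1) τ := fun τ => hasDerivAt_neg τ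
          -- Negative times are positive times for the opposite field.
          have := norm_sub_variation_le (convex_ball x₀ ρ) (f := fun z => - f z)
            (f' := fun z => - fderiv ℝ f z) (K := K) (C := C) (T := -t)
            (fun z hz => (hds z hz).neg) hKs.neg hCs.neg
            (X := fun τ => (α ((x, I), -τ)).1) (Y := fun τ => (α ((x + h, I), -τ)).1)
            (Φ := fun τ => (α ((x, I), -τ)).2) (m := m) (h := h)
            (fun τ hτ => by
              simpa using! (hder1 x hx (-τ) (hsubI τ hτ)).scomp τ (hneg τ))
            (fun τ hτ => by
              simpa using! (hder1 _ hxh (-τ) (hsubI τ hτ)).scomp τ (hneg τ))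
            (fun τ hτ => by
              simpa using! (hder2 x hx (-τ) (hsubI τ hτ)).scomp τ (hneg τ))
            (fun τ hτ => hsub (hnear' x hx _ (hsubI τ hτ)).1)
            (fun τ hτ => hsub (hnear' _ hxh _ (hsubI τ hτ)).1)
            (fun τ hτ => hin _ (hsubI τ hτ)) (fun τ hτ => (hnear' x hx _ (hsubI τ hτ)).2.le)
            (by simp [hinit x hx, I]) (by simp [hinit x hx, hinit _ hxh]) (-t)
            ⟨by linarith, le_rfl⟩
          simpa using this
      refine key.trans (le_of_eq ?_)
      rw [gronwallBound_zero_eq_mul]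
      ring
    rw [hasFDerivAt_iff_isLittleO_nhds_zero]
    refine (Asymptotics.IsBigO.of_bound (g := fun h : E => ‖h‖ ^ 2)
      (C * m ^ 2 * gronwallBound 0 K 1 |t|) ?_).trans_isLittleO
      (Asymptotics.isLittleO_norm_pow_id one_lt_two)
    filter_upwards [hbound] with h hh
    simpa using hh
  intro x hx
  refine ContDiffAt.contDiffWithinAt ?_
  rw [contDiffAt_one_iff]
  refine ⟨fun x => (α ((x, I), t)).2, U, Metric.isOpen_ball.mem_nhds hx, ?_, main⟩
  have h1 : Continuous (fun x : E => (x, t)) := by fun_prop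
  exact (hcontU.comp h1.continuousOn fun z hz => ⟨hz, ht⟩).snd

end Flow


/-! ### Local flows on manifolds -/

section ManifoldFlow

variable {M : Type*} [TopologicalSpace M] [ChartedSpace E3 M] [IsManifold 𝓘(ℝ, E3) ∞ M]

/-- A smooth vector field has a local flow which is `C^1` in the initial condition. -/
theorem exists_localFlow {v : (x : M) → TangentSpace 𝓘(ℝ, E3) x} (hv : IsSmoothVectorField v)
    (x₀ : M) : ∃ (F : M → ℝ → M) (O : Set M) (ε : ℝ), 0 < ε ∧ IsOpen O ∧ x₀ ∈ O ∧
      (∀ x ∈ O, F x 0 = x) ∧ (∀ x ∈ O, IsMIntegralCurveOn (F x) v (Ioo (-ε) ε)) ∧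
      ContinuousOn (fun z : M × ℝ => F z.1 z.2) (O ×ˢ Ioo (-ε) ε) ∧
      ∀ t ∈ Ioo (-ε) ε, ContMDiffOn 𝓘(ℝ, E3) 𝓘(ℝ, E3) 1 (fun x => F x t) O := by
  have hv0 := hv x₀
  have : IsManifold 𝓘(ℝ, E3) 1 M := IsManifold.of_le (n := ∞) (by norm_num)
  rw [contMDiffAt_iff] at hv0
  set f : E3 → E3 := fun y => tangentCoordChange 𝓘(ℝ, E3) ((extChartAt 𝓘(ℝ, E3) x₀).symm y) x₀
    ((extChartAt 𝓘(ℝ, E3) x₀).symm y) (v ((extChartAt 𝓘(ℝ, E3) x₀).symm y)) with hfdef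
  have hf : ContDiffAt ℝ ∞ f (extChartAt 𝓘(ℝ, E3) x₀ x₀) :=
    (hv0.2.contDiffAt (range_mem_nhds_isInteriorPoint
      BoundarylessManifold.isInteriorPoint)).snd
  have htgt : IsOpen (extChartAt 𝓘(ℝ, E3) x₀).target := isOpen_extChartAt_target x₀
  obtain ⟨G, U, ε, hε, hU, hxU, hG0, hG, hGc, hGd⟩ := exists_localFlow_contDiffOn
    (by exact_mod_cast contDiffAt_infty.1 hf 2)
    (htgt.mem_nhds (mem_extChartAt_target x₀))
  have hO : IsOpen ((extChartAt 𝓘(ℝ, E3) x₀).source ∩ (extChartAt 𝓘(ℝ, E3) x₀) ⁻¹' U) :=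
    (continuousOn_extChartAt x₀).isOpen_inter_preimage (isOpen_extChartAt_source x₀) hU
  refine ⟨fun x t => (extChartAt 𝓘(ℝ, E3) x₀).symm (G (extChartAt 𝓘(ℝ, E3) x₀ x) t), _, ε, hε, hO,
    ⟨mem_extChartAt_source x₀, hxU⟩, ?_, ?_, ?_, ?_⟩
  · rintro x ⟨hx, hx'⟩
    simp only
    rw [hG0 _ hx', (extChartAt 𝓘(ℝ, E3) x₀).left_inv hx]
  · rintro x ⟨hx, hx'⟩ t ht
    obtain ⟨hf3', h⟩ := hG _ hx' t ht
    set y := extChartAt 𝓘(ℝ, E3) x₀ x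
    set xt : M := (extChartAt 𝓘(ℝ, E3) x₀).symm (G y t) with hxt
    rw [hfdef] at h
    have hft1 : xt ∈ (extChartAt 𝓘(ℝ, E3) x₀).source :=
      (extChartAt 𝓘(ℝ, E3) x₀).map_target hf3'
    have hft2 := mem_extChartAt_source (I := 𝓘(ℝ, E3)) xt
    apply HasMFDerivAt.hasMFDerivWithinAt
    let u : E3 := v xt
    suffices hu : HasDerivWithinAt ((extChartAt 𝓘(ℝ, E3) xt ∘ (extChartAt 𝓘(ℝ, E3) x₀).symm) ∘ G y)
        u (range 𝓘(ℝ, ℝ)) t from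
      ⟨(continuousAt_extChartAt_symm'' hf3').comp h.continuousAt, hu.hasFDerivWithinAt⟩
    rw [ModelWithCorners.Boundaryless.range_eq_univ, hasDerivWithinAt_univ]
    have e : tangentCoordChange 𝓘(ℝ, E3) x₀ xt xt (tangentCoordChange 𝓘(ℝ, E3) xt x₀ xt u) = u :=
      (tangentCoordChange_comp ⟨⟨hft2, hft1⟩, hft2⟩).trans (tangentCoordChange_self hft2)
    refine HasDerivAt.congr_deriv ?_ e
    apply HasFDerivAt.comp_hasDerivAt _ _ h
    apply HasFDerivWithinAt.hasFDerivAt (s := range 𝓘(ℝ, E3)) _ (by simp)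
    rw [← (extChartAt 𝓘(ℝ, E3) x₀).right_inv hf3']
    exact hasFDerivWithinAt_tangentCoordChange ⟨hft1, hft2⟩
  · refine (continuousOn_extChartAt_symm x₀).comp (hGc.comp
      (f := fun z : M × ℝ => (extChartAt 𝓘(ℝ, E3) x₀ z.1, z.2)) ?_ ?_) ?_
    · exact ContinuousOn.prodMk ((continuousOn_extChartAt x₀).comp continuousOn_fst
        fun z hz => hz.1.1) continuousOn_snd
    · exact fun z hz => ⟨hz.1.2, hz.2⟩
    · exact fun z hz => (hG _ hz.1.2 _ hz.2).1
  · intro t ht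
    have h1 : ContMDiffOn 𝓘(ℝ, E3) 𝓘(ℝ, E3) 1 (extChartAt 𝓘(ℝ, E3) x₀)
        (extChartAt 𝓘(ℝ, E3) x₀).source := by
      simpa using (contMDiffOn_extChartAt (I := 𝓘(ℝ, E3)) (n := 1) (x := x₀))
    have h2 := contMDiffOn_extChartAt_symm (I := 𝓘(ℝ, E3)) (n := 1) x₀
    refine h2.comp (((hGd t ht).contMDiffOn).comp (h1.mono inter_subset_left) fun z hz => hz.2) ?_
    exact fun z hz => (hG _ hz.2 _ ht).1

end ManifoldFlow


/-! ### Flows of linear vector fields -/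

section LinearFlow

variable {E : Type*} [NormedAddCommGroup E] [NormedSpace ℝ E] [CompleteSpace E]

/-- The flow `e^{tA}` of the linear vector field `A`. -/
noncomputable def linearFlow (A : E →L[ℝ] E) (t : ℝ) : E →L[ℝ] E := NormedSpace.exp (t • A)

omit [CompleteSpace E] in
@[simp] theorem linearFlow_zero (A : E →L[ℝ] E) : linearFlow A 0 = 1 := by
  simp [linearFlow]

theorem linearFlow_add (A : E →L[ℝ] E) (s t : ℝ) (y : E) :
    linearFlow A (s + t) y = linearFlow A s (linearFlow A t y) := by
  let _ : NormedAlgebra ℚ (E →L[ℝ] E) := NormedAlgebra.restrictScalars ℚ ℝ _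
  have : Commute (s • A) (t • A) := ((Commute.refl A).smul_left s).smul_right t
  rw [linearFlow, add_smul, NormedSpace.exp_add_of_commute this]
  rfl

theorem hasDerivAt_linearFlow (A : E →L[ℝ] E) (t : ℝ) :
    HasDerivAt (linearFlow A) (A * linearFlow A t) t :=
  hasDerivAt_exp_smul_const' A t

theorem linearFlow_comm (A : E →L[ℝ] E) (t : ℝ) (y : E) :
    linearFlow A t (A y) = A (linearFlow A t y) := by
  have := (hasDerivAt_exp_smul_const (𝕂 := ℝ) A t).unique (hasDerivAt_exp_smul_const' A t)
  exact DFunLike.congr_fun this y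

theorem hasDerivAt_linearFlow_apply (A : E →L[ℝ] E) (y : E) (t : ℝ) :
    HasDerivAt (fun t => linearFlow A t y) (A (linearFlow A t y)) t := by
  simpa using (hasDerivAt_linearFlow A t).clm_apply (hasDerivAt_const t y)

theorem continuous_linearFlow (A : E →L[ℝ] E) : Continuous (linearFlow A) :=
  continuous_iff_continuousAt.2 fun t => (hasDerivAt_linearFlow A t).continuousAt

theorem linearFlow_neg_apply (A : E →L[ℝ] E) (t : ℝ) (y : E) :
    linearFlow A (-t) (linearFlow A t y) = y := by
  rw [← linearFlow_add]; simp

theorem linearFlow_apply_neg (A : E →L[ℝ] E) (t : ℝ) (y : E) :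
    linearFlow A t (linearFlow A (-t) y) = y := by
  rw [← linearFlow_add]; simp

/-- The linear automorphism `e^{tA}`. -/
noncomputable def linearFlowEquiv (A : E →L[ℝ] E) (t : ℝ) : E ≃L[ℝ] E :=
  ContinuousLinearEquiv.equivOfInverse (linearFlow A t) (linearFlow A (-t))
    (linearFlow_neg_apply A t) (linearFlow_apply_neg A t)

@[simp] theorem linearFlowEquiv_apply (A : E →L[ℝ] E) (t : ℝ) (y : E) :
    linearFlowEquiv A t y = linearFlow A t y := rfl

/-- Solutions of a linear differential equation. -/
theorem eq_linearFlow_of_hasDerivWithinAt {A : E →L[ℝ] E} {c : ℝ → E} {a b : ℝ}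
    (hc : ∀ t ∈ Icc a b, HasDerivWithinAt c (A (c t)) (Icc a b) t) :
    ∀ t ∈ Icc a b, c t = linearFlow A (t - a) (c a) := by
  have hder : ∀ t, HasDerivAt (fun t => linearFlow A (t - a) (c a))
      (A (linearFlow A (t - a) (c a))) t := fun t =>
    (hasDerivAt_linearFlow_apply A (c a) (t - a)).comp_sub_const t a
  refine ODE_solution_unique_of_mem_Icc_right (v := fun _ => A) (s := fun _ => univ)
    (K := ‖A‖₊) (fun t _ => A.lipschitz.lipschitzOnWith)
    (fun t ht => (hc t ht).continuousWithinAt) (fun t ht => ?_) (fun _ _ => trivial)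
    (fun t _ => (hder t).continuousAt.continuousWithinAt) (fun t _ => (hder t).hasDerivWithinAt)
    (fun _ _ => trivial) (by simp)
  exact (hc t (Ico_subset_Icc_self ht)).mono_of_mem_nhdsWithin (Icc_mem_nhdsGE_of_mem ht)

end LinearFlow

/-! ### Charts conjugating a vector field to a flow -/

section Conjugation

variable {M : Type*} [TopologicalSpace M] [ChartedSpace E3 M]

/-- The chart `P` conjugates the vector field `v` to the flow `S`. -/
def Conjugates {Y : Type*} [TopologicalSpace Y] (v : (x : M) → TangentSpace 𝓘(ℝ, E3) x)
    (S : ℝ → Y → Y) (P : OpenPartialHomeomorph M Y) : Prop :=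
  ∀ (a b : ℝ) (γ : ℝ → M), a ≤ b → (∀ t ∈ Icc a b, γ t ∈ P.source) →
    (IsMIntegralCurveOn γ v (Icc a b) ↔ ∀ t ∈ Icc a b, P (γ t) = S (t - a) (P (γ a)))

/-- The chart `φ` is a `C^1` diffeomorphism taking the vector field `v` to the linear one `A`. -/
structure IsLinearisingChart (v : (x : M) → TangentSpace 𝓘(ℝ, E3) x) (A : E3 →L[ℝ] E3)
    (φ : OpenPartialHomeomorph M E3) : Prop where
  contMDiffAt : ∀ x ∈ φ.source, ContMDiffAt 𝓘(ℝ, E3) 𝓘(ℝ, E3) 1 φ x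
  contMDiffAt_symm : ∀ y ∈ φ.target, ContMDiffAt 𝓘(ℝ, E3) 𝓘(ℝ, E3) 1 φ.symm y
  mfderiv_apply : ∀ x ∈ φ.source, mfderiv 𝓘(ℝ, E3) 𝓘(ℝ, E3) φ x (v x) = A (φ x)

variable {v : (x : M) → TangentSpace 𝓘(ℝ, E3) x} {A : E3 →L[ℝ] E3}
  {φ : OpenPartialHomeomorph M E3}

theorem hasMFDerivWithinAt_congr_velocity {γ : ℝ → M} {s : Set ℝ} {t : ℝ}
    {L : ℝ →L[ℝ] TangentSpace 𝓘(ℝ, E3) (γ t)} {u : TangentSpace 𝓘(ℝ, E3) (γ t)}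
    (h : HasMFDerivWithinAt 𝓘(ℝ, ℝ) 𝓘(ℝ, E3) γ s t L) (hL : L 1 = u) :
    HasMFDerivWithinAt 𝓘(ℝ, ℝ) 𝓘(ℝ, E3) γ s t ((1 : ℝ →L[ℝ] ℝ).smulRight u) := by
  have : L = (1 : ℝ →L[ℝ] ℝ).smulRight u := ContinuousLinearMap.ext_ring (by simp [hL])
  exact this ▸ h

namespace IsLinearisingChart

theorem hasMFDerivAt (h : IsLinearisingChart v A φ) {x : M} (hx : x ∈ φ.source) :
    HasMFDerivAt 𝓘(ℝ, E3) 𝓘(ℝ, E3) φ x (mfderiv 𝓘(ℝ, E3) 𝓘(ℝ, E3) φ x) :=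
  ((h.contMDiffAt x hx).mdifferentiableAt one_ne_zero).hasMFDerivAt

theorem hasMFDerivAt_symm (h : IsLinearisingChart v A φ) {y : E3} (hy : y ∈ φ.target) :
    HasMFDerivAt 𝓘(ℝ, E3) 𝓘(ℝ, E3) φ.symm y (mfderiv 𝓘(ℝ, E3) 𝓘(ℝ, E3) φ.symm y) :=
  ((h.contMDiffAt_symm y hy).mdifferentiableAt one_ne_zero).hasMFDerivAt

theorem mfderiv_symm_mfderiv (h : IsLinearisingChart v A φ) {x : M} (hx : x ∈ φ.source)
    (u : TangentSpace 𝓘(ℝ, E3) x) :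
    mfderiv 𝓘(ℝ, E3) 𝓘(ℝ, E3) φ.symm (φ x) (mfderiv 𝓘(ℝ, E3) 𝓘(ℝ, E3) φ x u) = u := by
  have h1 := (h.hasMFDerivAt_symm (φ.map_source hx)).comp x (h.hasMFDerivAt hx)
  have h2 : HasMFDerivAt 𝓘(ℝ, E3) 𝓘(ℝ, E3) (φ.symm ∘ φ) x
      (ContinuousLinearMap.id ℝ (TangentSpace 𝓘(ℝ, E3) x)) :=
    (hasMFDerivAt_id x).congr_of_eventuallyEq (φ.eventually_left_inverse hx)
  exact DFunLike.congr_fun (hasMFDerivAt_unique h1 h2) u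

theorem mfderiv_mfderiv_symm (h : IsLinearisingChart v A φ) {x : M} (hx : x ∈ φ.source) (u : E3) :
    mfderiv 𝓘(ℝ, E3) 𝓘(ℝ, E3) φ x (mfderiv 𝓘(ℝ, E3) 𝓘(ℝ, E3) φ.symm (φ x) u) = u := by
  have h0 : HasMFDerivAt 𝓘(ℝ, E3) 𝓘(ℝ, E3) φ (φ.symm (φ x))
      (mfderiv 𝓘(ℝ, E3) 𝓘(ℝ, E3) φ (φ.symm (φ x))) :=
    h.hasMFDerivAt (φ.map_target (φ.map_source hx))
  have h1 := h0.comp (φ x) (h.hasMFDerivAt_symm (φ.map_source hx))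
  have h2 : HasMFDerivAt 𝓘(ℝ, E3) 𝓘(ℝ, E3) (φ ∘ φ.symm) (φ x)
      (ContinuousLinearMap.id ℝ (TangentSpace 𝓘(ℝ, E3) (φ x))) :=
    (hasMFDerivAt_id (φ x)).congr_of_eventuallyEq
      (φ.eventually_right_inverse (φ.map_source hx))
  have h3 := DFunLike.congr_fun (hasMFDerivAt_unique h1 h2) u
  have hx' : φ.symm (φ x) = x := φ.left_inv hx
  rw [hx'] at h3
  exact h3

theorem mfderiv_symm_apply (h : IsLinearisingChart v A φ) {y : E3} (hy : y ∈ φ.target) :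
    mfderiv 𝓘(ℝ, E3) 𝓘(ℝ, E3) φ.symm y (A y) = v (φ.symm y) := by
  have h1 := h.mfderiv_symm_mfderiv (φ.map_target hy) (v (φ.symm y))
  rw [h.mfderiv_apply _ (φ.map_target hy), φ.right_inv hy] at h1
  exact h1

theorem hasDerivWithinAt_comp (h : IsLinearisingChart v A φ) {γ : ℝ → M} {s : Set ℝ} {t : ℝ}
    (hγ : HasMFDerivWithinAt 𝓘(ℝ, ℝ) 𝓘(ℝ, E3) γ s t ((1 : ℝ →L[ℝ] ℝ).smulRight (v (γ t))))
    (ht : γ t ∈ φ.source) : HasDerivWithinAt (fun t => φ (γ t)) (A (φ (γ t))) s t := by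
  have h1 := (h.hasMFDerivAt ht).comp_hasMFDerivWithinAt t hγ
  rw [hasMFDerivWithinAt_iff_hasFDerivWithinAt] at h1
  let D : E3 →L[ℝ] E3 := mfderiv 𝓘(ℝ, E3) 𝓘(ℝ, E3) φ (γ t)
  let u : E3 := v (γ t)
  have h2 : HasFDerivWithinAt (fun t => φ (γ t)) (D.comp ((1 : ℝ →L[ℝ] ℝ).smulRight u)) s t := h1
  refine h2.hasDerivWithinAt.congr_deriv ?_
  rw [← h.mfderiv_apply _ ht]
  change D ((1 : ℝ) • u) = D u
  rw [one_smul]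

theorem hasMFDerivWithinAt_symm_comp (h : IsLinearisingChart v A φ) {c : ℝ → E3} {s : Set ℝ}
    {t : ℝ} (hc : HasDerivWithinAt c (A (c t)) s t) (ht : c t ∈ φ.target) :
    HasMFDerivWithinAt 𝓘(ℝ, ℝ) 𝓘(ℝ, E3) (fun t => φ.symm (c t)) s t
      ((1 : ℝ →L[ℝ] ℝ).smulRight (v (φ.symm (c t)))) := by
  have h0 := hc.hasFDerivWithinAt.hasMFDerivWithinAt
  refine hasMFDerivWithinAt_congr_velocity
    ((h.hasMFDerivAt_symm ht).comp_hasMFDerivWithinAt t h0) ?_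
  rw [← h.mfderiv_symm_apply ht]
  change mfderiv 𝓘(ℝ, E3) 𝓘(ℝ, E3) φ.symm (c t) ((1 : ℝ) • A (c t)) = _
  rw [one_smul]

/-- A linearising chart conjugates the vector field to the linear flow. -/
theorem conjugates (h : IsLinearisingChart v A φ) : Conjugates v (fun t => linearFlow A t) φ := by
  intro a b γ hab hγs
  constructor
  · intro hγ
    exact eq_linearFlow_of_hasDerivWithinAt fun t ht =>
      h.hasDerivWithinAt_comp (hγ t ht) (hγs t ht)
  · intro hγ t ht
    beta_reduce at hγ
    have hder : HasDerivWithinAt (fun t => linearFlow A (t - a) (φ (γ a)))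
        (A (linearFlow A (t - a) (φ (γ a)))) (Icc a b) t :=
      ((hasDerivAt_linearFlow_apply A (φ (γ a)) (t - a)).comp_sub_const t a).hasDerivWithinAt
    have hmem : linearFlow A (t - a) (φ (γ a)) ∈ φ.target := by
      rw [← hγ t ht]; exact φ.map_source (hγs t ht)
    have h1 := h.hasMFDerivWithinAt_symm_comp hder hmem
    have h2 : ∀ t ∈ Icc a b, γ t = φ.symm (linearFlow A (t - a) (φ (γ a))) := fun t ht => by
      rw [← hγ t ht, φ.left_inv (hγs t ht)]
    have h3 := h1.congr_of_eventuallyEq (f₁ := γ)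
      (by filter_upwards [self_mem_nhdsWithin] with t ht using h2 t ht) (h2 t ht)
    rw [← h2 t ht] at h3
    exact h3

end IsLinearisingChart

end Conjugation


/-! ### Extension of a linearising chart along an orbit -/

section Extension

variable {M : Type*} [TopologicalSpace M] [T2Space M] [ChartedSpace E3 M]
  [IsManifold 𝓘(ℝ, E3) ∞ M]

omit [T2Space M] in
theorem IsSmoothVectorField.contMDiff_one {v : (x : M) → TangentSpace 𝓘(ℝ, E3) x}
    (hv : IsSmoothVectorField v) : ContMDiff 𝓘(ℝ, E3) 𝓘(ℝ, E3).tangent 1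
      (fun x => (⟨x, v x⟩ : TangentBundle 𝓘(ℝ, E3) M)) :=
  ContMDiff.of_le hv (by exact_mod_cast le_top)

theorem eqOn_of_isMIntegralCurveOn {v : (x : M) → TangentSpace 𝓘(ℝ, E3) x}
    (hv : IsSmoothVectorField v) {γ₁ γ₂ : ℝ → M} {a b t₀ : ℝ} (ht₀ : t₀ ∈ Ioo a b)
    (h₁ : IsMIntegralCurveOn γ₁ v (Ioo a b)) (h₂ : IsMIntegralCurveOn γ₂ v (Ioo a b))
    (h : γ₁ t₀ = γ₂ t₀) : EqOn γ₁ γ₂ (Ioo a b) :=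
  have : IsManifold 𝓘(ℝ, E3) 1 M := IsManifold.of_le (n := ∞) (by norm_num)
  isMIntegralCurveOn_Ioo_eqOn_of_contMDiff_boundaryless ht₀ hv.contMDiff_one h₁ h₂ h

/-- Uniqueness of integral curves, on the interval around `0` where both the flow from `F x r` and
the shifted flow from `x` are defined. -/
theorem localFlow_add {v : (x : M) → TangentSpace 𝓘(ℝ, E3) x} (hv : IsSmoothVectorField v)
    {F : M → ℝ → M} {O : Set M} {ε : ℝ} (hF0 : ∀ x ∈ O, F x 0 = x)
    (hF : ∀ x ∈ O, IsMIntegralCurveOn (F x) v (Ioo (-ε) ε)) {x : M} {r t : ℝ} (hx : x ∈ O)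
    (hr : r ∈ Ioo (-ε) ε) (ht : t ∈ Ioo (-ε) ε) (hrt : r + t ∈ Ioo (-ε) ε) (hxr : F x r ∈ O) :
    F (F x r) t = F x (t + r) := by
  have h1 : IsMIntegralCurveOn (F (F x r)) v (Ioo (max (-ε) (-ε - r)) (min ε (ε - r))) :=
    (hF _ hxr).mono (Ioo_subset_Ioo (le_max_left _ _) (min_le_left _ _))
  have h2 : IsMIntegralCurveOn (F x ∘ (· + r)) v (Ioo (max (-ε) (-ε - r)) (min ε (ε - r))) := by
    refine ((hF x hx).comp_add r).mono ?_
    rintro s ⟨hs1, hs2⟩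
    have := (le_max_right _ _).trans_lt hs1
    have := hs2.trans_le (min_le_right _ _)
    exact ⟨by linarith, by linarith⟩
  have := eqOn_of_isMIntegralCurveOn hv (t₀ := 0)
    ⟨max_lt (by linarith [hr.1, hr.2]) (by linarith [hr.1, hr.2]),
      lt_min (by linarith [hr.1, hr.2]) (by linarith [hr.1, hr.2])⟩ h1 h2
    (by simp [hF0 _ hxr])
  exact this ⟨max_lt ht.1 (by linarith [hrt.1]), lt_min ht.2 (by linarith [hrt.2])⟩

/-- The time `r` map of a local flow. -/
theorem exists_openPartialHomeomorph_localFlow {v : (x : M) → TangentSpace 𝓘(ℝ, E3) x}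
    (hv : IsSmoothVectorField v) {F : M → ℝ → M} {O : Set M} {ε : ℝ} (hO : IsOpen O)
    (hF0 : ∀ x ∈ O, F x 0 = x) (hF : ∀ x ∈ O, IsMIntegralCurveOn (F x) v (Ioo (-ε) ε))
    (hFd : ∀ t ∈ Ioo (-ε) ε, ContMDiffOn 𝓘(ℝ, E3) 𝓘(ℝ, E3) 1 (fun x => F x t) O)
    {r : ℝ} (hr : r ∈ Ioo (-ε) ε) :
    ∃ g : OpenPartialHomeomorph M M, g.source = O ∩ (fun x => F x r) ⁻¹' O ∧
      g.target ⊆ O ∧ (⇑g = fun x => F x r) ∧ (⇑g.symm = fun x => F x (-r)) := by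
  have hε : 0 < ε := by linarith [hr.1, hr.2]
  have hr' : -r ∈ Ioo (-ε) ε := ⟨by linarith [hr.2], by linarith [hr.1]⟩
  have key : ∀ r ∈ Ioo (-ε) ε, ∀ x ∈ O ∩ (fun x => F x r) ⁻¹' O, F (F x r) (-r) = x := by
    rintro r hr x ⟨hx, hx'⟩
    rw [localFlow_add hv hF0 hF hx hr ⟨by linarith [hr.2], by linarith [hr.1]⟩
      (by simpa using hε) hx']
    simpa using hF0 x hx
  refine ⟨{
    toFun := fun x => F x r
    invFun := fun x => F x (-r)
    source := O ∩ (fun x => F x r) ⁻¹' O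
    target := O ∩ (fun x => F x (-r)) ⁻¹' O
    map_source' := fun x hx => ⟨hx.2, by
      have := key r hr x hx
      simp only [mem_preimage, this]
      exact hx.1⟩
    map_target' := fun x hx => ⟨hx.2, by
      have := key (-r) hr' x hx
      rw [neg_neg] at this
      simp only [mem_preimage, this]
      exact hx.1⟩
    left_inv' := fun x hx => key r hr x hx
    right_inv' := fun x hx => by simpa using key (-r) hr' x hx
    open_source := (hFd r hr).continuousOn.isOpen_inter_preimage hO hO
    open_target := (hFd (-r) hr').continuousOn.isOpen_inter_preimage hO hO
    continuousOn_toFun := (hFd r hr).continuousOn.mono inter_subset_left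
    continuousOn_invFun := (hFd (-r) hr').continuousOn.mono inter_subset_left }, rfl,
    inter_subset_left, rfl, rfl⟩

/-- A linearising chart, transported by a time map of a local flow. -/
theorem IsLinearisingChart.exists_transport {v : (x : M) → TangentSpace 𝓘(ℝ, E3) x}
    {A : E3 →L[ℝ] E3} {φ : OpenPartialHomeomorph M E3} (hv : IsSmoothVectorField v)
    (hφ : IsLinearisingChart v A φ) {F : M → ℝ → M} {O : Set M} {ε : ℝ} (hO : IsOpen O)
    (hF0 : ∀ x ∈ O, F x 0 = x) (hF : ∀ x ∈ O, IsMIntegralCurveOn (F x) v (Ioo (-ε) ε))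
    (hFd : ∀ t ∈ Ioo (-ε) ε, ContMDiffOn 𝓘(ℝ, E3) 𝓘(ℝ, E3) 1 (fun x => F x t) O)
    {r : ℝ} (hr : r ∈ Ioo (-ε) ε) :
    ∃ f : OpenPartialHomeomorph M E3, IsLinearisingChart v A f ∧
      (∀ x ∈ O, F x r ∈ O → F x r ∈ φ.source → x ∈ f.source) ∧
      ∀ x, f x = linearFlow A (-r) (φ (F x r)) := by
  obtain ⟨g, hgs, hgt, hg, hgsymm⟩ := exists_openPartialHomeomorph_localFlow hv hO hF0 hF hFd hr
  have hr' : -r ∈ Ioo (-ε) ε := ⟨by linarith [hr.2], by linarith [hr.1]⟩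
  have hε : 0 < ε := by linarith [hr.1, hr.2]
  -- Flow for time `r` into the domain of `φ`, apply `φ`, and come back by the linear flow.
  let f : OpenPartialHomeomorph M E3 :=
    (g.trans φ).transHomeomorph (linearFlowEquiv A (-r)).toHomeomorph
  have hfapp : ∀ x, f x = linearFlow A (-r) (φ (F x r)) := fun x => by
    simp [f, hg]
  have hfs : ∀ x, x ∈ f.source ↔ (x ∈ O ∧ F x r ∈ O) ∧ F x r ∈ φ.source := fun x => by
    simp [f, hgs, hg]
  have hC1 : ∀ x ∈ f.source, ContMDiffAt 𝓘(ℝ, E3) 𝓘(ℝ, E3) 1 f x := by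
    intro x hx
    have hx' := (hfs x).1 hx
    have h1 : ContMDiffAt 𝓘(ℝ, E3) 𝓘(ℝ, E3) 1 (fun x => F x r) x :=
      (hFd r hr).contMDiffAt (hO.mem_nhds hx'.1.1)
    have h2 := (hφ.contMDiffAt _ hx'.2).comp x h1
    rw [show ⇑f = (linearFlow A (-r)) ∘ (φ ∘ fun x => F x r) from funext hfapp]
    exact ((linearFlow A (-r)).contDiff.contMDiff.contMDiffAt).comp x h2
  refine ⟨f, ⟨hC1, ?_, ?_⟩, fun x h1 h2 h3 => (hfs x).2 ⟨⟨h1, h2⟩, h3⟩, hfapp⟩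
  · intro y hy
    have hy' : (linearFlowEquiv A (-r)).symm y ∈ φ.target ∧
        φ.symm ((linearFlowEquiv A (-r)).symm y) ∈ g.target := by
      simpa [f] using hy
    have h1 : ContMDiffAt 𝓘(ℝ, E3) 𝓘(ℝ, E3) 1 (linearFlowEquiv A (-r)).symm y :=
      (linearFlowEquiv A (-r)).symm.contDiff.contMDiff.contMDiffAt
    have h2 := (hφ.contMDiffAt_symm _ hy'.1).comp y h1
    have h3 : ContMDiffAt 𝓘(ℝ, E3) 𝓘(ℝ, E3) 1 (fun x => F x (-r))
        (φ.symm ((linearFlowEquiv A (-r)).symm y)) :=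
      (hFd (-r) hr').contMDiffAt (hO.mem_nhds (hgt hy'.2))
    have h4 := h3.comp y h2
    have h5 : ⇑f.symm = (fun x => F x (-r)) ∘ (φ.symm ∘ (linearFlowEquiv A (-r)).symm) := by
      rw [← hgsymm]; rfl
    rw [h5]
    exact h4
  · intro x hx
    have hx' := (hfs x).1 hx
    -- the velocity of `f ∘ F x` at time zero, computed in two ways
    have hFx : HasMFDerivAt 𝓘(ℝ, ℝ) 𝓘(ℝ, E3) (F x) 0
        ((1 : ℝ →L[ℝ] ℝ).smulRight (v (F x 0))) :=
      (hF x hx'.1.1 0 ⟨by linarith, hε⟩).hasMFDerivAt (Ioo_mem_nhds (by linarith) hε)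
    have hfx : HasMFDerivAt 𝓘(ℝ, E3) 𝓘(ℝ, E3) f (F x 0)
        (mfderiv 𝓘(ℝ, E3) 𝓘(ℝ, E3) f (F x 0)) := by
      rw [hF0 x hx'.1.1]
      exact ((hC1 x hx).mdifferentiableAt one_ne_zero).hasMFDerivAt
    have h1 := hfx.comp 0 hFx
    rw [hasMFDerivAt_iff_hasFDerivAt] at h1
    let D : E3 →L[ℝ] E3 := mfderiv 𝓘(ℝ, E3) 𝓘(ℝ, E3) f (F x 0)
    let u : E3 := v (F x 0)
    have h1' : HasFDerivAt (f ∘ F x) (D.comp ((1 : ℝ →L[ℝ] ℝ).smulRight u)) 0 := h1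
    have h1'' : HasDerivAt (f ∘ F x) (D u) 0 := by
      refine h1'.hasDerivAt.congr_deriv ?_
      change D ((1 : ℝ) • u) = D u
      rw [one_smul]
    have hFr : HasMFDerivAt 𝓘(ℝ, ℝ) 𝓘(ℝ, E3) (F x) (0 + r)
        ((1 : ℝ →L[ℝ] ℝ).smulRight (v (F x (0 + r)))) := by
      rw [zero_add]
      exact (hF x hx'.1.1 r hr).hasMFDerivAt (Ioo_mem_nhds hr.1 hr.2)
    have h2 : HasDerivAt (fun t => φ (F x t)) (A (φ (F x (0 + r)))) (0 + r) := by
      have := hφ.hasDerivWithinAt_comp (s := univ) hFr.hasMFDerivWithinAt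
        (by simpa using hx'.2)
      simpa using this
    have h3 : HasDerivAt (fun t => φ (F x (t + r))) (A (φ (F x (0 + r)))) 0 :=
      h2.comp_add_const 0 r
    have h4 : HasDerivAt (fun t => linearFlow A (-r) (φ (F x (t + r))))
        (linearFlow A (-r) (A (φ (F x (0 + r))))) 0 :=
      (linearFlow A (-r)).hasFDerivAt.comp_hasDerivAt 0 h3
    have h5 : (f ∘ F x) =ᶠ[𝓝 0] fun t => linearFlow A (-r) (φ (F x (t + r))) := by
      have hc1 : ContinuousAt (F x) 0 := hFx.continuousAt
      have hc2 : ContinuousAt (fun t => t + r) 0 := by fun_prop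
      have hmem : ∀ᶠ t in 𝓝 (0 : ℝ), F x t ∈ f.source :=
        hc1.eventually_mem (f.open_source.mem_nhds (by rwa [hF0 x hx'.1.1]))
      filter_upwards [hmem, Ioo_mem_nhds (neg_lt_zero.2 hε) hε,
        hc2.eventually_mem (Ioo_mem_nhds (a := -ε) (b := ε) (by simpa using hr.1)
          (by simpa using hr.2))] with t ht1 ht2 ht3
      have ht4 := ((hfs _).1 ht1).1
      simp only [Function.comp_apply, hfapp]
      rw [localFlow_add hv hF0 hF hx'.1.1 ht2 hr ht3 ht4.1, add_comm r t]
    have h6 := h1''.unique (h4.congr_of_eventuallyEq h5)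
    rw [zero_add, linearFlow_comm, ← hfapp] at h6
    have h7 : D u = mfderiv 𝓘(ℝ, E3) 𝓘(ℝ, E3) f (F x 0) (v (F x 0)) := rfl
    rw [h7, hF0 x hx'.1.1] at h6
    exact h6

/-- A linearising chart at the limit `p` in negative time of an orbit extends along any half orbit. -/
theorem IsLinearisingChart.exists_extension {v : (x : M) → TangentSpace 𝓘(ℝ, E3) x}
    (hv : IsSmoothVectorField v) {γ : ℝ → M} (hγ : IsMIntegralCurve γ v)
    (hinj : Function.Injective γ) {p : M} (hp : Tendsto γ atBot (𝓝 p)) (hne : ∀ t, γ t ≠ p)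
    {A : E3 →L[ℝ] E3} {φ : OpenPartialHomeomorph M E3} (hφ : IsLinearisingChart v A φ)
    (hps : p ∈ φ.source) (hφp : φ p = 0) (s : ℝ) :
    ∃ f : OpenPartialHomeomorph M E3, IsLinearisingChart v A f ∧ p ∈ f.source ∧ f p = 0 ∧
      ∀ t ≤ s, γ t ∈ f.source := by
  -- A continuation argument: the gain `δ` in `hstep` depends only on the point `s₀` and not on the
  -- chart, so at `s₀ = sSup S` it contradicts boundedness of `S`.
  let S : Set ℝ := {s | ∃ f : OpenPartialHomeomorph M E3, IsLinearisingChart v A f ∧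
    p ∈ f.source ∧ f p = 0 ∧ ∀ t ≤ s, γ t ∈ f.source}
  have hS0 : S.Nonempty := by
    obtain ⟨s, hs⟩ := eventually_atBot.1 (hp.eventually_mem (φ.open_source.mem_nhds hps))
    exact ⟨s, φ, hφ, hps, hφp, hs⟩
  have hSdown : ∀ s ∈ S, ∀ s' ≤ s, s' ∈ S := by
    rintro s ⟨f, h1, h2, h3, h4⟩ s' hs'
    exact ⟨f, h1, h2, h3, fun t ht => h4 t (ht.trans hs')⟩
  have hstep : ∀ s₀ : ℝ, ∃ δ > 0, ∀ s ∈ S, s₀ - δ < s → s₀ + δ ∈ S := by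
    intro s₀
    obtain ⟨F, O, ε, hε, hO, hmO, hF0, hF, hFc, hFd⟩ := exists_localFlow hv (γ s₀)
    obtain ⟨η, hη, hηO⟩ := Metric.mem_nhds_iff.1
      (hγ.continuous.continuousAt.preimage_mem_nhds (hO.mem_nhds hmO))
    set δ := min (η / 4) (ε / 4) with hδ
    have hδ0 : 0 < δ := lt_min (by linarith) (by linarith)
    have hδη : δ ≤ η / 4 := min_le_left _ _
    have hδε : δ ≤ ε / 4 := min_le_right _ _
    have hγO : ∀ t, |t - s₀| ≤ 3 * δ → γ t ∈ O := fun t ht =>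
      hηO (by rw [Metric.mem_ball, Real.dist_eq]; linarith)
    have hγF : ∀ t, γ t ∈ O → ∀ r ∈ Ioo (-ε) ε, F (γ t) r = γ (t + r) := by
      intro t ht r hr
      have h2 : IsMIntegralCurveOn (γ ∘ (· + t)) v (Ioo (-ε) ε) :=
        (hγ.comp_add t).isMIntegralCurveOn _
      have := eqOn_of_isMIntegralCurveOn hv (t₀ := 0) ⟨by linarith, hε⟩ (hF _ ht) h2
        (by simp [hF0 _ ht]) hr
      simpa [add_comm] using this
    refine ⟨δ, hδ0, ?_⟩
    rintro s ⟨f, hf, hpf, hfp, hfs⟩ hs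
    have hτ : -(2 * δ) ∈ Ioo (-ε) ε := ⟨by linarith, by linarith⟩
    -- The old chart pushed forward by time `2 δ`: it is available up to time `s₀ + δ`, since going
    -- back by `2 δ` lands before `s₀ - δ < s`.
    obtain ⟨f₂, hf₂, hf₂s, hf₂app⟩ := hf.exists_transport hv hO hF0 hF hFd hτ
    rw [neg_neg] at hf₂app
    have habs : ∀ t ∈ Icc (s₀ - δ) (s₀ + δ), |t - s₀| ≤ 3 * δ ∧ |t + -(2 * δ) - s₀| ≤ 3 * δ := by
      intro t ht
      exact ⟨abs_le.2 ⟨by linarith [ht.1], by linarith [ht.2]⟩,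
        abs_le.2 ⟨by linarith [ht.1], by linarith [ht.2]⟩⟩
    have hf₂γ : ∀ t ∈ Icc (s₀ - δ) (s₀ + δ),
        f₂ (γ t) = linearFlow A (2 * δ) (f (γ (t + -(2 * δ)))) := fun t ht => by
      rw [hf₂app, hγF t (hγO t (habs t ht).1) _ hτ]
    have hK₂ : γ '' Icc (s₀ - δ) (s₀ + δ) ⊆ f₂.source := by
      rintro _ ⟨t, ht, rfl⟩
      have e := hγF t (hγO t (habs t ht).1) _ hτ
      refine hf₂s _ (hγO t (habs t ht).1) ?_ ?_
      · rw [e]; exact hγO _ (habs t ht).2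
      · rw [e]; exact hfs _ (by linarith [ht.2])
    have hK₁ : insert p (γ '' Iic (s₀ - δ)) ⊆ f.source := by
      rintro _ (rfl | ⟨t, ht, rfl⟩)
      · exact hpf
      · exact hfs _ (le_trans ht hs.le)
    have hflow : ∀ t ≤ s₀ - δ, f (γ t) = linearFlow A (2 * δ) (f (γ (t + -(2 * δ)))) := by
      intro t ht
      have := (hf.conjugates (t + -(2 * δ)) t γ (by linarith)
        (fun r hr => hfs r (by linarith [hr.2]))).1 (hγ.isMIntegralCurveOn _) t
        ⟨by linarith, le_rfl⟩
      simpa using this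
    -- The two arcs meet only at `γ (s₀ - δ)`. Orbits near it stay in the domain of `f` during `[-2
    -- δ, 0]`, where `f` conjugates the field to the linear flow, so `f` and `f₂` coincide there.
    have hagree : ∀ x ∈ insert p (γ '' Iic (s₀ - δ)) ∩ γ '' Icc (s₀ - δ) (s₀ + δ),
        f =ᶠ[𝓝 x] f₂ := by
      rintro x ⟨hx | ⟨t, ht, rfl⟩, ⟨t', ht', hx'⟩⟩
      · exact absurd (hx'.trans hx) (hne t')
      · have htt : t' = t := hinj hx'
        rw [htt] at ht'
        have hev : ∀ᶠ m in 𝓝 (γ t), ∀ r ∈ Icc (-(2 * δ)) 0, F m r ∈ f.source := by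
          refine isCompact_Icc.eventually_forall_of_forall_eventually
            (P := fun m r => F m r ∈ f.source) fun r hr => ?_
          have hrε : r ∈ Ioo (-ε) ε := ⟨by linarith [hr.1], by linarith [hr.2]⟩
          have hc : ContinuousAt (fun z : M × ℝ => F z.1 z.2) (γ t, r) :=
            hFc.continuousAt (prod_mem_nhds (hO.mem_nhds (hγO t (habs t ht').1))
              (Ioo_mem_nhds hrε.1 hrε.2))
          refine hc.eventually_mem (f.open_source.mem_nhds ?_)
          simp only
          rw [hγF t (hγO t (habs t ht').1) r hrε]
          have ht1 : t ≤ s₀ - δ := ht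
          exact hfs _ (by linarith [hr.2])
        filter_upwards [hev, hO.mem_nhds (hγO t (habs t ht').1)] with m hm hmO
        have := (hf.conjugates (-(2 * δ)) 0 (F m) (by linarith) hm).1
          ((hF m hmO).mono fun r hr => ⟨by linarith [hr.1], by linarith [hr.2]⟩) 0
          ⟨by linarith, le_rfl⟩
        rw [hF0 m hmO] at this
        simpa [hf₂app] using this
    have hinj' : ∀ x ∈ insert p (γ '' Iic (s₀ - δ)), ∀ y ∈ γ '' Icc (s₀ - δ) (s₀ + δ),
        f x = f₂ y → x = y := by
      rintro x (rfl | ⟨t, ht, rfl⟩) _ ⟨t', ht', rfl⟩ hxy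
      · rw [hfp, hf₂γ t' ht'] at hxy
        have h1 := congrArg (linearFlow A (-(2 * δ))) hxy
        rw [linearFlow_neg_apply, map_zero, ← hfp] at h1
        exact absurd (f.injOn hpf (hfs _ (by linarith [ht'.2])) h1).symm (hne _)
      · have ht1 : t ≤ s₀ - δ := ht
        rw [hf₂γ t' ht', hflow t ht] at hxy
        have h1 := congrArg (linearFlow A (-(2 * δ))) hxy
        rw [linearFlow_neg_apply, linearFlow_neg_apply] at h1
        have h2 := hinj (f.injOn (hfs _ (by linarith)) (hfs _ (by linarith [ht'.2])) h1)
        rw [add_right_cancel h2]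
    obtain ⟨H, hHs, hH₁, -, hHloc⟩ := exists_glued_openPartialHomeomorph f f₂
      (isCompact_insert_image_Iic hγ.continuous hp)
      (isCompact_Icc.image hγ.continuous) hK₁ hK₂ hagree hinj'
    refine ⟨H, ⟨?_, ?_, ?_⟩, hHs (Or.inl (mem_insert _ _)), ?_, ?_⟩
    · intro x hx
      rcases hHloc x hx with ⟨h1, h2⟩ | ⟨h1, h2⟩
      · exact (hf.contMDiffAt x h1).congr_of_eventuallyEq h2
      · exact (hf₂.contMDiffAt x h1).congr_of_eventuallyEq h2
    · have aux : ∀ (g : OpenPartialHomeomorph M E3) (y : E3), y ∈ H.target →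
          H.symm y ∈ g.source → H =ᶠ[𝓝 (H.symm y)] g → y ∈ g.target ∧ H.symm =ᶠ[𝓝 y] g.symm := by
        intro g y hy hs hg
        have hgy : g (H.symm y) = y := by rw [← hg.eq_of_nhds, H.right_inv hy]
        refine ⟨hgy ▸ g.map_source hs, ?_⟩
        filter_upwards [(H.continuousAt_symm hy).eventually hg,
          H.open_target.mem_nhds hy,
          (H.continuousAt_symm hy).eventually_mem (g.open_source.mem_nhds hs)] with z h1 h2 h3
        rw [← g.left_inv h3, ← h1, H.right_inv h2]
      intro y hy
      rcases hHloc _ (H.map_target hy) with ⟨h1, h2⟩ | ⟨h1, h2⟩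
      · obtain ⟨h3, h4⟩ := aux _ y hy h1 h2
        exact (hf.contMDiffAt_symm y h3).congr_of_eventuallyEq h4
      · obtain ⟨h3, h4⟩ := aux _ y hy h1 h2
        exact (hf₂.contMDiffAt_symm y h3).congr_of_eventuallyEq h4
    · intro x hx
      rcases hHloc x hx with ⟨h1, h2⟩ | ⟨h1, h2⟩
      · rw [h2.mfderiv_eq, h2.eq_of_nhds]; exact hf.mfderiv_apply x h1
      · rw [h2.mfderiv_eq, h2.eq_of_nhds]; exact hf₂.mfderiv_apply x h1
    · rw [(hH₁ p (mem_insert _ _)).eq_of_nhds, hfp]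
    · intro t ht
      rcases le_total t (s₀ - δ) with h | h
      · exact hHs (Or.inl (Or.inr ⟨t, h, rfl⟩))
      · exact hHs (Or.inr ⟨t, ⟨h, ht⟩, rfl⟩)
  by_contra hs
  have hbdd : BddAbove S := ⟨s, fun r hr => by
    by_contra hrs
    exact hs (hSdown r hr s (not_le.1 hrs).le)⟩
  obtain ⟨δ, hδ, hstep⟩ := hstep (sSup S)
  obtain ⟨r, hr, hr'⟩ := exists_lt_of_lt_csSup hS0 (sub_lt_self (sSup S) hδ)
  have := le_csSup hbdd (hstep r hr hr')
  linarith

end Extension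


/-! ### Linear normal form at a saddle -/

section LinearAlgebra

open Polynomial

/-- A real cubic with one root whose real part has a sign different from that of the real parts of
the two other roots. -/
theorem eq_mul_quadratic_of_aroots {P : ℝ[X]} (hP : P.Monic) {r z w : ℂ}
    (hroots : P.aroots ℂ = {r, z, w}) (hrz : r.re * z.re < 0) (hzw : 0 < z.re * w.re) :
    ∃ δ : ℝ, 0 < δ ∧ P = (X - C r.re) * (X ^ 2 - C (z.re + w.re) * X + C δ) := by
  have hmap : P.map (algebraMap ℝ ℂ) = (X - C r) * (X - C z) * (X - C w) := by
    have h1 := (IsAlgClosed.splits (P.map (algebraMap ℝ ℂ))).eq_prod_roots_of_monic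
      (hP.map (algebraMap ℝ ℂ))
    rw [aroots_def] at hroots
    rw [h1, hroots]
    simp [mul_assoc]
  have heval : ∀ u : ℂ, aeval u P = (u - r) * (u - z) * (u - w) := fun u => by
    rw [← eval_map_algebraMap, hmap]; simp
  have hreal : ∀ t : ℝ, (((t : ℂ) - r) * (t - z) * (t - w)).im = 0 := fun t => by
    rw [← heval]
    have := aeval_algebraMap_apply_eq_algebraMap_eval (A := ℂ) t P
    rw [Complex.coe_algebraMap] at this
    rw [this, Complex.ofReal_im]
  -- The conjugate of `r` is a root with the same real part, while `z` and `w` have real parts of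
  -- the other sign; so `r` is its own conjugate.
  have hrim : r.im = 0 := by
    have h1 : aeval (starRingEnd ℂ r) P = 0 := by
      rw [aeval_conj, heval]; simp
    rw [heval, mul_eq_zero, mul_eq_zero, sub_eq_zero, sub_eq_zero, sub_eq_zero] at h1
    rcases h1 with (h1 | h1) | h1
    · exact Complex.conj_eq_iff_im.1 h1
    · have := congrArg Complex.re h1
      rw [Complex.conj_re] at this
      rw [this] at hrz
      nlinarith [mul_self_nonneg z.re]
    · have := congrArg Complex.re h1
      rw [Complex.conj_re] at this
      rw [this] at hrz
      nlinarith
  -- At `r.re ± 1` the factor `t - r` is `±1`, so the imaginary part of `(t - z) (t - w)`, affine in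
  -- `t`, vanishes at two points: `z + w` and `z w` are real.
  have h1 := hreal (r.re + 1)
  have h2 := hreal (r.re - 1)
  simp only [Complex.mul_im, Complex.mul_re, Complex.sub_re, Complex.sub_im, Complex.ofReal_re,
    Complex.ofReal_im, hrim] at h1 h2
  have hsum : z.im + w.im = 0 := by linarith
  have hprod : z.re * w.im + z.im * w.re = 0 := by
    have : w.im = - z.im := by linarith
    rw [this] at h1 h2 ⊢
    linarith
  refine ⟨(z * w).re, ?_, ?_⟩
  · have : w.im = - z.im := by linarith
    rw [Complex.mul_re, this]
    nlinarith [mul_self_nonneg z.im]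
  · apply map_injective (algebraMap ℝ ℂ) (algebraMap ℝ ℂ).injective
    rw [hmap]
    have e1 : ((r.re : ℝ) : ℂ) = r := by apply Complex.ext <;> simp [hrim]
    have e2 : ((z.re + w.re : ℝ) : ℂ) = z + w := by apply Complex.ext <;> simp [hsum]
    have e3 : (((z * w).re : ℝ) : ℂ) = z * w := by
      apply Complex.ext <;> simp only [Complex.ofReal_re, Complex.ofReal_im, Complex.mul_im]
      linarith
    generalize z.re + w.re = τ at e2 ⊢
    simp only [Polynomial.map_mul, Polynomial.map_sub, Polynomial.map_add, Polynomial.map_pow,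
      map_X, map_C, Complex.coe_algebraMap, e1, e2, e3, C_add, C_mul]
    ring

/-- The linear normal form at a hyperbolic saddle with a one-dimensional stable space. -/
theorem exists_linear_normalForm {E : Type*} [NormedAddCommGroup E] [NormedSpace ℝ E]
    [FiniteDimensional ℝ E] (hE : Module.finrank ℝ E = 3) (A : E →L[ℝ] E) {a τ δ : ℝ} (ha : 0 < a)
    (hτ : 0 < τ) (hδ : 0 < δ) (hA : ∀ y, A (A (A y) - τ • A y + δ • y) +
      a • (A (A y) - τ • A y + δ • y) = 0)
    (hker : Module.finrank ℝ (LinearMap.ker ((A : E →ₗ[ℝ] E) + a • LinearMap.id)) = 1) :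
    ∃ (Λ : E ≃L[ℝ] ℝ × (ℝ × ℝ)) (B : ℝ × ℝ →L[ℝ] ℝ × ℝ),
      (∀ y, Λ (A y) = (-a * (Λ y).1, B (Λ y).2)) ∧ ∀ Y, B (τ • Y - B Y) = δ • Y := by
  let A' : E →ₗ[ℝ] E := A
  let K₁ : Submodule ℝ E := LinearMap.ker (A' + a • LinearMap.id)
  let K₂ : Submodule ℝ E := LinearMap.ker (A' ∘ₗ A' - τ • A' + δ • LinearMap.id)
  have hK₁ : ∀ y, y ∈ K₁ ↔ A y + a • y = 0 := fun y => by simp [K₁, A']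
  have hK₂ : ∀ y, y ∈ K₂ ↔ A (A y) - τ • A y + δ • y = 0 := fun y => by simp [K₂, A']
  -- `c` is the value of the quadratic factor `X² - τ X + δ` at `-a`. As `c > 0`, the Bézout
  -- identity `c = (A² - τ A + δ) + (a + τ - A) (A + a)` splits the space.
  set c := a * a + τ * a + δ with hc
  have hc0 : 0 < c := by positivity
  have hcompl : IsCompl K₁ K₂ := by
    constructor
    · rw [Submodule.disjoint_def]
      intro y h1 h2
      rw [hK₁] at h1
      rw [hK₂] at h2
      have e1 : A y = -(a • y) := eq_neg_of_add_eq_zero_left h1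
      rw [e1, map_neg, map_smul, e1] at h2
      have : c • y = 0 := by
        rw [← h2, hc]
        module
      exact (smul_eq_zero.1 this).resolve_left hc0.ne'
    · rw [codisjoint_iff, Submodule.eq_top_iff']
      intro y
      refine Submodule.mem_sup.2 ⟨c⁻¹ • (A (A y) - τ • A y + δ • y), K₁.smul_mem _ ((hK₁ _).2 (hA y)),
        c⁻¹ • ((a + τ) • (A y + a • y) - A (A y + a • y)), K₂.smul_mem _ ((hK₂ _).2 ?_), ?_⟩
      · have := hA y
        have e : A (A (A y)) = -(A (- (τ • A y) + δ • y) +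
            a • (A (A y) - τ • A y + δ • y)) := by
          rw [← add_eq_zero_iff_eq_neg, ← this]
          simp only [map_add, map_sub, map_neg]
          module
        simp only [map_add, map_sub, map_neg, map_smul, e]
        module
      · rw [← smul_add, map_add, map_smul]
        have : A (A y) - τ • A y + δ • y + ((a + τ) • (A y + a • y) - (A (A y) + a • A y)) =
            c • y := by
          rw [hc]; module
        rw [this, smul_smul, inv_mul_cancel₀ hc0.ne', one_smul]
  have hdim : Module.finrank ℝ K₂ = 2 := by
    have := Submodule.finrank_add_eq_of_isCompl hcompl
    rw [hE] at this
    have h1 : Module.finrank ℝ K₁ = 1 := hker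
    omega
  let e₁ : K₁ ≃ₗ[ℝ] ℝ := LinearEquiv.ofFinrankEq _ _ (by rw [Module.finrank_self]; exact hker)
  let e₂ : K₂ ≃ₗ[ℝ] ℝ × ℝ := LinearEquiv.ofFinrankEq _ _ (by simp [hdim])
  have hinv : ∀ y ∈ K₂, A' y ∈ K₂ := fun y hy => by
    rw [hK₂] at hy ⊢
    have := congrArg A hy
    simpa [A'] using this
  let A₂ : K₂ →ₗ[ℝ] K₂ := A'.restrict hinv
  let B : ℝ × ℝ →ₗ[ℝ] ℝ × ℝ := e₂.toLinearMap ∘ₗ A₂ ∘ₗ e₂.symm.toLinearMap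
  let Λ : E ≃ₗ[ℝ] ℝ × (ℝ × ℝ) :=
    (Submodule.prodEquivOfIsCompl K₁ K₂ hcompl).symm.trans (e₁.prodCongr e₂)
  refine ⟨Λ.toContinuousLinearEquiv, LinearMap.toContinuousLinearMap B, ?_, ?_⟩
  · intro y
    change Λ (A y) = (-a * (Λ y).1, B (Λ y).2)
    obtain ⟨⟨x, Y⟩, rfl⟩ := (Submodule.prodEquivOfIsCompl K₁ K₂ hcompl).surjective y
    have hx : A (x : E) = -(a • (x : E)) := eq_neg_of_add_eq_zero_left ((hK₁ _).1 x.2)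
    have : A (Submodule.prodEquivOfIsCompl K₁ K₂ hcompl (x, Y)) =
        Submodule.prodEquivOfIsCompl K₁ K₂ hcompl (-(a • x), A₂ Y) := by
      simp only [Submodule.coe_prodEquivOfIsCompl', map_add, hx]
      rfl
    rw [this]
    simp only [Λ, LinearEquiv.trans_apply, LinearEquiv.symm_apply_apply, LinearEquiv.prodCongr_apply,
      B, LinearMap.comp_apply, LinearEquiv.coe_coe, map_neg, map_smul, smul_eq_mul, neg_mul]
  · intro Y
    change B (τ • Y - B Y) = δ • Y
    obtain ⟨y, rfl⟩ := e₂.surjective Y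
    have hB : ∀ y, B (e₂ y) = e₂ (A₂ y) := fun y => by simp [B]
    rw [hB, ← map_smul, ← map_sub, hB, ← map_smul]
    congr 1
    have h := (hK₂ _).1 y.2
    apply Subtype.ext
    change A (τ • (y : E) - A y) = δ • (y : E)
    rw [map_sub, map_smul, ← sub_eq_zero, ← neg_eq_zero, ← h]
    abel

/-- A nonzero vector of the plane can be taken to `(1, 0)`. -/
theorem exists_continuousLinearEquiv_apply_eq {Y : ℝ × ℝ} (hY : Y ≠ 0) :
    ∃ e : (ℝ × ℝ) ≃L[ℝ] ℝ × ℝ, e Y = (1, 0) :=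
  SeparatingDual.exists_continuousLinearEquiv_apply_eq hY (by simp)

/-- The normal form of a saddle with a prescribed vector of its unstable space. -/
theorem exists_linear_normalForm_apply {A : E3 →L[ℝ] E3} {a τ δ : ℝ} (ha : 0 < a)
    (hτ : 0 < τ) (hδ : 0 < δ) (hA : (A : E3 →ₗ[ℝ] E3).charpoly =
      (X + C a) * (X ^ 2 - C τ * X + C δ)) {ξ : E3} (hξ : ξ ≠ 0)
    (hlim : Tendsto (fun t => linearFlow A t ξ) atBot (𝓝 0)) :
    ∃ (Λ : E3 ≃L[ℝ] ℝ × (ℝ × ℝ)) (B : ℝ × ℝ →L[ℝ] ℝ × ℝ),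
      (∀ y, Λ (A y) = (-a * (Λ y).1, B (Λ y).2)) ∧ (∀ Y, B (τ • Y - B Y) = δ • Y) ∧
      Λ ξ = (0, (1, 0)) := by
  have hCH : ∀ y, A (A (A y) - τ • A y + δ • y) + a • (A (A y) - τ • A y + δ • y) = 0 := by
    intro y
    have h := LinearMap.aeval_self_charpoly (A : E3 →ₗ[ℝ] E3)
    rw [hA] at h
    have h2 := DFunLike.congr_fun h y
    simpa [pow_two, Module.algebraMap_end_apply] using h2
  have hq : ∀ x : ℝ, x = -a → (X ^ 2 - C τ * X + C δ : ℝ[X]).eval x ≠ 0 := by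
    rintro x rfl
    simp only [eval_add, eval_sub, eval_pow, eval_X, eval_mul, eval_C]
    nlinarith [mul_pos hτ ha, sq_nonneg a]
  -- `-a` is not a root of the quadratic factor, hence it is a simple root of the characteristic
  -- polynomial and its eigenspace is a line.
  have hker : Module.finrank ℝ (LinearMap.ker ((A : E3 →ₗ[ℝ] E3) + a • LinearMap.id)) = 1 := by
    have hes : LinearMap.ker ((A : E3 →ₗ[ℝ] E3) + a • LinearMap.id) =
        Module.End.eigenspace (A : E3 →ₗ[ℝ] E3) (-a) := by
      ext y
      simp [eq_neg_iff_add_eq_zero]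
    rw [hes]
    have hroot : (A : E3 →ₗ[ℝ] E3).charpoly.IsRoot (-a) := by
      rw [hA]; simp
    apply le_antisymm
    · refine (LinearMap.finrank_genEigenspace_le (A : E3 →ₗ[ℝ] E3) (-a) 1).trans ?_
      have hne : (X + C a) * (X ^ 2 - C τ * X + C δ) ≠ 0 := by
        rw [← hA]; exact (LinearMap.charpoly_monic _).ne_zero
      rw [hA, rootMultiplicity_mul hne, rootMultiplicity_eq_zero (p := X ^ 2 - C τ * X + C δ)
        (hq _ rfl)]
      have : (X + C a : ℝ[X]) = X - C (-a) := by simp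
      rw [this, rootMultiplicity_X_sub_C_self]
    · have hev : Module.End.HasEigenvalue (A : E3 →ₗ[ℝ] E3) (-a) :=
        (Module.End.hasEigenvalue_iff_isRoot_charpoly _ _).2 hroot
      have := hev
      rw [Module.End.hasEigenvalue_iff] at this
      exact Submodule.one_le_finrank_iff.2 this
  obtain ⟨Λ, B, hΛ, hB⟩ := exists_linear_normalForm (by simp) A ha hτ hδ hCH hker
  -- Along the orbit of `ξ` the product of `exp (a t)` and the stable coordinate is constant, yet it
  -- tends to zero in negative time.
  have hx0 : (Λ ξ).1 = 0 := by
    have hsol : ∀ t, (Λ (linearFlow A t ξ)).1 = Real.exp (-a * t) * (Λ ξ).1 := by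
      intro t
      have hd : ∀ t, HasDerivAt (fun t => Real.exp (a * t) * (Λ (linearFlow A t ξ)).1) 0 t := by
        intro t
        have h1 : HasDerivAt (fun t => Λ (linearFlow A t ξ)) (Λ (A (linearFlow A t ξ))) t :=
          Λ.toContinuousLinearMap.hasFDerivAt.comp_hasDerivAt t (hasDerivAt_linearFlow_apply A ξ t)
        rw [hΛ] at h1
        have h2 := h1.fst
        have h3 : HasDerivAt (fun t => Real.exp (a * t)) (Real.exp (a * t) * a) t := by
          simpa using ((hasDerivAt_id t).const_mul a).exp
        refine (h3.mul h2).congr_deriv ?_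
        ring
      have := is_const_of_deriv_eq_zero (fun t => (hd t).differentiableAt) (fun t => (hd t).deriv)
        t 0
      simp only [mul_zero, Real.exp_zero, linearFlow_zero, one_mul] at this
      change _ = (Λ ξ).1 at this
      rw [← this, ← mul_assoc, ← Real.exp_add]
      simp
    have h1 : Tendsto (fun t => (Λ (linearFlow A t ξ)).1) atBot (𝓝 0) := by
      have : Continuous fun y => (Λ y).1 := by fun_prop
      simpa [Function.comp_def] using (this.tendsto 0).comp hlim
    by_contra h0
    have h2 : Tendsto (fun t => Real.exp (a * t) * (Λ (linearFlow A t ξ)).1) atBot (𝓝 (0 * 0)) := by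
      refine Tendsto.mul ?_ h1
      exact Real.tendsto_exp_atBot.comp (tendsto_id.const_mul_atBot ha)
    have h3 : (fun t => Real.exp (a * t) * (Λ (linearFlow A t ξ)).1) = fun _ => (Λ ξ).1 := by
      funext t
      rw [hsol, ← mul_assoc, ← Real.exp_add]
      simp
    rw [h3, mul_zero] at h2
    exact h0 (tendsto_nhds_unique tendsto_const_nhds h2)
  have hY0 : (Λ ξ).2 ≠ 0 := fun h => hξ (Λ.injective (by
    rw [map_zero]; exact Prod.ext hx0 h))
  obtain ⟨e, he⟩ := exists_continuousLinearEquiv_apply_eq hY0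
  refine ⟨Λ.trans ((ContinuousLinearEquiv.refl ℝ ℝ).prodCongr e),
    e.toContinuousLinearMap ∘L B ∘L e.symm.toContinuousLinearMap, ?_, ?_, ?_⟩
  · intro y
    simp [hΛ]
  · intro Y
    obtain ⟨Y, rfl⟩ := e.surjective Y
    have : (e.toContinuousLinearMap ∘L B ∘L e.symm.toContinuousLinearMap) (e Y) = e (B Y) := by
      simp
    rw [this, ← map_smul, ← map_sub, ← map_smul, ← hB]
    simp
  · simp [he, hx0]

end LinearAlgebra


/-! ### Conjugacy of expanding linear flows -/

section Expanding

variable {V : Type*} [NormedAddCommGroup V] [NormedSpace ℝ V] [CompleteSpace V]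

/-- The function `N` grows at least and at most exponentially along the flow of `B`. -/
def IsExpandingFor (N : V → ℝ) (B : V →L[ℝ] V) : Prop :=
  ∃ κ K : ℝ, 0 < κ ∧ 0 < K ∧ ∀ Y ≠ 0, ∀ s t, s ≤ t →
    κ * (t - s) ≤ Real.log (N (linearFlow B t Y)) - Real.log (N (linearFlow B s Y)) ∧
    Real.log (N (linearFlow B t Y)) - Real.log (N (linearFlow B s Y)) ≤ K * (t - s)

theorem linearFlow_ne_zero (B : V →L[ℝ] V) (t : ℝ) {Y : V} (hY : Y ≠ 0) : linearFlow B t Y ≠ 0 :=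
  fun h => hY ((linearFlowEquiv B t).injective (by simpa using h))

theorem linearFlow_one (t : ℝ) (Y : V) : linearFlow (1 : V →L[ℝ] V) t Y = Real.exp t • Y := by
  have h1 : ∀ t, HasDerivAt (fun t => Real.exp (-t) • linearFlow (1 : V →L[ℝ] V) t Y) 0 t := by
    intro t
    have := (((hasDerivAt_id t).neg).exp).smul (hasDerivAt_linearFlow_apply (1 : V →L[ℝ] V) Y t)
    refine this.congr_deriv ?_
    simp
  have h2 := is_const_of_deriv_eq_zero (fun t => (h1 t).differentiableAt) (fun t => (h1 t).deriv) t 0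
  simp only [neg_zero, Real.exp_zero, linearFlow_zero, one_smul] at h2
  change _ = Y at h2
  have h3 := congrArg (Real.exp t • ·) h2
  simpa only [smul_smul, ← Real.exp_add, add_neg_cancel, Real.exp_zero, one_smul] using h3

variable {N : V → ℝ}

/-- The time at which the function `log N` takes a given value along the orbits of an expanding
linear flow. -/
theorem IsExpandingFor.exists_time {B : V →L[ℝ] V} (hN : Continuous N) (hN0 : ∀ Y ≠ 0, 0 < N Y)
    (h : IsExpandingFor N B) :
    ∃ T : V × ℝ → ℝ, (∀ Y ≠ 0, ∀ s, ContinuousAt T (Y, s)) ∧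
      ∀ Y ≠ 0, ∀ s, Real.log (N (linearFlow B (T (Y, s)) Y)) = s ∧
        ∀ t, Real.log (N (linearFlow B t Y)) = s → t = T (Y, s) := by
  obtain ⟨κ, K, hκ, hK, h⟩ := h
  let X := {Y : V // Y ≠ 0}
  let f : X × ℝ → ℝ := fun z => Real.log (N (linearFlow B z.2 z.1))
  have hf : Continuous f := by
    have h1 : Continuous fun z : X × ℝ => linearFlow B z.2 z.1 :=
      ((continuous_linearFlow B).comp continuous_snd).clm_apply
        (continuous_subtype_val.comp continuous_fst)
    exact (hN.comp h1).log fun z => (hN0 _ (linearFlow_ne_zero B _ z.1.2)).ne'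
  have hm : ∀ x, StrictMono fun t => f (x, t) := fun x s t hst => by
    have := (h x x.2 s t hst.le).1
    have h2 : 0 < κ * (t - s) := mul_pos hκ (sub_pos.2 hst)
    change Real.log _ < Real.log _
    linarith
  have hs : ∀ x, Function.Surjective fun t => f (x, t) := by
    intro x
    have hc : Continuous fun t => f (x, t) := by fun_prop
    refine hc.surjective ?_ ?_
    · refine tendsto_atTop_mono' _ ?_ (tendsto_atTop_add_const_left _ (f (x, 0))
        (tendsto_id.const_mul_atTop hκ))
      filter_upwards [eventually_ge_atTop 0] with t ht
      have := (h x x.2 0 t ht).1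
      simp only [f, id, sub_zero] at this ⊢
      linarith
    · refine tendsto_atBot_mono' _ ?_ (tendsto_atBot_add_const_left _ (f (x, 0))
        (tendsto_id.const_mul_atBot hκ))
      filter_upwards [eventually_le_atBot 0] with t ht
      have := (h x x.2 t 0 ht).1
      simp only [f, id, zero_sub] at this ⊢
      linarith
  obtain ⟨g, hg, hgf, hfg⟩ := exists_continuous_inverse_of_strictMono hf hm hs
  classical
  refine ⟨fun z => if hz : z.1 ≠ 0 then g (⟨z.1, hz⟩, z.2) else 0, ?_, ?_⟩
  · intro Y hY s
    have hopen : IsOpen {z : V × ℝ | z.1 ≠ 0} := isOpen_ne.preimage continuous_fst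
    refine ContinuousOn.continuousAt (s := {z : V × ℝ | z.1 ≠ 0}) ?_ (hopen.mem_nhds hY)
    rw [continuousOn_iff_continuous_domRestrict]
    have : Continuous fun z : {z : V × ℝ | z.1 ≠ 0} => g (⟨z.1.1, z.2⟩, z.1.2) := by
      refine hg.comp ?_
      exact Continuous.prodMk (Continuous.subtype_mk (continuous_fst.comp continuous_subtype_val) _)
        (continuous_snd.comp continuous_subtype_val)
    convert this using 1
    ext z
    exact dif_pos z.2
  · intro Y hY s
    simp only [dif_pos hY]
    exact ⟨hfg ⟨Y, hY⟩ s, fun t ht => by rw [← hgf ⟨Y, hY⟩ t]; congr 2⟩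

/-- Two linear flows which are expanding for the same function are topologically conjugate. -/
theorem IsExpandingFor.exists_conjugacy {B B' : V →L[ℝ] V} (hN : Continuous N)
    (hN0 : ∀ Y ≠ 0, 0 < N Y) (hNz : N 0 = 0) {c : ℝ} (hNc : ∀ Y, c * ‖Y‖ ^ 2 ≤ N Y) (hc : 0 < c)
    (h : IsExpandingFor N B) (h' : IsExpandingFor N B') {Y₀ : V} (hY₀ : Y₀ ≠ 0)
    {T T' : V × ℝ → ℝ}
    (hT : ∀ Y ≠ 0, ∀ s, ContinuousAt T (Y, s))
    (hT1 : ∀ Y ≠ 0, ∀ s, Real.log (N (linearFlow B (T (Y, s)) Y)) = s ∧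
        ∀ t, Real.log (N (linearFlow B t Y)) = s → t = T (Y, s))
    (hT' : ∀ Y ≠ 0, ∀ s, ContinuousAt T' (Y, s))
    (hT'1 : ∀ Y ≠ 0, ∀ s, Real.log (N (linearFlow B' (T' (Y, s)) Y)) = s ∧
        ∀ t, Real.log (N (linearFlow B' t Y)) = s → t = T' (Y, s)) :
    ∃ H : V ≃ₜ V, (∀ t Y, H (linearFlow B t Y) = linearFlow B' t (H Y)) ∧ H Y₀ = Y₀ ∧ H 0 = 0 ∧
      ∀ Y ≠ 0, H Y = linearFlow B' (-T (Y, Real.log (N Y₀)))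
        (linearFlow B (T (Y, Real.log (N Y₀))) Y) := by
  classical
  -- The conjugacy follows the flow of `B` to the level set of `N` through `Y₀`, then returns for
  -- the same time by the flow of `B'`.
  set s₀ := Real.log (N Y₀) with hs₀
  have cont : ∀ (B B' : V →L[ℝ] V) (T : V × ℝ → ℝ), IsExpandingFor N B → IsExpandingFor N B' →
      (∀ Y ≠ 0, ∀ s, ContinuousAt T (Y, s)) →
      (∀ Y ≠ 0, ∀ s, Real.log (N (linearFlow B (T (Y, s)) Y)) = s ∧
        ∀ t, Real.log (N (linearFlow B t Y)) = s → t = T (Y, s)) →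
      Continuous fun Y => if Y = 0 then 0 else
        linearFlow B' (-T (Y, s₀)) (linearFlow B (T (Y, s₀)) Y) := by
    intro B B' T h h' hT hT1
    rw [continuous_iff_continuousAt]
    intro Y
    rcases eq_or_ne Y 0 with rfl | hY
    · obtain ⟨κ, K, hκ, hK, h⟩ := h
      obtain ⟨κ', K', hκ', hK', h'⟩ := h'
      rw [ContinuousAt, if_pos rfl, tendsto_zero_iff_norm_tendsto_zero]
      set G : V → V := fun Y => if Y = 0 then 0 else
        linearFlow B' (-T (Y, s₀)) (linearFlow B (T (Y, s₀)) Y) with hG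
      -- it suffices that `N ∘ G` tends to zero
      suffices hNG : Tendsto (fun Y => N (G Y)) (𝓝 0) (𝓝 0) by
        have h1 : Tendsto (fun Y => ‖G Y‖ ^ 2) (𝓝 0) (𝓝 0) := by
          refine squeeze_zero (fun Y => by positivity) (fun Y => ?_)
            (by simpa using hNG.const_mul c⁻¹)
          rw [← div_eq_inv_mul, le_div_iff₀ hc, mul_comm]
          exact hNc _
        have h2 := (Real.continuous_sqrt.tendsto 0).comp h1
        simp only [Function.comp_def, Real.sqrt_sq (norm_nonneg _), Real.sqrt_zero] at h2
        exact h2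
      -- Continuity at the origin: `log N` grows at rate at most `K` along `B`, so the time to the
      -- level is at least `(s₀ - log (N Y)) / K`, which tends to infinity; going back along `B'`
      -- lowers `log N` at rate at least `κ'`.
      have hlog : Tendsto (fun Y => s₀ - κ' * ((s₀ - Real.log (N Y)) / K)) (𝓝[≠] 0) atBot := by
        have h1 : Tendsto (fun Y => Real.log (N Y)) (𝓝[≠] (0 : V)) atBot := by
          refine Real.tendsto_log_nhdsGT_zero.comp (tendsto_nhdsWithin_iff.2 ⟨?_, ?_⟩)
          · have := hN.tendsto 0
            rw [hNz] at this
            exact this.mono_left nhdsWithin_le_nhds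
          · filter_upwards [self_mem_nhdsWithin] with Y hY using hN0 Y hY
        have h2 := (h1.const_mul_atBot (div_pos hκ' hK))
        refine (tendsto_atBot_add_const_left _ (s₀ - κ' * s₀ / K) h2).congr fun Y => ?_
        ring
      have hexp := Real.tendsto_exp_atBot.comp hlog
      have hsmall : ∀ᶠ Y in 𝓝[≠] (0 : V), Real.log (N Y) < s₀ := by
        have h1 : ∀ᶠ Y in 𝓝 (0 : V), N Y < N Y₀ :=
          hN.continuousAt.eventually_lt continuousAt_const (by rw [hNz]; exact hN0 _ hY₀)
        filter_upwards [h1.filter_mono nhdsWithin_le_nhds, self_mem_nhdsWithin] with Y h1 h2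
        exact Real.log_lt_log (hN0 _ h2) h1
      have hG0 : G 0 = 0 := if_pos rfl
      have key : Tendsto (fun Y => N (G Y)) (𝓝[≠] 0) (𝓝 0) := by
        refine squeeze_zero' ?_ ?_ hexp
        · filter_upwards with Y
          rcases eq_or_ne (G Y) 0 with h0 | h0
          · rw [h0, hNz]
          · exact (hN0 _ h0).le
        · filter_upwards [hsmall, self_mem_nhdsWithin] with Y h1 h2
          have hY : Y ≠ 0 := h2
          have hGY : G Y = linearFlow B' (-T (Y, s₀)) (linearFlow B (T (Y, s₀)) Y) := if_neg hY
          have hω : linearFlow B (T (Y, s₀)) Y ≠ 0 := linearFlow_ne_zero B _ hY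
          have hTs := (hT1 Y hY s₀).1
          have hTpos : 0 ≤ T (Y, s₀) := by
            by_contra hneg
            have := (h Y hY (T (Y, s₀)) 0 (not_le.1 hneg).le).1
            rw [hTs] at this
            simp only [linearFlow_zero] at this
            change _ ≤ Real.log (N Y) - s₀ at this
            have h3 := mul_nonneg hκ.le (show 0 ≤ 0 - T (Y, s₀) by linarith)
            linarith
          have h3 := (h Y hY 0 (T (Y, s₀)) hTpos).2
          rw [hTs] at h3
          simp only [linearFlow_zero, sub_zero] at h3
          change s₀ - Real.log (N Y) ≤ _ at h3
          have h4 := (h' _ hω (-T (Y, s₀)) 0 (by linarith)).1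
          simp only [linearFlow_zero, zero_sub, neg_neg] at h4
          change _ ≤ Real.log (N (linearFlow B (T (Y, s₀)) Y)) - _ at h4
          rw [hTs, ← hGY] at h4
          have hGne : G Y ≠ 0 := by rw [hGY]; exact linearFlow_ne_zero B' _ hω
          rw [← Real.exp_log (hN0 _ hGne)]
          apply Real.exp_le_exp.2
          have h5 : (s₀ - Real.log (N Y)) / K ≤ T (Y, s₀) := by
            rw [div_le_iff₀ hK]; linarith
          have h6 := mul_le_mul_of_nonneg_left h5 hκ'.le
          linarith
      have hpure : Tendsto (fun Y => N (G Y)) (pure 0) (𝓝 0) := by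
        have h0 : N (G 0) = 0 := by rw [hG0, hNz]
        have := tendsto_pure_nhds (fun Y => N (G Y)) (0 : V)
        rwa [h0] at this
      rw [← nhdsNE_sup_pure]
      exact key.sup hpure
    · have h1 : ContinuousAt (fun Y => T (Y, s₀)) Y :=
        ContinuousAt.comp (f := fun Y => (Y, s₀)) (hT Y hY s₀) (by fun_prop)
      have h2 : ContinuousAt (fun Y => linearFlow B' (-T (Y, s₀))
          (linearFlow B (T (Y, s₀)) Y)) Y :=
        ((continuous_linearFlow B').continuousAt.comp h1.neg).clm_apply
          (((continuous_linearFlow B).continuousAt.comp h1).clm_apply continuousAt_id)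
      refine h2.congr ?_
      filter_upwards [isOpen_ne.mem_nhds hY] with Z hZ
      exact (if_neg hZ).symm
  have inv : ∀ (B B' : V →L[ℝ] V) (T T' : V × ℝ → ℝ),
      (∀ Y ≠ 0, ∀ s, Real.log (N (linearFlow B (T (Y, s)) Y)) = s ∧
        ∀ t, Real.log (N (linearFlow B t Y)) = s → t = T (Y, s)) →
      (∀ Y ≠ 0, ∀ s, Real.log (N (linearFlow B' (T' (Y, s)) Y)) = s ∧
        ∀ t, Real.log (N (linearFlow B' t Y)) = s → t = T' (Y, s)) →
      Function.LeftInverse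
        (fun Y => if Y = 0 then 0 else linearFlow B (-T' (Y, s₀)) (linearFlow B' (T' (Y, s₀)) Y))
        (fun Y => if Y = 0 then 0 else linearFlow B' (-T (Y, s₀)) (linearFlow B (T (Y, s₀)) Y)) := by
    intro B B' T T' hT1 hT'1 Y
    rcases eq_or_ne Y 0 with rfl | hY
    · simp
    · have h1 : linearFlow B' (-T (Y, s₀)) (linearFlow B (T (Y, s₀)) Y) ≠ 0 :=
        linearFlow_ne_zero _ _ (linearFlow_ne_zero _ _ hY)
      simp only [if_neg hY, if_neg h1]
      -- The image of `Y` reaches the level under `B'` at the same time as `Y` does under `B`.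
      rw [← (hT'1 _ h1 s₀).2 (T (Y, s₀)) (by rw [linearFlow_apply_neg]; exact (hT1 Y hY s₀).1),
        linearFlow_apply_neg, linearFlow_neg_apply]
  refine ⟨{
    toFun := fun Y => if Y = 0 then 0 else linearFlow B' (-T (Y, s₀)) (linearFlow B (T (Y, s₀)) Y)
    invFun := fun Y => if Y = 0 then 0 else
      linearFlow B (-T' (Y, s₀)) (linearFlow B' (T' (Y, s₀)) Y)
    left_inv := inv B B' T T' hT1 hT'1
    right_inv := inv B' B T' T hT'1 hT1
    continuous_toFun := cont B B' T h h' hT hT1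
    continuous_invFun := cont B' B T' h' h hT' hT'1 }, ?_, ?_, if_pos rfl, fun Y hY => if_neg hY⟩
  · intro t Y
    rcases eq_or_ne Y 0 with rfl | hY
    · simp
    · have h1 := linearFlow_ne_zero B t hY
      have h2 : T (Y, s₀) - t = T (linearFlow B t Y, s₀) := (hT1 _ h1 s₀).2 _ (by
        rw [← linearFlow_add, sub_add_cancel]; exact (hT1 Y hY s₀).1)
      simp only [Homeomorph.homeomorph_mk_coe, Equiv.coe_fn_mk, if_neg h1, if_neg hY]
      rw [← h2, ← linearFlow_add, ← linearFlow_add, sub_add_cancel]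
      congr 2
      ring
  · have h2 : 0 = T (Y₀, s₀) := (hT1 _ hY₀ s₀).2 _ (by simp [hs₀])
    simp only [Homeomorph.homeomorph_mk_coe, Equiv.coe_fn_mk, if_neg hY₀]
    rw [← h2]
    simp

end Expanding


/-! ### Expanding linear flows on the plane -/

section Planar

/-- A quadratic function which is strictly increasing along the linear flow of `B` on the plane,
when `B (τ • Y - B Y) = δ • Y`. -/
noncomputable def planarEnergy (δ τ : ℝ) (B : ℝ × ℝ →L[ℝ] ℝ × ℝ) (Y : ℝ × ℝ) : ℝ :=
  δ * (Y.1 ^ 2 + Y.2 ^ 2) + ((τ • Y - B Y).1 ^ 2 + (τ • Y - B Y).2 ^ 2)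

variable {δ τ : ℝ} {B : ℝ × ℝ →L[ℝ] ℝ × ℝ}

theorem contDiff_planarEnergy : ContDiff ℝ 1 (planarEnergy δ τ B) := by
  unfold planarEnergy
  fun_prop

theorem norm_sq_le_fst_sq_add_snd_sq (Y : ℝ × ℝ) : ‖Y‖ ^ 2 ≤ Y.1 ^ 2 + Y.2 ^ 2 := by
  rw [Prod.norm_def, Real.norm_eq_abs, Real.norm_eq_abs]
  rcases max_choice |Y.1| |Y.2| with h | h <;> rw [h, sq_abs] <;> nlinarith [sq_nonneg Y.1, sq_nonneg Y.2]

theorem fst_sq_add_snd_sq_le (Y : ℝ × ℝ) : Y.1 ^ 2 + Y.2 ^ 2 ≤ 2 * ‖Y‖ ^ 2 := by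
  have h1 : Y.1 ^ 2 ≤ ‖Y‖ ^ 2 := sq_le_sq.2 (by rw [abs_norm]; exact norm_fst_le Y)
  have h2 : Y.2 ^ 2 ≤ ‖Y‖ ^ 2 := sq_le_sq.2 (by rw [abs_norm]; exact norm_snd_le Y)
  linarith

theorem fst_sq_add_snd_sq_pos {Y : ℝ × ℝ} (hY : Y ≠ 0) : 0 < Y.1 ^ 2 + Y.2 ^ 2 :=
  (pow_pos (norm_pos_iff.2 hY) 2).trans_le (norm_sq_le_fst_sq_add_snd_sq Y)

theorem mul_le_planarEnergy (Y : ℝ × ℝ) : δ * (Y.1 ^ 2 + Y.2 ^ 2) ≤ planarEnergy δ τ B Y := by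
  unfold planarEnergy
  nlinarith [sq_nonneg (τ • Y - B Y).1, sq_nonneg (τ • Y - B Y).2]

theorem planarEnergy_le (Y : ℝ × ℝ) :
    planarEnergy δ τ B Y ≤ (δ + 2 * (|τ| + ‖B‖) ^ 2) * (Y.1 ^ 2 + Y.2 ^ 2) := by
  have h1 : ‖τ • Y - B Y‖ ≤ (|τ| + ‖B‖) * ‖Y‖ := by
    refine (norm_sub_le _ _).trans ?_
    rw [norm_smul, Real.norm_eq_abs, add_mul]
    gcongr
    exact B.le_opNorm Y
  have h2 := fst_sq_add_snd_sq_le (τ • Y - B Y)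
  have h3 : ‖τ • Y - B Y‖ ^ 2 ≤ (|τ| + ‖B‖) ^ 2 * ‖Y‖ ^ 2 := by
    rw [← mul_pow]; gcongr
  have h4 := mul_le_mul_of_nonneg_left (norm_sq_le_fst_sq_add_snd_sq Y)
    (sq_nonneg (|τ| + ‖B‖))
  unfold planarEnergy
  linarith

theorem planarEnergy_pos (hδ : 0 < δ) {Y : ℝ × ℝ} (hY : Y ≠ 0) : 0 < planarEnergy δ τ B Y :=
  (mul_pos hδ (fst_sq_add_snd_sq_pos hY)).trans_le (mul_le_planarEnergy Y)

/-- The relation says `B² - τ B + δ = 0`. Differentiating the energy gives `2 δ ⟨Y, B Y⟩ + 2 ⟨τ Y -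
B Y, δ Y⟩ = 2 δ τ |Y|²`: the indefinite terms cancel. No eigenvector is involved, so complex
eigenvalues and Jordan blocks need no separate treatment. -/
theorem hasDerivAt_log_planarEnergy (hδ : 0 < δ) (hB : ∀ Y, B (τ • Y - B Y) = δ • Y)
    {Y : ℝ × ℝ} (hY : Y ≠ 0) (t : ℝ) :
    HasDerivAt (fun t => Real.log (planarEnergy δ τ B (linearFlow B t Y)))
      (2 * δ * τ * ((linearFlow B t Y).1 ^ 2 + (linearFlow B t Y).2 ^ 2) /
        planarEnergy δ τ B (linearFlow B t Y)) t := by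
  have h1 : HasDerivAt (fun t => linearFlow B t Y) (B (linearFlow B t Y)) t :=
    hasDerivAt_linearFlow_apply B Y t
  have h2 := ((h1.const_smul τ).sub (B.hasFDerivAt.comp_hasDerivAt t h1))
  have h1a := (ContinuousLinearMap.fst ℝ ℝ ℝ).hasFDerivAt.comp_hasDerivAt t h1
  have h1b := (ContinuousLinearMap.snd ℝ ℝ ℝ).hasFDerivAt.comp_hasDerivAt t h1
  have h2a := (ContinuousLinearMap.fst ℝ ℝ ℝ).hasFDerivAt.comp_hasDerivAt t h2
  have h2b := (ContinuousLinearMap.snd ℝ ℝ ℝ).hasFDerivAt.comp_hasDerivAt t h2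
  have h3 := ((((h1a.pow 2).add (h1b.pow 2)).const_mul δ).add
    ((h2a.pow 2).add (h2b.pow 2)))
  have h4 := h3.log (x := t) (planarEnergy_pos hδ (linearFlow_ne_zero B t hY)).ne'
  refine h4.congr_deriv ?_
  set Z := linearFlow B t Y with hZ
  have e := hB Z
  have e' : τ • B Z - B (B Z) = δ • Z := by rw [← e, map_sub, map_smul]
  change _ / planarEnergy δ τ B Z = _
  congr 1
  have ea : (τ • B Z - B (B Z)).1 = δ * Z.1 := by rw [e']; rfl
  have eb : (τ • B Z - B (B Z)).2 = δ * Z.2 := by rw [e']; rfl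
  simp only [ContinuousLinearMap.coe_fst', ContinuousLinearMap.coe_snd', Function.comp_apply,
    Pi.sub_apply, Pi.smul_apply]
  rw [ea, eb]
  simp only [Prod.fst_sub, Prod.snd_sub, Prod.smul_fst, Prod.smul_snd, smul_eq_mul, ← hZ]
  push_cast
  ring

/-- The energy is comparable to `|Y|²`, so its logarithmic derivative `2 δ τ |Y|² / N` lies between
two positive constants. -/
theorem isExpandingFor_planarEnergy (hδ : 0 < δ) (hτ : 0 < τ)
    (hB : ∀ Y, B (τ • Y - B Y) = δ • Y) : IsExpandingFor (planarEnergy δ τ B) B := by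
  have hC : 0 < δ + 2 * (|τ| + ‖B‖) ^ 2 := by positivity
  refine ⟨2 * δ * τ / (δ + 2 * (|τ| + ‖B‖) ^ 2), 2 * τ, by positivity, by positivity,
    fun Y hY s t hst => ?_⟩
  have hd := hasDerivAt_log_planarEnergy hδ hB hY
  have hdiff : Differentiable ℝ fun t => Real.log (planarEnergy δ τ B (linearFlow B t Y)) :=
    fun t => (hd t).differentiableAt
  constructor
  · refine mul_sub_le_image_sub_of_le_deriv hdiff (fun t => ?_) hst
    rw [(hd t).deriv, div_le_div_iff₀ hC (planarEnergy_pos hδ (linearFlow_ne_zero B t hY)), mul_assoc _ _ (δ + _)]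
    refine mul_le_mul_of_nonneg_left ?_ (by positivity)
    rw [mul_comm]
    exact planarEnergy_le _
  · refine image_sub_le_mul_sub_of_deriv_le hdiff (fun t => ?_) hst
    rw [(hd t).deriv, div_le_iff₀ (planarEnergy_pos hδ (linearFlow_ne_zero B t hY))]
    have := mul_le_mul_of_nonneg_left (mul_le_planarEnergy (δ := δ) (τ := τ) (B := B)
      (linearFlow B t Y)) (show 0 ≤ 2 * τ by positivity)
    linarith

/-- The energy is homogeneous of degree two, so its logarithm grows at rate exactly `2` under
dilation. One function thus serves both flows to be conjugated. -/
theorem isExpandingFor_planarEnergy_one (hδ : 0 < δ) :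
    IsExpandingFor (planarEnergy δ τ B) 1 := by
  refine ⟨2, 2, by norm_num, by norm_num, fun Y hY s t hst => ?_⟩
  have h (t : ℝ) : Real.log (planarEnergy δ τ B (linearFlow 1 t Y)) =
      2 * t + Real.log (planarEnergy δ τ B Y) := by
    have h1 : planarEnergy δ τ B (linearFlow 1 t Y) = Real.exp (2 * t) * planarEnergy δ τ B Y := by
      rw [linearFlow_one, show 2 * t = t + t by ring, Real.exp_add]
      simp only [planarEnergy, map_smul, Prod.fst_sub, Prod.snd_sub, Prod.smul_fst, Prod.smul_snd,
        smul_eq_mul]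
      ring
    rw [h1, Real.log_mul (Real.exp_pos _).ne' (planarEnergy_pos hδ hY).ne', Real.log_exp]
  rw [h, h]
  constructor <;> linarith

theorem hasStrictFDerivAt_linearFlow_apply {V : Type*} [NormedAddCommGroup V] [NormedSpace ℝ V]
    [CompleteSpace V] (B : V →L[ℝ] V) (z : V × ℝ) :
    ∃ D : V × ℝ →L[ℝ] V, HasStrictFDerivAt (fun z : V × ℝ => linearFlow B z.2 z.1) D z := by
  have h1 : HasStrictDerivAt (linearFlow B) (NormedSpace.exp (z.2 • B) * B) z.2 :=
    hasStrictDerivAt_exp_smul_const B z.2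
  have h2 : HasStrictFDerivAt (fun z : V × ℝ => linearFlow B z.2) _ z :=
    h1.hasStrictFDerivAt.comp z hasStrictFDerivAt_snd
  exact ⟨_, h2.clm_apply hasStrictFDerivAt_fst⟩

/-- A linear flow on the plane with two unstable eigenvalues is conjugate to the flow of the radial
vector field, by a conjugacy which is regular at a given point. -/
theorem exists_planar_conjugacy (hδ : 0 < δ) (hτ : 0 < τ)
    (hB : ∀ Y, B (τ • Y - B Y) = δ • Y) {Y₀ : ℝ × ℝ} (hY₀ : Y₀ ≠ 0) :
    ∃ (H : ℝ × ℝ ≃ₜ ℝ × ℝ) (D : ℝ × ℝ →L[ℝ] ℝ × ℝ),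
      (∀ t Y, H (linearFlow B t Y) = Real.exp t • H Y) ∧ H Y₀ = Y₀ ∧ H 0 = 0 ∧
      HasStrictFDerivAt H D Y₀ := by
  have hN : Continuous (planarEnergy δ τ B) := contDiff_planarEnergy.continuous
  have hN0 : ∀ Y ≠ 0, 0 < planarEnergy δ τ B Y := fun Y => planarEnergy_pos hδ
  have hNz : planarEnergy δ τ B 0 = 0 := by simp [planarEnergy]
  have h := isExpandingFor_planarEnergy hδ hτ hB
  have h' : IsExpandingFor (planarEnergy δ τ B) 1 := isExpandingFor_planarEnergy_one hδ
  obtain ⟨T, hT, hT1⟩ := h.exists_time hN hN0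
  obtain ⟨T', hT', hT'1⟩ := h'.exists_time hN hN0
  obtain ⟨H, hH, hHY₀, hH0, hHT⟩ := IsExpandingFor.exists_conjugacy hN hN0 hNz
    (fun Y => (mul_le_mul_of_nonneg_left (norm_sq_le_fst_sq_add_snd_sq Y) hδ.le).trans
      (mul_le_planarEnergy Y)) hδ h h' hY₀ hT hT1 hT' hT'1
  set s₀ := Real.log (planarEnergy δ τ B Y₀) with hs₀
  have hT0 : T (Y₀, s₀) = 0 := ((hT1 _ hY₀ s₀).2 0 (by simp [hs₀])).symm
  -- the time function is strictly differentiable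
  obtain ⟨D₁, hD₁⟩ := hasStrictFDerivAt_linearFlow_apply B (Y₀, 0)
  have hF : ∃ D : (ℝ × ℝ) × ℝ →L[ℝ] ℝ, HasStrictFDerivAt
      (fun z : (ℝ × ℝ) × ℝ => Real.log (planarEnergy δ τ B (linearFlow B z.2 z.1))) D (Y₀, 0) := by
    have h1 := (contDiff_planarEnergy (δ := δ) (τ := τ) (B := B)).hasStrictFDerivAt one_ne_zero
      (x := linearFlow B 0 Y₀)
    exact ⟨_, HasStrictFDerivAt.log
      (HasStrictFDerivAt.comp (f := fun z : (ℝ × ℝ) × ℝ => linearFlow B z.2 z.1) (Y₀, 0) h1 hD₁)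
      (hN0 _ (linearFlow_ne_zero B 0 hY₀)).ne'⟩
  obtain ⟨D, hD⟩ := hF
  have hρ : 0 < D (0, 1) := by
    have h1 : HasDerivAt (fun t : ℝ => ((Y₀, t) : (ℝ × ℝ) × ℝ)) (0, 1) 0 :=
      (hasDerivAt_const 0 Y₀).prodMk (hasDerivAt_id 0)
    have h2 := HasFDerivAt.comp_hasDerivAt (f := fun t : ℝ => ((Y₀, t) : (ℝ × ℝ) × ℝ)) 0
      hD.hasFDerivAt h1
    rw [h2.unique (hasDerivAt_log_planarEnergy hδ hB hY₀ 0)]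
    have := fst_sq_add_snd_sq_pos (linearFlow_ne_zero B 0 hY₀)
    have := hN0 _ (linearFlow_ne_zero B 0 hY₀)
    positivity
  -- The derivative of `(Y, t) ↦ (Y, log N)` is triangular with nonzero diagonal entry `D (0, 1)`;
  -- `(Y, s) ↦ (Y, T (Y, s))` is a continuous local inverse, hence strictly differentiable.
  let Ψ : ((ℝ × ℝ) × ℝ) ≃L[ℝ] (ℝ × ℝ) × ℝ :=
    (ContinuousLinearEquiv.refl ℝ (ℝ × ℝ)).skewProd
      (ContinuousLinearEquiv.unitsEquivAut ℝ (Units.mk0 (D (0, 1)) hρ.ne'))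
      (D ∘L ContinuousLinearMap.inl ℝ (ℝ × ℝ) ℝ)
  have hΨ : HasStrictFDerivAt (fun z : (ℝ × ℝ) × ℝ =>
      (z.1, Real.log (planarEnergy δ τ B (linearFlow B z.2 z.1))))
      (Ψ : ((ℝ × ℝ) × ℝ) →L[ℝ] (ℝ × ℝ) × ℝ) (Y₀, 0) := by
    refine (hasStrictFDerivAt_fst.prodMk hD).congr_fderiv ?_
    ext <;> simp [Ψ]
    exact map_zero D
  have hg : HasStrictFDerivAt (fun z : (ℝ × ℝ) × ℝ => (z.1, T z))
      (Ψ.symm : ((ℝ × ℝ) × ℝ) →L[ℝ] (ℝ × ℝ) × ℝ) (Y₀, s₀) := by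
    refine HasStrictFDerivAt.of_local_left_inverse (f := fun z : (ℝ × ℝ) × ℝ =>
      (z.1, Real.log (planarEnergy δ τ B (linearFlow B z.2 z.1)))) ?_ ?_ ?_
    · exact continuousAt_fst.prodMk (hT Y₀ hY₀ s₀)
    · simp only [hT0]
      exact hΨ
    · have : ∀ᶠ z : (ℝ × ℝ) × ℝ in 𝓝 (Y₀, s₀), z.1 ≠ 0 :=
        continuousAt_fst.eventually_ne hY₀
      filter_upwards [this] with z hz
      exact Prod.ext rfl (hT1 z.1 hz z.2).1
  have hYT : HasStrictFDerivAt (fun Y : ℝ × ℝ => (Y, T (Y, s₀))) _ Y₀ :=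
    HasStrictFDerivAt.comp (f := fun Y : ℝ × ℝ => (Y, s₀)) Y₀ hg
      ((hasStrictFDerivAt_id Y₀).prodMk (hasStrictFDerivAt_const s₀ Y₀))
  have hTs : HasStrictFDerivAt (fun Y : ℝ × ℝ => T (Y, s₀)) _ Y₀ := hYT.snd
  have hflow := HasStrictFDerivAt.comp (f := fun Y : ℝ × ℝ => (Y, T (Y, s₀))) Y₀
    (g := fun z : (ℝ × ℝ) × ℝ => linearFlow B z.2 z.1) (by simpa only [hT0] using hD₁) hYT
  have hexp := (hTs.neg.exp).smul hflow
  refine ⟨H, _, fun t Y => by rw [hH, linearFlow_one], hHY₀, hH0, hexp.congr_of_eventuallyEq ?_⟩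
  filter_upwards [isOpen_ne.mem_nhds hY₀] with Y hY
  rw [hHT Y hY, linearFlow_one]
  rfl

end Planar


/-! ### Signed powers on the line -/

section SignedPower

/-- The odd extension of the real power function. -/
noncomputable def signedPow (c x : ℝ) : ℝ := max x 0 ^ c - max (-x) 0 ^ c

theorem continuous_signedPow {c : ℝ} (hc : 0 < c) : Continuous (signedPow c) := by
  unfold signedPow
  exact ((continuous_id.max continuous_const).rpow_const fun _ => Or.inr hc.le).sub
    ((continuous_neg.max continuous_const).rpow_const fun _ => Or.inr hc.le)

theorem signedPow_of_nonneg {c x : ℝ} (hc : 0 < c) (hx : 0 ≤ x) : signedPow c x = x ^ c := by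
  rw [signedPow, max_eq_left hx, max_eq_right (neg_nonpos.2 hx), Real.zero_rpow hc.ne', sub_zero]

theorem signedPow_neg (c x : ℝ) : signedPow c (-x) = -signedPow c x := by
  rw [signedPow, signedPow, neg_neg, neg_sub]

theorem signedPow_zero {c : ℝ} (hc : 0 < c) : signedPow c 0 = 0 := by
  rw [signedPow_of_nonneg hc le_rfl, Real.zero_rpow hc.ne']

/-- Positive homogeneity is what changes the rate of a one-dimensional contraction: with `c = a⁻¹`,
the factor `exp (-a t)` becomes `exp (-t)`. -/
theorem signedPow_mul {c y : ℝ} (x : ℝ) (hy : 0 ≤ y) :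
    signedPow c (x * y) = signedPow c x * y ^ c := by
  have h1 (x : ℝ) : max (x * y) 0 = max x 0 * y := by rw [max_mul_of_nonneg _ _ hy, zero_mul]
  rw [signedPow, signedPow, ← neg_mul, h1, h1, Real.mul_rpow (le_max_right _ _) hy,
    Real.mul_rpow (le_max_right _ _) hy, sub_mul]

theorem signedPow_signedPow {c d : ℝ} (hc : 0 < c) (hd : 0 < d) (hcd : d * c = 1) (x : ℝ) :
    signedPow c (signedPow d x) = x := by
  have h (x : ℝ) (hx : 0 ≤ x) : signedPow c (signedPow d x) = x := by
    rw [signedPow_of_nonneg hd hx, signedPow_of_nonneg hc (Real.rpow_nonneg hx d),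
      ← Real.rpow_mul hx, hcd, Real.rpow_one]
  rcases le_total 0 x with hx | hx
  · exact h x hx
  · have := h (-x) (neg_nonneg.2 hx)
    rwa [signedPow_neg, signedPow_neg, neg_inj] at this

/-- The odd extension of the power function, as a homeomorphism of the line. -/
noncomputable def signedPowHomeomorph {c : ℝ} (hc : 0 < c) : ℝ ≃ₜ ℝ where
  toFun := signedPow c
  invFun := signedPow c⁻¹
  left_inv := signedPow_signedPow (inv_pos.2 hc) hc (mul_inv_cancel₀ hc.ne')
  right_inv := signedPow_signedPow hc (inv_pos.2 hc) (inv_mul_cancel₀ hc.ne')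
  continuous_toFun := continuous_signedPow hc
  continuous_invFun := continuous_signedPow (inv_pos.2 hc)

end SignedPower

/-! ### The model flow and its symmetries -/

section ModelFlow

/-- The model linear flow on three-space, with eigenvalues `-1, 1, 1`. -/
noncomputable def modelFlow (t : ℝ) (z : ℝ × ℝ × ℝ) : ℝ × ℝ × ℝ :=
  (Real.exp (-t) * z.1, Real.exp t * z.2.1, Real.exp t * z.2.2)

@[simp] theorem modelFlow_zero (z : ℝ × ℝ × ℝ) : modelFlow 0 z = z := by simp [modelFlow]

@[simp] theorem modelFlow_apply_zero (t : ℝ) : modelFlow t 0 = 0 := by simp [modelFlow]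

theorem modelFlow_add (s t : ℝ) (z : ℝ × ℝ × ℝ) :
    modelFlow (s + t) z = modelFlow s (modelFlow t z) := by
  simp only [modelFlow, neg_add, Real.exp_add, mul_assoc]

theorem continuous_modelFlow : Continuous fun z : ℝ × (ℝ × ℝ × ℝ) => modelFlow z.1 z.2 := by
  unfold modelFlow
  fun_prop

/-- A homeomorphism of three-space commuting with the model flow and fixing the origin and the
half-line through `(0, 1, 0)`. -/
structure IsModelSymmetry (S : ℝ × ℝ × ℝ ≃ₜ ℝ × ℝ × ℝ) : Prop where
  comm : ∀ t z, S (modelFlow t z) = modelFlow t (S z)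
  zero : S 0 = 0
  axis : ∀ y : ℝ, 0 < y → S (0, y, 0) = (0, y, 0)

theorem IsModelSymmetry.trans {S S' : ℝ × ℝ × ℝ ≃ₜ ℝ × ℝ × ℝ} (h : IsModelSymmetry S)
    (h' : IsModelSymmetry S') : IsModelSymmetry (S.trans S') where
  comm t z := by simp [h.comm, h'.comm]
  zero := by simp [h.zero, h'.zero]
  axis y hy := by simp [h.axis y hy, h'.axis y hy]

/-- The clamping of a real number to `[-r, r]`. -/
noncomputable def clamp (r t : ℝ) : ℝ := max (-r) (min r t)

theorem continuous_clamp (r : ℝ) : Continuous (clamp r) := by unfold clamp; fun_prop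

theorem clamp_mem {r : ℝ} (hr : 0 ≤ r) (t : ℝ) : clamp r t ∈ Icc (-r) r :=
  ⟨le_max_left _ _, max_le (by linarith) (min_le_left _ _)⟩

theorem clamp_of_mem {r t : ℝ} (ht : t ∈ Icc (-r) r) : clamp r t = t := by
  rw [clamp, min_eq_right ht.2, max_eq_right ht.1]

theorem clamp_zero {r : ℝ} (hr : 0 ≤ r) : clamp r 0 = 0 := clamp_of_mem ⟨by linarith, hr⟩

theorem clamp_mono (r : ℝ) : Monotone (clamp r) := fun _ _ h =>
  max_le_max le_rfl (min_le_min le_rfl h)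

theorem sub_clamp_mono {r : ℝ} (hr : 0 ≤ r) : Monotone fun t => t - clamp r t := by
  intro s t h
  simp only [clamp]
  rcases le_total r s with h1 | h1 <;> rcases le_total r t with h2 | h2 <;>
  rcases le_total (-r) s with h3 | h3 <;> rcases le_total (-r) t with h4 | h4 <;>
  simp_all <;> linarith

/-- Both invariants of the model flow vanish at `(0, 1, 0)`, so a symmetry built from clamped
invariants is the intended one near that point. -/
theorem eventually_clamp_eq {r : ℝ} (hr : 0 < r) : 
    ∀ᶠ z : ℝ × ℝ × ℝ in 𝓝 (0, 1, 0), 0 < z.2.1 ∧ clamp r (z.1 * z.2.1) = z.1 * z.2.1 ∧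
      clamp r (z.2.2 / z.2.1) = z.2.2 / z.2.1 := by
  have h1 : ∀ᶠ z : ℝ × ℝ × ℝ in 𝓝 (0, 1, 0), 0 < z.2.1 :=
    ContinuousAt.eventually_lt (f := fun _ => (0 : ℝ)) (by fun_prop) (by fun_prop) (by simp)
  have hI : Icc (-r) r ∈ 𝓝 (0 : ℝ) := Icc_mem_nhds (by linarith) hr
  have h2 : ContinuousAt (fun z : ℝ × ℝ × ℝ => z.1 * z.2.1) (0, 1, 0) := by fun_prop
  have h3 : ContinuousAt (fun z : ℝ × ℝ × ℝ => z.2.2 / z.2.1) (0, 1, 0) := by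
    refine ContinuousAt.div (by fun_prop) (by fun_prop) (by simp)
  have h2' : Tendsto (fun z : ℝ × ℝ × ℝ => z.1 * z.2.1) (𝓝 (0, 1, 0)) (𝓝 0) := by
    simpa only [ContinuousAt, zero_mul] using h2
  have h3' : Tendsto (fun z : ℝ × ℝ × ℝ => z.2.2 / z.2.1) (𝓝 (0, 1, 0)) (𝓝 0) := by
    simpa only [ContinuousAt, zero_div] using h3
  filter_upwards [h1, h2' hI, h3' hI] with z h1 h2 h3
  exact ⟨h1, clamp_of_mem h2, clamp_of_mem h3⟩

/-- A function of the invariants of the model flow, cut off in the half-space where they are not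
defined, is continuous if it vanishes for `x = 0`. -/
theorem exists_model_shift {r : ℝ} (hr : 0 < r) {e : ℝ × ℝ → ℝ}
    (he : ContinuousOn e (Icc (-r) r ×ˢ Icc (-r) r)) (he0 : ∀ η ∈ Icc (-r) r, e (0, η) = 0) :
    ∃ S, IsModelSymmetry S ∧ ∀ᶠ z in 𝓝 ((0, 1, 0) : ℝ × ℝ × ℝ),
      S z = modelFlow (e (z.1 * z.2.1, z.2.2 / z.2.1)) z := by
  classical
  let g : ℝ × ℝ → ℝ := fun z => e (clamp r z.1, clamp r z.2)
  have hg : Continuous g := he.comp_continuous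
    (((continuous_clamp r).comp continuous_fst).prodMk ((continuous_clamp r).comp continuous_snd))
    fun z => ⟨clamp_mem hr.le _, clamp_mem hr.le _⟩
  have hg0 (η : ℝ) : g (0, η) = 0 := by
    simp only [g, clamp_zero hr.le]
    exact he0 _ (clamp_mem hr.le _)
  let E : ℝ × ℝ × ℝ → ℝ := fun z => if 0 < z.2.1 then g (z.1 * z.2.1, z.2.2 / z.2.1) else 0
  have hE : Continuous E := by
    rw [continuous_iff_continuousAt]
    rintro ⟨x, y, y'⟩
    rcases lt_trichotomy 0 y with hy | hy | hy
    · have h1 : ContinuousAt (fun z : ℝ × ℝ × ℝ => g (z.1 * z.2.1, z.2.2 / z.2.1)) (x, y, y') := by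
        refine hg.continuousAt.comp (ContinuousAt.prodMk (by fun_prop) ?_)
        exact ContinuousAt.div (by fun_prop) (by fun_prop) hy.ne'
      refine h1.congr ?_
      have : ∀ᶠ z : ℝ × ℝ × ℝ in 𝓝 (x, y, y'), 0 < z.2.1 :=
        ContinuousAt.eventually_lt (f := fun _ => (0 : ℝ)) (by fun_prop) (by fun_prop) hy
      filter_upwards [this] with z hz
      exact (if_pos hz).symm
    · subst hy
      have hE0 : E (x, 0, y') = 0 := if_neg (lt_irrefl _)
      rw [ContinuousAt, hE0, Metric.tendsto_nhds]
      intro ε hε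
      -- As `y` decreases to `0` the invariant `y' / y` has no limit, but it is clamped to a compact
      -- interval, on which `g (u, ·)` tends uniformly to `0` with `u = x y`.
      have h1 : ∀ᶠ u in 𝓝 (0 : ℝ), ∀ η ∈ Icc (-r) r, dist (g (u, η)) 0 < ε := by
        refine isCompact_Icc.eventually_forall_of_forall_eventually fun η _ => ?_
        have h2 : ContinuousAt (fun z : ℝ × ℝ => g (z.1, z.2)) (0, η) := hg.continuousAt
        have := Metric.tendsto_nhds.1 h2 ε hε
        simpa only [hg0] using this
      have h2 : ContinuousAt (fun z : ℝ × ℝ × ℝ => z.1 * z.2.1) (x, 0, y') := by fun_prop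
      simp only [ContinuousAt, mul_zero] at h2
      filter_upwards [h2.eventually h1] with z hz
      by_cases h : 0 < z.2.1
      · have hm := clamp_mem hr.le (z.2.2 / z.2.1)
        have h3 := hz (clamp r (z.2.2 / z.2.1)) hm
        simp only [E, if_pos h]
        simpa only [g, clamp_of_mem hm] using h3
      · simpa only [E, if_neg h, dist_self] using hε
    · refine ContinuousAt.congr (f := fun _ => 0) continuousAt_const ?_
      have : ∀ᶠ z : ℝ × ℝ × ℝ in 𝓝 (x, y, y'), z.2.1 < 0 :=
        ContinuousAt.eventually_lt (g := fun _ => (0 : ℝ)) (by fun_prop) (by fun_prop) hy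
      filter_upwards [this] with z hz
      exact (if_neg hz.not_gt).symm
  -- `E` is constant along orbits, so flowing for time `E` commutes with the flow and is undone by
  -- flowing for time `-E`.
  have hEinv (t : ℝ) (z : ℝ × ℝ × ℝ) : E (modelFlow t z) = E z := by
    have h1 : 0 < Real.exp t * z.2.1 ↔ 0 < z.2.1 := mul_pos_iff_of_pos_left (Real.exp_pos t)
    simp only [E, modelFlow, h1]
    rw [mul_div_mul_left _ _ (Real.exp_pos t).ne', mul_mul_mul_comm, ← Real.exp_add,
      neg_add_cancel, Real.exp_zero, one_mul]
  refine ⟨{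
    toFun := fun z => modelFlow (E z) z
    invFun := fun z => modelFlow (-E z) z
    left_inv := fun z => by
      simp only [hEinv]
      rw [← modelFlow_add, neg_add_cancel, modelFlow_zero]
    right_inv := fun z => by
      simp only [hEinv]
      rw [← modelFlow_add, add_neg_cancel, modelFlow_zero]
    continuous_toFun := continuous_modelFlow.comp (hE.prodMk continuous_id)
    continuous_invFun := continuous_modelFlow.comp (hE.neg.prodMk continuous_id) }, ⟨?_, ?_, ?_⟩, ?_⟩
  · intro t z
    simp only [Homeomorph.homeomorph_mk_coe, Equiv.coe_fn_mk, hEinv]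
    rw [← modelFlow_add, ← modelFlow_add, add_comm]
  · simp
  · intro y hy
    have : E (0, y, 0) = 0 := by simp only [E, if_pos hy, zero_mul, hg0]
    simp [this]
  · filter_upwards [eventually_clamp_eq hr] with z hz
    simp only [Homeomorph.homeomorph_mk_coe, Equiv.coe_fn_mk, E, if_pos hz.1, g, hz.2.1, hz.2.2]

/-- The homeomorphism replaces `η = y' / y` by `ζ (u, η)` near the axis. It is written `y' ↦ y' +
max y 0 * b` with `b = ζ - η` at clamped arguments. As `b` is bounded, the map extends continuously
by the identity to `y ≤ 0`, and each fibre map is at bounded distance from the identity, hence onto.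
Monotonicity comes from `η + b = (η - clamp r η) + ζ (clamp r u, clamp r η)`. -/
theorem exists_model_shear_of_strictMonoOn {r : ℝ} (hr : 0 < r) {ζ : ℝ × ℝ → ℝ}
    (hζ : ContinuousOn ζ (Icc (-r) r ×ˢ Icc (-r) r))
    (hm : ∀ u ∈ Icc (-r) r, StrictMonoOn (fun η => ζ (u, η)) (Icc (-r) r)) (hζ0 : ζ (0, 0) = 0) :
    ∃ S, IsModelSymmetry S ∧ ∀ᶠ z in 𝓝 ((0, 1, 0) : ℝ × ℝ × ℝ),
      S z = (z.1, z.2.1, z.2.1 * ζ (z.1 * z.2.1, z.2.2 / z.2.1)) := by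
  let b : ℝ × ℝ → ℝ := fun z => ζ (clamp r z.1, clamp r z.2) - clamp r z.2
  have hb : Continuous b := (hζ.comp_continuous
    (((continuous_clamp r).comp continuous_fst).prodMk ((continuous_clamp r).comp continuous_snd))
    fun z => ⟨clamp_mem hr.le _, clamp_mem hr.le _⟩).sub ((continuous_clamp r).comp continuous_snd)
  obtain ⟨C, hC⟩ : ∃ C, ∀ z, |b z| ≤ C := by
    obtain ⟨C, hC⟩ := (isCompact_Icc.prod isCompact_Icc).exists_bound_of_continuousOn
      (s := Icc (-r) r ×ˢ Icc (-r) r) hb.continuousOn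
    refine ⟨C, fun z => ?_⟩
    have := hC (clamp r z.1, clamp r z.2) ⟨clamp_mem hr.le _, clamp_mem hr.le _⟩
    simpa only [b, clamp_of_mem (clamp_mem hr.le _), Real.norm_eq_abs] using this
  let f : (ℝ × ℝ) × ℝ → ℝ := fun z => z.2 + max z.1.2 0 * b (z.1.1 * z.1.2, z.2 / z.1.2)
  have hf : Continuous f := by
    refine continuous_snd.add ?_
    rw [continuous_iff_continuousAt]
    rintro ⟨⟨x, y⟩, y'⟩
    rcases eq_or_ne y 0 with rfl | hy
    · have h1 : Tendsto (fun z : (ℝ × ℝ) × ℝ => max z.1.2 0 * C) (𝓝 ((x, 0), y')) (𝓝 0) := by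
        have : Continuous (fun z : (ℝ × ℝ) × ℝ => max z.1.2 0 * C) := by fun_prop
        simpa using this.tendsto ((x, 0), y')
      simp only [ContinuousAt, max_self, zero_mul]
      refine squeeze_zero_norm (fun z => ?_) h1
      rw [norm_mul, Real.norm_eq_abs, Real.norm_eq_abs, abs_of_nonneg (le_max_right _ _)]
      exact mul_le_mul_of_nonneg_left (hC _) (le_max_right _ _)
    · refine ContinuousAt.mul (by fun_prop) (hb.continuousAt.comp
        (ContinuousAt.prodMk (by fun_prop) ?_))
      exact ContinuousAt.div (by fun_prop) (by fun_prop) hy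
  have hfm : ∀ x, StrictMono fun t => f (x, t) := by
    rintro ⟨x, y⟩ t t' htt
    rcases le_or_gt y 0 with hy | hy
    · simpa only [f, max_eq_right hy, zero_mul, add_zero] using htt
    have key : StrictMono fun η => η + b (x * y, η) := by
      intro η η' h
      have h1 := sub_clamp_mono hr.le h.le
      have hmu := hm _ (clamp_mem hr.le (x * y))
      have h2 := hmu.monotoneOn (clamp_mem hr.le η) (clamp_mem hr.le η') (clamp_mono r h.le)
      simp only [b] at h1 h2 ⊢
      rcases (clamp_mono r h.le).eq_or_lt with h3 | h3
      · rw [h3]; linarith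
      · have h4 := hmu (clamp_mem hr.le η) (clamp_mem hr.le η') h3
        simp only at h4
        linarith
    have h1 (s : ℝ) : f ((x, y), s) = y * (s / y + b (x * y, s / y)) := by
      simp only [f, max_eq_left hy.le]
      field_simp
    simp only [h1]
    exact mul_lt_mul_of_pos_left (key (div_lt_div_of_pos_right htt hy)) hy
  have hfb (x : ℝ × ℝ) (t : ℝ) : |f (x, t) - t| ≤ max x.2 0 * C := by
    simp only [f, add_sub_cancel_left]
    rw [abs_mul, abs_of_nonneg (le_max_right x.2 0)]
    exact mul_le_mul_of_nonneg_left (hC _) (le_max_right _ _)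
  have hfs : ∀ x, Function.Surjective fun t => f (x, t) := by
    intro x
    refine Continuous.surjective (by fun_prop) ?_ ?_
    · refine tendsto_atTop_mono (fun t => ?_)
        (tendsto_atTop_add_const_right _ (-(max x.2 0 * C)) tendsto_id)
      have := (abs_le.1 (hfb x t)).1
      simp only [id]; linarith
    · refine tendsto_atBot_mono (fun t => ?_)
        (tendsto_atBot_add_const_right _ (max x.2 0 * C) tendsto_id)
      have := (abs_le.1 (hfb x t)).2
      simp only [id]; linarith
  obtain ⟨g, hg, hgf, hfg⟩ := exists_continuous_inverse_of_strictMono hf hfm hfs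
  refine ⟨{
    toFun := fun z => (z.1, z.2.1, f ((z.1, z.2.1), z.2.2))
    invFun := fun z => (z.1, z.2.1, g ((z.1, z.2.1), z.2.2))
    left_inv := fun z => by simp [hgf]
    right_inv := fun z => by simp [hfg]
    continuous_toFun := by fun_prop
    continuous_invFun := by fun_prop }, ⟨?_, ?_, ?_⟩, ?_⟩
  · intro t z
    have h1 : max (Real.exp t * z.2.1) 0 = Real.exp t * max z.2.1 0 := by
      rw [mul_max_of_nonneg _ _ (Real.exp_pos t).le, mul_zero]
    simp only [Homeomorph.homeomorph_mk_coe, Equiv.coe_fn_mk, modelFlow, f, h1]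
    rw [mul_div_mul_left _ _ (Real.exp_pos t).ne', mul_mul_mul_comm, ← Real.exp_add,
      neg_add_cancel, Real.exp_zero, one_mul]
    simp only [Prod.mk.injEq, true_and]
    ring
  · simp [f]
  · intro y hy
    simp [f, b, clamp_zero hr.le, hζ0]
  · filter_upwards [eventually_clamp_eq hr] with z hz
    simp only [Homeomorph.homeomorph_mk_coe, Equiv.coe_fn_mk, f, b, hz.2.1, hz.2.2,
      max_eq_left hz.1.le, Prod.mk.injEq, true_and]
    have := hz.1.ne'
    field_simp
    ring

/-- A change of the second unstable coordinate, prescribed near the point `(0, 1, 0)`. -/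
theorem exists_model_shear {ζ : ℝ × ℝ → ℝ} {U : Set (ℝ × ℝ)} (hU : U ∈ 𝓝 ((0, 0) : ℝ × ℝ))
    (hζ : ContinuousOn ζ U) (hinj : ∀ u η η', (u, η) ∈ U → (u, η') ∈ U → ζ (u, η) = ζ (u, η') → η = η')
    (hζ0 : ζ (0, 0) = 0) :
    ∃ S, IsModelSymmetry S ∧ ∀ᶠ z in 𝓝 ((0, 1, 0) : ℝ × ℝ × ℝ),
      S z = (z.1, z.2.1, z.2.1 * ζ (z.1 * z.2.1, z.2.2 / z.2.1)) := by
  obtain ⟨r, hr, hrU⟩ : ∃ r : ℝ, 0 < r ∧ Icc (-r) r ×ˢ Icc (-r) r ⊆ U := by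
    obtain ⟨r, hr, h⟩ := Metric.nhds_basis_closedBall.mem_iff.1 hU
    refine ⟨r, hr, ?_⟩
    rw [← closedBall_prod_same] at h
    simpa [Real.closedBall_eq_Icc] using h
  have hζr := hζ.mono hrU
  have hmem : -r ∈ Icc (-r) r ∧ r ∈ Icc (-r) r ∧ (0 : ℝ) ∈ Icc (-r) r :=
    ⟨⟨le_rfl, by linarith⟩, ⟨by linarith, le_rfl⟩, ⟨by linarith, hr.le⟩⟩
  have hsec (u : ℝ) (hu : u ∈ Icc (-r) r) : ContinuousOn (fun η => ζ (u, η)) (Icc (-r) r) :=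
    hζr.comp (by fun_prop) fun η hη => ⟨hu, hη⟩
  have hsec' (η : ℝ) (hη : η ∈ Icc (-r) r) : ContinuousOn (fun u => ζ (u, η)) (Icc (-r) r) :=
    hζr.comp (by fun_prop) fun u hu => ⟨hu, hη⟩
  have hinj' (u : ℝ) (hu : u ∈ Icc (-r) r) : InjOn (fun η => ζ (u, η)) (Icc (-r) r) :=
    fun η hη η' hη' h => hinj u η η' (hrU ⟨hu, hη⟩) (hrU ⟨hu, hη'⟩) h
  have hma (u : ℝ) (hu : u ∈ Icc (-r) r) := (hsec u hu).strictMonoOn_of_injOn_Icc'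
    (by linarith) (hinj' u hu)
  have hd : ContinuousOn (fun u => ζ (u, r) - ζ (u, -r)) (Icc (-r) r) :=
    (hsec' r hmem.2.1).sub (hsec' (-r) hmem.1)
  have hd0 (u : ℝ) (hu : u ∈ Icc (-r) r) : ζ (u, r) - ζ (u, -r) ≠ 0 := fun h => by
    have := hinj' u hu hmem.2.1 hmem.1 (sub_eq_zero.1 h)
    linarith
  -- Each section is strictly monotone by injectivity; the direction is the same for all `u`,
  -- because the difference of end values never vanishes on an interval of parameters.
  have hsign : (∀ u ∈ Icc (-r) r, 0 < ζ (u, r) - ζ (u, -r)) ∨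
      ∀ u ∈ Icc (-r) r, ζ (u, r) - ζ (u, -r) < 0 := by
    by_contra! hcon
    obtain ⟨⟨u, hu, h1⟩, u', hu', h2⟩ := hcon
    obtain ⟨c, hc, hc0⟩ := isPreconnected_Icc.intermediate_value hu hu' hd ⟨h1, h2⟩
    exact hd0 c hc hc0
  rcases hsign with hpos | hneg
  · refine exists_model_shear_of_strictMonoOn hr hζr (fun u hu => ?_) hζ0
    refine (hma u hu).resolve_right fun h => ?_
    have := h hmem.1 hmem.2.1 (by linarith)
    have := hpos u hu
    simp only at *
    linarith
  · have hneg_mem {η : ℝ} (h : η ∈ Icc (-r) r) : -η ∈ Icc (-r) r :=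
      ⟨by linarith [h.2], by linarith [h.1]⟩
    have hanti (u : ℝ) (hu : u ∈ Icc (-r) r) :
        StrictMonoOn (fun η => ζ (u, -η)) (Icc (-r) r) := by
      intro η hη η' hη' h
      have h1 := (hma u hu).resolve_left fun h => by
        have := h hmem.1 hmem.2.1 (by linarith)
        have := hneg u hu
        simp only at *
        linarith
      exact h1 (hneg_mem hη') (hneg_mem hη) (neg_lt_neg h)
    obtain ⟨S, hS, hSz⟩ := exists_model_shear_of_strictMonoOn hr (ζ := fun z => ζ (z.1, -z.2))
      (hζr.comp (by fun_prop) fun z hz => ⟨hz.1, hneg_mem hz.2⟩) hanti (by simpa using hζ0)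
    -- The decreasing case reduces to the increasing one by the reflection `y' ↦ -y'`, itself a
    -- symmetry of the model.
    let F : ℝ × ℝ × ℝ ≃ₜ ℝ × ℝ × ℝ :=
      (Homeomorph.refl ℝ).prodCongr ((Homeomorph.refl ℝ).prodCongr (Homeomorph.neg ℝ))
    have hF (z) : F z = (z.1, z.2.1, -z.2.2) := rfl
    have hFsym : IsModelSymmetry F := ⟨fun t z => by simp [hF, modelFlow], by simp [hF],
      fun y _ => by simp [hF]⟩
    refine ⟨F.trans S, hFsym.trans hS, ?_⟩
    have hFc : Tendsto F (𝓝 (0, 1, 0)) (𝓝 (0, 1, 0)) := by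
      have := F.continuous.tendsto (0, 1, 0)
      simpa [hF] using this
    filter_upwards [hFc.eventually hSz] with z hz
    rw [Homeomorph.trans_apply, hz]
    simp [hF, neg_div]

end ModelFlow


/-! ### Time reversal and changes of conjugating charts -/

section Reversal

variable {M : Type*} [TopologicalSpace M] [ChartedSpace E3 M]
  {v : (x : M) → TangentSpace 𝓘(ℝ, E3) x}

theorem isMIntegralCurveOn_neg_iff {γ : ℝ → M} {s : Set ℝ} :
    IsMIntegralCurveOn (fun t => γ (-t)) (-v) {t | -t ∈ s} ↔ IsMIntegralCurveOn γ v s := by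
  have h := isMIntegralCurveOn_comp_mul_ne_zero (γ := γ) (v := v) (s := s)
    (a := -1) (by norm_num)
  simpa only [Function.comp_def, mul_neg, mul_one, neg_smul, one_smul] using h

theorem isMIntegralCurve_neg_iff {γ : ℝ → M} :
    IsMIntegralCurve (fun t => γ (-t)) (-v) ↔ IsMIntegralCurve γ v := by
  have h := isMIntegralCurve_comp_mul_ne_zero (γ := γ) (v := v) (a := -1) (by norm_num)
  simpa only [Function.comp_def, mul_neg, mul_one, neg_smul, one_smul] using h

theorem unstableManifold_neg (q : M) : unstableManifold (-v) q = stableManifold v q := by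
  ext x
  constructor
  · rintro ⟨δ, h0, h1, h2⟩
    refine ⟨fun t => δ (-t), by simpa using h0, ?_, h2.comp tendsto_neg_atTop_atBot⟩
    have := isMIntegralCurveOn_neg_iff.2 h1
    rw [neg_neg] at this
    refine this.mono fun t ht => ?_
    simpa using ht
  · rintro ⟨δ, h0, h1, h2⟩
    refine ⟨fun t => δ (-t), by simpa using h0, ?_, h2.comp tendsto_neg_atBot_atTop⟩
    refine (isMIntegralCurveOn_neg_iff.2 h1).mono fun t ht => ?_
    simpa using ht

variable {Y : Type*} [TopologicalSpace Y] {S S' : ℝ → Y → Y} {P Q : OpenPartialHomeomorph M Y}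

theorem Conjugates.neg (h : Conjugates v S P) (hS0 : ∀ y, S 0 y = y)
    (hS : ∀ s t y, S (s + t) y = S s (S t y)) : Conjugates (-v) (fun t => S (-t)) P := by
  intro a b γ hab hγ
  have h1 := h (-b) (-a) (fun t => γ (-t)) (neg_le_neg hab) fun t ht =>
    hγ (-t) ⟨by linarith [ht.2], by linarith [ht.1]⟩
  have h2 := isMIntegralCurveOn_neg_iff (v := -v) (γ := γ) (s := Icc a b)
  rw [neg_neg] at h2
  have h3 : {t | -t ∈ Icc a b} = Icc (-b) (-a) := by
    ext t
    simp only [mem_ofPred_eq, mem_Icc]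
    constructor <;> rintro ⟨h, h'⟩ <;> constructor <;> linarith
  rw [← h2, h3, h1]
  simp only [neg_neg]
  have hinv (s : ℝ) (y : Y) : S (-s) (S s y) = y := by rw [← hS, neg_add_cancel, hS0]
  constructor
  · intro h t ht
    have e1 := h (-t) ⟨by linarith [ht.2], by linarith [ht.1]⟩
    have e2 := h (-a) ⟨by linarith, le_rfl⟩
    simp only [neg_neg] at e1 e2
    rw [e1, e2, ← hS]
    congr 1
    ring
  · intro h t ht
    have e1 := h (-t) ⟨by linarith [ht.2], by linarith [ht.1]⟩
    have e2 := h b ⟨hab, le_rfl⟩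
    rw [e1, e2, ← hS]
    congr 1
    ring

/-- Two charts conjugating the same vector field to flows transform one local flow into the other. -/
theorem Conjugates.eventually_flow (hP : Conjugates v S P) (hQ : Conjugates v S' Q)
    (hS0 : ∀ y, S 0 y = y) (hS : ∀ s t y, S (s + t) y = S s (S t y))
    (hSc : Continuous fun z : ℝ × Y => S z.1 z.2) (hS' : ∀ s t y, S' (s + t) y = S' s (S' t y))
    {x₀ : M} (hx : x₀ ∈ P.source) (hx' : x₀ ∈ Q.source) :
    ∀ᶠ z : M × ℝ in 𝓝 (x₀, 0), S z.2 (P z.1) ∈ P.target ∧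
      P.symm (S z.2 (P z.1)) ∈ Q.source ∧
      Q (P.symm (S z.2 (P z.1))) = S' z.2 (Q z.1) := by
  have hf : ContinuousAt (fun z : M × ℝ => S z.2 (P z.1)) (x₀, 0) :=
    hSc.continuousAt.comp (continuousAt_snd.prodMk
      ((P.continuousAt hx).comp continuousAt_fst))
  have hf0 : S 0 (P x₀) = P x₀ := hS0 _
  have h1 : ∀ᶠ z : M × ℝ in 𝓝 (x₀, 0), S z.2 (P z.1) ∈ P.target :=
    hf.eventually_mem (by simpa only [hf0] using P.open_target.mem_nhds (P.map_source hx))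
  have hg : ContinuousAt (fun z : M × ℝ => P.symm (S z.2 (P z.1))) (x₀, 0) :=
    ContinuousAt.comp (by
      simp only [hf0]
      exact P.continuousAt_symm (P.map_source hx)) hf
  have h2 : ∀ᶠ z : M × ℝ in 𝓝 (x₀, 0), P.symm (S z.2 (P z.1)) ∈ Q.source :=
    hg.eventually_mem (by
      simp only [hf0, P.left_inv hx]
      exact Q.open_source.mem_nhds hx')
  have h3 : ∀ᶠ z : M × ℝ in 𝓝 (x₀, 0), z.1 ∈ P.source :=
    continuousAt_fst.eventually_mem (P.open_source.mem_nhds hx)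
  have h := h1.and (h2.and h3)
  rw [nhds_prod_eq] at h ⊢
  obtain ⟨pa, ha, pb, hb, h⟩ := eventually_prod_iff.1 h
  obtain ⟨ε, hε, hb⟩ := Metric.eventually_nhds_iff.1 hb
  have hb' : ∀ᶠ t : ℝ in 𝓝 0, dist t 0 < ε := Metric.ball_mem_nhds 0 hε
  filter_upwards [ha.prod_mk hb'] with ⟨m, t⟩ ⟨hm, ht⟩
  simp only [Real.dist_eq, sub_zero] at ht hb
  refine ⟨(h hm (hb ht)).1, (h hm (hb ht)).2.1, ?_⟩
  have hs : ∀ s ∈ Icc (min 0 t) (max 0 t), |s| < ε := fun s hs => by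
    refine lt_of_le_of_lt (abs_le.2 ⟨?_, ?_⟩) ht
    · refine le_trans ?_ hs.1
      exact le_min (neg_nonpos.2 (abs_nonneg t)) (neg_abs_le t)
    · exact hs.2.trans (max_le (abs_nonneg t) (le_abs_self t))
  have hab : min 0 t ≤ max 0 t := min_le_max
  let c : ℝ → M := fun s => P.symm (S s (P m))
  have hc : ∀ s ∈ Icc (min 0 t) (max 0 t), P (c s) = S s (P m) := fun s h' =>
    P.right_inv (h hm (hb (hs s h'))).1
  have hint : IsMIntegralCurveOn c v (Icc (min 0 t) (max 0 t)) :=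
    (hP _ _ c hab fun s h' => P.map_target (h hm (hb (hs s h'))).1).2 fun s h' => by
      rw [hc s h', hc _ ⟨le_rfl, hab⟩, ← hS, sub_add_cancel]
  have hQc := (hQ _ _ c hab fun s h' => (h hm (hb (hs s h'))).2.1).1 hint
  have e1 := hQc t ⟨min_le_right _ _, le_max_right _ _⟩
  have e0 := hQc 0 ⟨min_le_left _ _, le_max_left _ _⟩
  have c0 : c 0 = m := by
    change P.symm (S 0 (P m)) = m
    rw [hS0, P.left_inv (h hm (hb ht)).2.2]
  change Q (c t) = _
  rw [← c0, e1, e0, ← hS']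
  congr 1
  ring

end Reversal

/-! ### Adapted charts and the matching of their transition map -/

section Adapted

variable {M : Type*} [TopologicalSpace M] [ChartedSpace E3 M]

/-- A topological chart near the negative half `γ (-∞, 0]` of an orbit and its limit `p`, which
conjugates `v` to the model flow and sends the half-orbit onto `{0} × (0, 1] × {0}`. -/
structure IsAdapted (v : (x : M) → TangentSpace 𝓘(ℝ, E3) x) (p : M) (γ : ℝ → M)
    (P : OpenPartialHomeomorph M (ℝ × ℝ × ℝ)) : Prop where
  conj : Conjugates v modelFlow P
  mem : p ∈ P.source
  apply_eq : P p = 0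
  mem_curve : ∀ t ≤ 0, γ t ∈ P.source
  curve : ∀ t ≤ 0, P (γ t) = (0, Real.exp t, 0)

variable {v : (x : M) → TangentSpace 𝓘(ℝ, E3) x} {p q : M} {γ : ℝ → M}
  {P Q : OpenPartialHomeomorph M (ℝ × ℝ × ℝ)}

namespace IsAdapted

/-- The freedom in the choice of an adapted chart: model symmetries preserve both the conjugacy and
the normalisation along the half orbit. -/
theorem transHomeomorph (hP : IsAdapted v p γ P) {S : ℝ × ℝ × ℝ ≃ₜ ℝ × ℝ × ℝ}
    (hS : IsModelSymmetry S) : IsAdapted v p γ (P.transHomeomorph S) where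
  conj a b c hab hc := by
    rw [hP.conj a b c hab hc]
    simp only [OpenPartialHomeomorph.transHomeomorph_apply, Function.comp_apply, ← hS.comm,
      S.injective.eq_iff]
  mem := hP.mem
  apply_eq := by simp [hP.apply_eq, hS.zero]
  mem_curve := hP.mem_curve
  curve t ht := by simp [hP.curve t ht, hS.axis _ (Real.exp_pos t)]

theorem curve_zero (hP : IsAdapted v p γ P) : P (γ 0) = (0, 1, 0) := by
  simpa using hP.curve 0 le_rfl

theorem tendsto (hP : IsAdapted v p γ P) : Tendsto P (𝓝 (γ 0)) (𝓝 (0, 1, 0)) := by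
  have := P.continuousAt (hP.mem_curve 0 le_rfl)
  rwa [ContinuousAt, hP.curve_zero] at this

theorem tendsto_snd (hP : IsAdapted v p γ P) : Tendsto (fun m => (P m).2.1) (𝓝 (γ 0)) (𝓝 1) :=
  ((continuous_fst.comp continuous_snd).tendsto _).comp hP.tendsto

theorem tendsto_section (hP : IsAdapted v p γ P) :
    Tendsto (fun z : ℝ × ℝ => P.symm (z.1, 1, z.2)) (𝓝 (0, 0)) (𝓝 (γ 0)) := by
  have h1 : Tendsto P.symm (𝓝 (0, 1, 0)) (𝓝 (γ 0)) := by
    rw [← hP.curve_zero]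
    exact P.tendsto_symm (hP.mem_curve 0 le_rfl)
  have h2 : Continuous fun z : ℝ × ℝ => (z.1, (1 : ℝ), z.2) := by fun_prop
  exact h1.comp (h2.tendsto (0, 0))

theorem eventually_section_mem (hP : IsAdapted v p γ P) :
    ∀ᶠ z : ℝ × ℝ in 𝓝 (0, 0), (z.1, (1 : ℝ), z.2) ∈ P.target := by
  have h2 : Continuous fun z : ℝ × ℝ => (z.1, (1 : ℝ), z.2) := by fun_prop
  refine (h2.tendsto (0, 0)).eventually_mem (P.open_target.mem_nhds ?_)
  rw [← hP.curve_zero]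
  exact P.map_source (hP.mem_curve 0 le_rfl)

theorem section_zero (hP : IsAdapted v p γ P) : P.symm (0, 1, 0) = γ 0 := by
  rw [← hP.curve_zero, P.left_inv (hP.mem_curve 0 le_rfl)]

theorem continuousOn_section (hP : IsAdapted v p γ P) {f : M → ℝ} {W : Set M}
    (hf : ContinuousOn f W) (hW : W ∈ 𝓝 (γ 0)) :
    ∃ U ∈ 𝓝 ((0, 0) : ℝ × ℝ), ContinuousOn (fun z : ℝ × ℝ => f (P.symm (z.1, 1, z.2))) U ∧
      ∀ z ∈ U, (z.1, (1 : ℝ), z.2) ∈ P.target ∧ P.symm (z.1, 1, z.2) ∈ W := by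
  refine ⟨{z | (z.1, (1 : ℝ), z.2) ∈ P.target ∧ P.symm (z.1, 1, z.2) ∈ W},
    hP.eventually_section_mem.and (hP.tendsto_section.eventually_mem hW), ?_, fun z hz => hz⟩
  refine hf.comp (P.continuousOn_symm.comp ?_ fun z hz => hz.1) fun z hz => hz.2
  fun_prop

/-- A function which is invariant under the local flow is a function of the invariants of the model
flow. -/
theorem eventually_eq_section (hP : IsAdapted v p γ P) {f : M → ℝ}
    (hf : ∀ᶠ z : M × ℝ in 𝓝 (γ 0, 0), f (P.symm (modelFlow z.2 (P z.1))) = f z.1) :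
    ∀ᶠ m in 𝓝 (γ 0),
      f m = f (P.symm ((P m).1 * (P m).2.1, 1, (P m).2.2 / (P m).2.1)) := by
  -- Flowing for time `-log y` carries a point to the section `y = 1`, where its coordinates are its
  -- two invariants.
  have h1 : Tendsto (fun m => (m, -Real.log (P m).2.1)) (𝓝 (γ 0)) (𝓝 (γ 0, 0)) := by
    have h2 := ((Real.continuousAt_log one_ne_zero).tendsto.comp hP.tendsto_snd).neg
    rw [Real.log_one, neg_zero] at h2
    exact Tendsto.prodMk_nhds tendsto_id h2
  filter_upwards [h1.eventually hf, hP.tendsto_snd.eventually (lt_mem_nhds one_pos)] with m hm hpos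
  rw [← hm]
  simp only [modelFlow, neg_neg, Real.exp_neg, Real.exp_log hpos, inv_mul_cancel₀ hpos.ne']
  rw [mul_comm, div_eq_inv_mul]

/-- `Q` is adapted to `-v`, so the forward flow of `v` is the model flow run backwards in `Q`. -/
theorem eventually_flow (hP : IsAdapted v p γ P) (hQ : IsAdapted (-v) q (fun t => γ (-t)) Q) :
    ∀ᶠ z : M × ℝ in 𝓝 (γ 0, 0), P (P.symm (modelFlow z.2 (P z.1))) = modelFlow z.2 (P z.1) ∧
      Q (P.symm (modelFlow z.2 (P z.1))) = modelFlow (-z.2) (Q z.1) := by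
  have h := hQ.conj.neg modelFlow_zero modelFlow_add
  rw [neg_neg] at h
  have h0 : γ 0 ∈ Q.source := by simpa using hQ.mem_curve 0 le_rfl
  filter_upwards [hP.conj.eventually_flow h modelFlow_zero modelFlow_add continuous_modelFlow
    (fun s t y => by rw [← modelFlow_add, neg_add]) (hP.mem_curve 0 le_rfl) h0] with z hz
  exact ⟨P.right_inv hz.1, hz.2.2⟩

/-- The invariant `u_Q` is constant along the flow, so near `γ 0` it is a function `ζ (u, η)` of the
invariants of `P`. On the section `y = 1`, `hinj` says that `ζ` is injective in `η` for fixed `u`,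
as `exists_model_shear` requires. -/
theorem exists_shear (hP : IsAdapted v p γ P) (hQ : IsAdapted (-v) q (fun t => γ (-t)) Q)
    (hinj : ∃ U ∈ 𝓝 (γ 0), ∀ m ∈ U, ∀ m' ∈ U, (P m).1 = (P m').1 → (P m).2.1 = (P m').2.1 →
      (Q m).1 * (Q m).2.1 = (Q m').1 * (Q m').2.1 → m = m') :
    ∃ P', IsAdapted v p γ P' ∧ ∀ᶠ m in 𝓝 (γ 0),
      P' m = ((P m).1, (P m).2.1, (P m).2.1 * ((Q m).1 * (Q m).2.1)) := by
  obtain ⟨U, hU, hinj⟩ := hinj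
  have h0 : γ 0 ∈ Q.source := by simpa using hQ.mem_curve 0 le_rfl
  let f : M → ℝ := fun m => (Q m).1 * (Q m).2.1
  have hf : ContinuousOn f (U ∩ Q.source) :=
    (((continuous_fst.comp_continuousOn Q.continuousOn)).mul
      ((continuous_fst.comp continuous_snd).comp_continuousOn Q.continuousOn)).mono
      inter_subset_right
  obtain ⟨U', hU', hc, hU'm⟩ := hP.continuousOn_section hf
    (inter_mem hU (Q.open_source.mem_nhds h0))
  obtain ⟨S, hS, hSz⟩ := exists_model_shear hU' hc (fun u η η' h h' he => by
    have e := hinj _ (hU'm _ h).2.1 _ (hU'm _ h').2.1 (by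
      rw [P.right_inv (hU'm _ h).1, P.right_inv (hU'm _ h').1]) (by
      rw [P.right_inv (hU'm _ h).1, P.right_inv (hU'm _ h').1]) he
    have e' := congrArg P e
    rw [P.right_inv (hU'm _ h).1, P.right_inv (hU'm _ h').1] at e'
    simpa using e') (by
    have := hQ.curve 0 le_rfl
    rw [neg_zero] at this
    simp [f, hP.section_zero, this])
  refine ⟨P.transHomeomorph S, hP.transHomeomorph hS, ?_⟩
  have hinv : ∀ᶠ z : M × ℝ in 𝓝 (γ 0, 0), f (P.symm (modelFlow z.2 (P z.1))) = f z.1 := by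
    filter_upwards [hP.eventually_flow hQ] with z hz
    simp only [f, hz.2]
    simp only [modelFlow, neg_neg]
    rw [mul_mul_mul_comm, ← Real.exp_add, add_neg_cancel, Real.exp_zero, one_mul]
  filter_upwards [hP.tendsto.eventually hSz, hP.eventually_eq_section hinv] with m h1 h2
  rw [OpenPartialHomeomorph.transHomeomorph_apply, Function.comp_apply, h1]
  simp only [← h2, f]

theorem exists_shift (hP : IsAdapted v p γ P) {e : ℝ × ℝ → ℝ}
    {U : Set (ℝ × ℝ)} (hU : U ∈ 𝓝 ((0, 0) : ℝ × ℝ))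
    (he : ContinuousOn e U) (he0 : ∀ η, (0, η) ∈ U → e (0, η) = 0) :
    ∃ P', IsAdapted v p γ P' ∧ ∀ᶠ m in 𝓝 (γ 0),
      P' m = modelFlow (e ((P m).1 * (P m).2.1, (P m).2.2 / (P m).2.1)) (P m) := by
  obtain ⟨r, hr, hrU⟩ : ∃ r : ℝ, 0 < r ∧ Icc (-r) r ×ˢ Icc (-r) r ⊆ U := by
    obtain ⟨r, hr, h⟩ := Metric.nhds_basis_closedBall.mem_iff.1 hU
    refine ⟨r, hr, ?_⟩
    rw [← closedBall_prod_same] at h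
    simpa [Real.closedBall_eq_Icc] using h
  obtain ⟨S, hS, hSz⟩ := exists_model_shift hr (he.mono hrU) fun η hη =>
    he0 η (hrU ⟨⟨by linarith, hr.le⟩, hη⟩)
  refine ⟨P.transHomeomorph S, hP.transHomeomorph hS, ?_⟩
  filter_upwards [hP.tendsto.eventually hSz] with m h1
  rw [OpenPartialHomeomorph.transHomeomorph_apply, Function.comp_apply, h1]

/-- The adapted charts at both ends of a transverse connection can be chosen such that their
transition map is standard. -/
theorem exists_matched (hP : IsAdapted v p γ P) (hQ : IsAdapted (-v) q (fun t => γ (-t)) Q)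
    (hinj : ∃ U ∈ 𝓝 (γ 0), ∀ m ∈ U, ∀ m' ∈ U, (P m).1 = (P m').1 → (P m).2.1 = (P m').2.1 →
      (Q m).1 * (Q m).2.1 = (Q m').1 * (Q m').2.1 → m = m')
    (hinj' : ∃ U ∈ 𝓝 (γ 0), ∀ m ∈ U, ∀ m' ∈ U, (Q m).1 = (Q m').1 → (Q m).2.1 = (Q m').2.1 →
      (P m).1 * (P m).2.1 = (P m').1 * (P m').2.1 → m = m') :
    ∃ P' Q', IsAdapted v p γ P' ∧ IsAdapted (-v) q (fun t => γ (-t)) Q' ∧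
      ∀ᶠ m in 𝓝 (γ 0), Q' m = ((P' m).2.2, ((P' m).2.1)⁻¹, (P' m).1) := by
  have hnn : IsAdapted (-(-v)) p (fun t => γ (- -t)) P := by simpa only [neg_neg] using hP
  -- After these two shears the invariants of `P₁` are `(u_P, u_Q)` and those of `Q₁` are `(u_Q,
  -- u_P)`.
  obtain ⟨P₁, hP₁, hP₁m⟩ := hP.exists_shear hQ hinj
  obtain ⟨Q₁, hQ₁, hQ₁m⟩ := hQ.exists_shear hnn (by simpa only [neg_zero] using hinj')
  rw [neg_zero] at hQ₁m
  have hQt : Tendsto (fun m => (Q m).2.1) (𝓝 (γ 0)) (𝓝 1) := by simpa using hQ.tendsto_snd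
  have h0 : γ 0 ∈ Q₁.source := by simpa using hQ₁.mem_curve 0 le_rfl
  have hQ₁0 : Q₁ (γ 0) = (0, 1, 0) := by simpa using hQ₁.curve_zero
  have hQ₁t : Tendsto (fun m => (Q₁ m).2.1) (𝓝 (γ 0)) (𝓝 1) := by simpa using hQ₁.tendsto_snd
  -- The remaining discrepancy is one of time: the product of the second coordinates should be `1`.
  -- It is invariant under the flow, so `f` is a function `D` of the invariants.
  let f : M → ℝ := fun m => -Real.log ((P₁ m).2.1 * (Q₁ m).2.1)
  have hpos : ∀ᶠ m in 𝓝 (γ 0), 0 < (P₁ m).2.1 ∧ 0 < (Q₁ m).2.1 :=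
    (hP₁.tendsto_snd.eventually (lt_mem_nhds one_pos)).and
      (hQ₁t.eventually (lt_mem_nhds one_pos))
  obtain ⟨W, hW, hWp⟩ := hpos.exists_mem
  have hf : ContinuousOn f (W ∩ (P₁.source ∩ Q₁.source)) := by
    refine ContinuousOn.neg (ContinuousOn.log (ContinuousOn.mul ?_ ?_) fun m hm =>
      (mul_pos (hWp m hm.1).1 (hWp m hm.1).2).ne')
    · exact ((continuous_fst.comp continuous_snd).comp_continuousOn P₁.continuousOn).mono
        fun m hm => hm.2.1
    · exact ((continuous_fst.comp continuous_snd).comp_continuousOn Q₁.continuousOn).mono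
        fun m hm => hm.2.2
  obtain ⟨U, hU, hD, -⟩ := hP₁.continuousOn_section hf (inter_mem hW
    (inter_mem (P₁.open_source.mem_nhds (hP₁.mem_curve 0 le_rfl)) (Q₁.open_source.mem_nhds h0)))
  set D : ℝ × ℝ → ℝ := fun z => f (P₁.symm (z.1, 1, z.2)) with hDdef
  have hD0 : D (0, 0) = 0 := by
    simp [D, f, hP₁.section_zero, hP₁.curve_zero, hQ₁0]
  have hinv : ∀ᶠ z : M × ℝ in 𝓝 (γ 0, 0), f (P₁.symm (modelFlow z.2 (P₁ z.1))) = f z.1 := by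
    filter_upwards [hP₁.eventually_flow hQ₁] with z hz
    simp only [f, hz.1, hz.2]
    simp only [modelFlow]
    rw [mul_mul_mul_comm, ← Real.exp_add, add_neg_cancel, Real.exp_zero, one_mul]
  have hfD := hP₁.eventually_eq_section hinv
  obtain ⟨r, hr, hrU⟩ : ∃ r : ℝ, 0 < r ∧ Metric.ball 0 r ×ˢ Metric.ball 0 r ⊆ U := by
    obtain ⟨r, hr, h⟩ := Metric.mem_nhds_iff.1 hU
    exact ⟨r, hr, by rwa [← ball_prod_same] at h⟩
  have hb : Metric.ball (0 : ℝ) r ×ˢ Metric.ball 0 r ∈ 𝓝 ((0, 0) : ℝ × ℝ) :=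
    prod_mem_nhds (Metric.ball_mem_nhds _ hr) (Metric.ball_mem_nhds _ hr)
  have h0r : (0 : ℝ) ∈ Metric.ball (0 : ℝ) r := Metric.mem_ball_self hr
  have hDr := hD.mono hrU
  have hD1 : ContinuousOn (fun z : ℝ × ℝ => D (0, z.2)) (Metric.ball (0 : ℝ) r ×ˢ Metric.ball 0 r) :=
    hDr.comp (by fun_prop) fun z hz => ⟨h0r, hz.2⟩
  have hD2 : ContinuousOn (fun z : ℝ × ℝ => D (0, z.1)) (Metric.ball (0 : ℝ) r ×ˢ Metric.ball 0 r) :=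
    hDr.comp (by fun_prop) fun z hz => ⟨h0r, hz.1⟩
  -- A shift must vanish where the first invariant does. So `P₁` takes `D (u, η) - D (0, η)`, and
  -- `Q₁`, whose first invariant is `u_Q`, takes `D (0, u_Q)`, which vanishes at `u_Q = 0` because
  -- `D (0, 0) = 0`.
  obtain ⟨P₂, hP₂, hP₂m⟩ := hP₁.exists_shift hb (hDr.sub hD1) fun η _ => by simp
  obtain ⟨Q₂, hQ₂, hQ₂m⟩ := hQ₁.exists_shift hb hD2 fun η _ => by simp [hD0]
  rw [neg_zero] at hQ₂m
  refine ⟨P₂, Q₂, hP₂, hQ₂, ?_⟩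
  filter_upwards [hP₁m, hQ₁m, hP₂m, hQ₂m, hfD, hpos] with m h1 h2 h3 h4 h5 h6
  set x := (P m).1
  set y := (P m).2.1
  set z := (Q m).1
  set k := (Q m).2.1
  rw [h1, h2] at h6
  obtain ⟨hy, hk⟩ := h6
  simp only at hy hk
  have e1 : y * (z * k) / y = z * k := by field_simp
  have e2 : k * (x * y) / k = x * y := by field_simp
  have hfm : D (x * y, z * k) = -Real.log (y * k) := by
    have h5' := h5
    rw [h1] at h5'
    simp only [e1] at h5'
    rw [hDdef]
    simp only
    rw [← h5']
    simp only [f, h1, h2]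
  rw [h3, h4, h1, h2]
  simp only [modelFlow, Pi.sub_apply, e1, hfm]
  set d := D (0, z * k)
  have E1 : Real.exp (-Real.log (y * k) - d) = (y * k)⁻¹ * Real.exp (-d) := by
    rw [sub_eq_add_neg, Real.exp_add, Real.exp_neg, Real.exp_log (mul_pos hy hk)]
  have E2 : Real.exp (-(-Real.log (y * k) - d)) = (y * k) * Real.exp d := by
    rw [neg_sub, sub_neg_eq_add, Real.exp_add, Real.exp_log (mul_pos hy hk), mul_comm]
  rw [E1, E2]
  have E3 : Real.exp (-d) * Real.exp d = 1 := by rw [← Real.exp_add]; simp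
  refine Prod.ext ?_ (Prod.ext ?_ ?_) <;> simp only
  · field_simp
  · rw [mul_inv, mul_inv, inv_inv, ← Real.exp_neg, neg_neg]
    field_simp
  · ring

end IsAdapted

end Adapted


/-! ### Regularity of adapted charts and transversality -/

section Regular

variable {M : Type*} [TopologicalSpace M] [ChartedSpace E3 M]
  {v : (x : M) → TangentSpace 𝓘(ℝ, E3) x} {p q : M} {γ : ℝ → M}
  {P Q : OpenPartialHomeomorph M (ℝ × ℝ × ℝ)}

/-- In an adapted chart, the unstable manifold contains the points of the plane `x = 0`. -/
theorem IsAdapted.eventually_mem_unstableManifold (hP : IsAdapted v p γ P) :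
    ∀ᶠ Y : ℝ × ℝ in 𝓝 (1, 0),
      P.symm ((0 : ℝ), Y) ∈ unstableManifold v p := by
  have h1 : ∀ᶠ Y : ℝ × ℝ in 𝓝 (1, 0), ∀ r ∈ Icc (0 : ℝ) 1, ((0 : ℝ), r • Y) ∈ P.target := by
    -- The segment from the origin to `(0, 1, 0)` is the image of `p` and the half orbit; by
    -- compactness the segments to nearby points of the plane `x = 0`, which the model flow
    -- preserves, also lie in the target.
    refine isCompact_Icc.eventually_forall_of_forall_eventually fun r hr => ?_
    have hc : Continuous fun z : (ℝ × ℝ) × ℝ => ((0 : ℝ), z.2 • z.1) := by fun_prop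
    refine (hc.tendsto _).eventually_mem (P.open_target.mem_nhds ?_)
    rcases hr.1.eq_or_lt with h0 | h0
    · have : ((0 : ℝ), r • ((1 : ℝ), (0 : ℝ))) = P p := by simp [hP.apply_eq, ← h0]
      rw [this]
      exact P.map_source hP.mem
    · have hl : Real.log r ≤ 0 := Real.log_nonpos hr.1 hr.2
      have : ((0 : ℝ), r • ((1 : ℝ), (0 : ℝ))) = P (γ (Real.log r)) := by
        simp [hP.curve _ hl, Real.exp_log h0]
      rw [this]
      exact P.map_source (hP.mem_curve _ hl)
  filter_upwards [h1] with Y hY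
  have hexp {t : ℝ} (ht : t ≤ 0) : Real.exp t ∈ Icc (0 : ℝ) 1 :=
    ⟨(Real.exp_pos t).le, Real.exp_le_one_iff.2 ht⟩
  have hflow (t : ℝ) : modelFlow t ((0 : ℝ), Y) = ((0 : ℝ), Real.exp t • Y) := by
    simp only [modelFlow, mul_zero]
    rfl
  refine ⟨fun t => P.symm ((0 : ℝ), Real.exp t • Y), by simp, ?_, ?_⟩
  · intro t ht
    have ht : t ≤ 0 := ht
    have h2 := (hP.conj (t - 1) 0 (fun t => P.symm ((0 : ℝ), Real.exp t • Y)) (by linarith)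
      fun s hs => P.map_target (hY _ (hexp hs.2))).2 fun s hs => by
        rw [P.right_inv (hY _ (hexp hs.2)), P.right_inv (hY _ (hexp (by linarith))), ← hflow,
          ← hflow, ← modelFlow_add, sub_add_cancel]
    refine (h2 t ⟨by linarith, ht⟩).mono_of_mem_nhdsWithin ?_
    filter_upwards [self_mem_nhdsWithin, mem_nhdsWithin_of_mem_nhds (Ioi_mem_nhds
      (show t - 1 < t by linarith))] with s hs hs'
    exact ⟨le_of_lt hs', hs⟩
  · have h2 : Tendsto (fun t => ((0 : ℝ), Real.exp t • Y)) atBot (𝓝 (P p)) := by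
      rw [hP.apply_eq]
      have := (tendsto_const_nhds (x := (0 : ℝ))).prodMk_nhds
        (Real.tendsto_exp_atBot.smul_const Y)
      rw [zero_smul] at this
      exact this
    exact (P.tendsto_symm hP.mem).comp h2

/-- The regularity at `x₀` of a chart `P` adapted to a saddle: a power of the first coordinate and the
second one are strictly differentiable, and the first one vanishes on the unstable manifold. -/
structure IsRegularAt (v : (x : M) → TangentSpace 𝓘(ℝ, E3) x) (p x₀ : M)
    (P : OpenPartialHomeomorph M (ℝ × ℝ × ℝ)) (a : ℝ) (Dx Dy : E3 →L[ℝ] ℝ) : Prop where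
  pos : 0 < a
  apply_eq : P x₀ = (0, 1, 0)
  strict_fst : HasStrictFDerivAt (fun y => signedPow a (P ((extChartAt 𝓘(ℝ, E3) x₀).symm y)).1) Dx
    (extChartAt 𝓘(ℝ, E3) x₀ x₀)
  strict_snd : HasStrictFDerivAt (fun y => (P ((extChartAt 𝓘(ℝ, E3) x₀).symm y)).2.1) Dy
    (extChartAt 𝓘(ℝ, E3) x₀ x₀)
  ne_zero : Dx ≠ 0
  fst_apply : ∀ u : E3, u = v x₀ → Dx u = 0
  snd_apply : ∀ u : E3, u = v x₀ → Dy u = 1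
  tangent : ∃ V : Submodule ℝ (TangentSpace 𝓘(ℝ, E3) x₀),
    IsTangentSpaceAt 2 (unstableManifold v p) x₀ V ∧ ∀ u ∈ V, ∀ u' : E3, u' = u → Dx u' = 0

/-- Three independent functionals. -/
theorem exists_equiv_of_triangular {Dx Dy Dz : E3 →L[ℝ] ℝ} {n m u : E3} (hn : Dx n ≠ 0)
    (hn' : Dz n = 0) (hm : Dz m ≠ 0) (hm' : Dx m = 0) (hu : Dx u = 0) (hu' : Dz u = 0)
    (hu'' : Dy u ≠ 0) :
    ∃ e : E3 ≃L[ℝ] ℝ × ℝ × ℝ, (e : E3 →L[ℝ] ℝ × ℝ × ℝ) = Dx.prod (Dy.prod Dz) := by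
  let T : E3 →ₗ[ℝ] ℝ × ℝ × ℝ := (Dx.prod (Dy.prod Dz) : E3 →L[ℝ] ℝ × ℝ × ℝ)
  have hs : Function.Surjective T := by
    rintro ⟨α, β, κ⟩
    refine ⟨(α / Dx n) • n + (κ / Dz m) • m +
      ((β - α / Dx n * Dy n - κ / Dz m * Dy m) / Dy u) • u, ?_⟩
    change (Dx _, Dy _, Dz _) = _
    simp only [map_add, map_smul,
      smul_eq_mul, hn', hm', hu, hu', mul_zero, add_zero, zero_add, Prod.mk.injEq]
    refine ⟨by field_simp, by field_simp; ring, by field_simp⟩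
  have hi : Function.Injective T := (LinearMap.injective_iff_surjective_of_finrank_eq_finrank
    (by simp)).2 hs
  exact ⟨(LinearEquiv.ofBijective T ⟨hi, hs⟩).toContinuousLinearEquiv, by ext <;> rfl⟩

theorem exists_add_of_sup_eq_top {E : Type*} [AddCommGroup E] [Module ℝ E] {V W : Submodule ℝ E}
    (h : V ⊔ W = ⊤) (u : E) : ∃ y ∈ V, ∃ z ∈ W, y + z = u :=
  Submodule.mem_sup.1 (h ▸ Submodule.mem_top)

/-- The inverse function theorem at `x₀` for the signed power `a` of `x`, the coordinate `y`, and
the signed power `b` of `u_Q`; the powers undo the non-smooth normalisation of rates. `Dx` vanishes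
on `V`, `Dz` on `W`, and `V ⊔ W = ⊤`, so these nonzero functionals are independent; both kill the
velocity, on which `Dy` is `1`. -/
theorem IsRegularAt.exists_injOn {x₀ : M} {a b : ℝ} {Dx Dy Dz Dk : E3 →L[ℝ] ℝ}
    (hP : IsRegularAt v p x₀ P a Dx Dy) (hQ : IsRegularAt (-v) q x₀ Q b Dz Dk)
    (hQs : x₀ ∈ Q.source)
    (htr : ∀ V W : Submodule ℝ (TangentSpace 𝓘(ℝ, E3) x₀),
      IsTangentSpaceAt 2 (unstableManifold v p) x₀ V →
      IsTangentSpaceAt 2 (unstableManifold (-v) q) x₀ W → V ⊔ W = ⊤) :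
    ∃ U ∈ 𝓝 x₀, ∀ m ∈ U, ∀ m' ∈ U, (P m).1 = (P m').1 → (P m).2.1 = (P m').2.1 →
      (Q m).1 * (Q m).2.1 = (Q m').1 * (Q m').2.1 → m = m' := by
  obtain ⟨V, hV, hVx⟩ := hP.tangent
  obtain ⟨W, hW, hWz⟩ := hQ.tangent
  have hVW := htr V W hV hW
  have hsum (u : E3) : ∃ y z : E3, u = y + z ∧ Dx y = 0 ∧ Dz z = 0 := by
    obtain ⟨y, hy, z, hz, h⟩ := exists_add_of_sup_eq_top hVW u
    exact ⟨y, z, h.symm, hVx y hy y rfl, hWz z hz z rfl⟩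
  obtain ⟨n, hn, hn'⟩ : ∃ n, Dx n ≠ 0 ∧ Dz n = 0 := by
    obtain ⟨u, hu⟩ := DFunLike.ne_iff.1 hP.ne_zero
    obtain ⟨y, z, h, hy, hz⟩ := hsum u
    rw [h, map_add, hy, zero_add] at hu
    exact ⟨z, hu, hz⟩
  obtain ⟨m, hm, hm'⟩ : ∃ m, Dz m ≠ 0 ∧ Dx m = 0 := by
    obtain ⟨u, hu⟩ := DFunLike.ne_iff.1 hQ.ne_zero
    obtain ⟨y, z, h, hy, hz⟩ := hsum u
    rw [h, map_add, hz, add_zero] at hu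
    exact ⟨y, hu, hy⟩
  let u : E3 := v x₀
  have hu' : Dz u = 0 := by
    have := hQ.fst_apply (-u) rfl
    simpa using this
  obtain ⟨e, he⟩ := exists_equiv_of_triangular (Dy := Dy) hn hn' hm hm' (hP.fst_apply u rfl) hu'
    (by rw [hP.snd_apply u rfl]; exact one_ne_zero)
  set χ := extChartAt 𝓘(ℝ, E3) x₀ with hχ
  have hχx : χ.symm (χ x₀) = x₀ := extChartAt_to_inv x₀
  -- The first coordinate of `Q` vanishes at `x₀` and the second is `1`, so the second factor does
  -- not contribute to the derivative.
  have h3 : HasStrictFDerivAt (fun y => signedPow b (Q (χ.symm y)).1 * (Q (χ.symm y)).2.1 ^ b) Dz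
      (χ x₀) := by
    have h := hQ.strict_fst.mul (hQ.strict_snd.rpow_const (p := b) (Or.inl (by
      rw [← hχ, hχx, hQ.apply_eq]; exact one_ne_zero)))
    refine h.congr_fderiv ?_
    rw [← hχ, hχx, hQ.apply_eq]
    simp [signedPow_zero hQ.pos]
  have hF := (hP.strict_fst.prodMk (hP.strict_snd.prodMk h3))
  rw [← he] at hF
  let f := hF.toOpenPartialHomeomorph
  have hfs : f.source ∈ 𝓝 (χ x₀) := f.open_source.mem_nhds hF.mem_toOpenPartialHomeomorph_source
  have hpos : ∀ᶠ m in 𝓝 x₀, 0 < (Q m).2.1 := by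
    have h4 := Q.continuousAt hQs
    rw [ContinuousAt, hQ.apply_eq] at h4
    exact (((continuous_fst.comp continuous_snd).tendsto ((0 : ℝ), (1 : ℝ), (0 : ℝ))).comp
      h4).eventually (lt_mem_nhds one_pos)
  have hall : ∀ᶠ m in 𝓝 x₀, m ∈ χ.source ∧ χ m ∈ f.source ∧ 0 < (Q m).2.1 := by
    filter_upwards [extChartAt_source_mem_nhds (I := 𝓘(ℝ, E3)) x₀,
      (continuousAt_extChartAt (I := 𝓘(ℝ, E3)) x₀).eventually_mem hfs, hpos] with m h1 h2 h3
    exact ⟨h1, h2, h3⟩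
  obtain ⟨U, hU, hUm⟩ := hall.exists_mem
  refine ⟨U, hU, fun m hm m' hm' h1 h2 h3 => ?_⟩
  obtain ⟨hms, hmf, hmp⟩ := hUm m hm
  obtain ⟨hms', hmf', hmp'⟩ := hUm m' hm'
  refine χ.injOn hms hms' (f.injOn hmf hmf' ?_)
  change (_, _, _) = (_, _, _)
  rw [← hχ, χ.left_inv hms, χ.left_inv hms', h1, h2, ← signedPow_mul _ hmp.le,
    ← signedPow_mul _ hmp'.le, h3]

end Regular


/-! ### Intertwined linear flows -/

section NormalForm

variable {E F : Type*} [NormedAddCommGroup E] [NormedSpace ℝ E] [CompleteSpace E]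
  [NormedAddCommGroup F] [NormedSpace ℝ F] [CompleteSpace F]

theorem map_linearFlow {A : E →L[ℝ] E} {B : F →L[ℝ] F} {C : E →L[ℝ] F}
    (h : ∀ y, C (A y) = B (C y)) (t : ℝ) (y : E) : C (linearFlow A t y) = linearFlow B t (C y) := by
  have key : ∀ t, 0 ≤ t → ∀ y, C (linearFlow A t y) = linearFlow B t (C y) := by
    intro t ht y
    have := eq_linearFlow_of_hasDerivWithinAt (A := B) (c := fun t => C (linearFlow A t y)) (a := 0)
      (b := t) (fun s _ => by
        have := C.hasFDerivAt.comp_hasDerivAt s (hasDerivAt_linearFlow_apply A y s)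
        rw [h] at this
        exact this.hasDerivWithinAt) t ⟨ht, le_rfl⟩
    simpa using this
  rcases le_total 0 t with ht | ht
  · exact key t ht y
  · have h1 := key (-t) (neg_nonneg.2 ht) (linearFlow A t y)
    rw [linearFlow_neg_apply] at h1
    rw [h1, linearFlow_apply_neg]

omit [CompleteSpace E] in
theorem linearFlow_smul (A : E →L[ℝ] E) (c t : ℝ) : linearFlow (c • A) t = linearFlow A (t * c) := by
  rw [linearFlow, linearFlow, smul_smul]

end NormalForm

/-! ### Construction of adapted charts -/

section Existence

variable {M : Type*} [TopologicalSpace M] [ChartedSpace E3 M]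
  {v : (x : M) → TangentSpace 𝓘(ℝ, E3) x} {p : M} {γ : ℝ → M} {A : E3 →L[ℝ] E3}
  {φ : OpenPartialHomeomorph M E3}

/-- Evaluates the differential of a coordinate on the velocity of `γ`. The derivative is one-sided
because adapted coordinates are prescribed along `γ` only for `t ≤ 0`. -/
theorem hasDerivWithinAt_extChartAt_comp (hγ : IsMIntegralCurve γ v) {f : M → ℝ} {D : E3 →L[ℝ] ℝ}
    (hf : HasFDerivAt (fun y => f ((extChartAt 𝓘(ℝ, E3) (γ 0)).symm y)) D
      (extChartAt 𝓘(ℝ, E3) (γ 0) (γ 0))) {u : E3} (hu : u = v (γ 0)) {F : ℝ → ℝ}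
    (hF : ∀ t ≤ 0, f (γ t) = F t) : HasDerivWithinAt F (D u) (Iic 0) 0 := by
  have h1 : HasFDerivWithinAt (fun t => extChartAt 𝓘(ℝ, E3) (γ 0) (γ t))
      ((1 : ℝ →L[ℝ] ℝ).smulRight u) (range 𝓘(ℝ, ℝ)) 0 := hu ▸ (hγ 0).2
  rw [ModelWithCorners.Boundaryless.range_eq_univ, hasFDerivWithinAt_univ] at h1
  have h2 := (HasFDerivAt.comp_hasDerivAt (f := fun t => extChartAt 𝓘(ℝ, E3) (γ 0) (γ t)) 0 hf
    h1.hasDerivAt).hasDerivWithinAt (s := Iic 0)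
  simp only [ContinuousLinearMap.smulRight_apply, one_apply_eq_self, one_smul] at h2
  have h3 : ∀ᶠ t in 𝓝 0, γ t ∈ (extChartAt 𝓘(ℝ, E3) (γ 0)).source :=
    (hγ 0).continuousAt.eventually_mem (extChartAt_source_mem_nhds (γ 0))
  refine h2.congr_of_eventuallyEq ?_ ?_
  · filter_upwards [mem_nhdsWithin_of_mem_nhds h3, self_mem_nhdsWithin] with t ht ht'
    rw [Function.comp_apply, PartialEquiv.left_inv _ ht, hF t ht']
  · rw [Function.comp_apply, extChartAt_to_inv, hF 0 le_rfl]

namespace IsLinearisingChart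

theorem hasStrictFDerivAt (h : IsLinearisingChart v A φ) {x₀ : M} (hx : x₀ ∈ φ.source) :
    HasStrictFDerivAt (fun y => φ ((extChartAt 𝓘(ℝ, E3) x₀).symm y))
      (mfderiv 𝓘(ℝ, E3) 𝓘(ℝ, E3) φ x₀ : E3 →L[ℝ] E3) (extChartAt 𝓘(ℝ, E3) x₀ x₀) := by
  have h1 := (contMDiffAt_iff.1 (h.contMDiffAt x₀ hx)).2
  let D : E3 →L[ℝ] E3 := mfderiv 𝓘(ℝ, E3) 𝓘(ℝ, E3) φ x₀
  have h2 : HasFDerivWithinAt (fun y => φ ((extChartAt 𝓘(ℝ, E3) x₀).symm y)) D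
    (range 𝓘(ℝ, E3)) (extChartAt 𝓘(ℝ, E3) x₀ x₀) := (h.hasMFDerivAt hx).2
  rw [ModelWithCorners.Boundaryless.range_eq_univ] at h1 h2
  rw [contDiffWithinAt_univ] at h1
  rw [hasFDerivWithinAt_univ] at h2
  exact ContDiffAt.hasStrictFDerivAt' h1 h2 one_ne_zero

theorem curve (h : IsLinearisingChart v A φ) (hγ : IsMIntegralCurve γ v)
    (hs : ∀ t ≤ 0, γ t ∈ φ.source) {t : ℝ} (ht : t ≤ 0) :
    φ (γ t) = linearFlow A t (φ (γ 0)) := by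
  have h1 := (h.conjugates t 0 γ ht fun s hs' => hs s hs'.2).1 (hγ.isMIntegralCurveOn _) 0
    ⟨ht, le_rfl⟩
  rw [h1, zero_sub, linearFlow_apply_neg]

open Polynomial in
/-- A saddle with two unstable eigenvalues has a chart adapted to an orbit tending to it in negative
time. -/
theorem exists_isAdapted (h : IsLinearisingChart v A φ) (hγ : IsMIntegralCurve γ v)
    (hs : ∀ t ≤ 0, γ t ∈ φ.source) (hp : Tendsto γ atBot (𝓝 p)) (hne : γ 0 ≠ p)
    (hps : p ∈ φ.source) (hφp : φ p = 0) {a τ δ : ℝ} (ha : 0 < a)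
    (hτ : 0 < τ) (hδ : 0 < δ) (hA : (A : E3 →ₗ[ℝ] E3).charpoly =
      (X + C a) * (X ^ 2 - C τ * X + C δ)) :
    ∃ P Dx Dy, IsAdapted v p γ P ∧ IsRegularAt v p (γ 0) P a Dx Dy := by
  have h0 := hs 0 le_rfl
  set ξ : E3 := φ (γ 0) with hξ
  have hξ0 : ξ ≠ 0 := fun h' => hne (φ.injOn h0 hps (by rw [hφp, ← h', hξ]))
  have hlim : Tendsto (fun t => linearFlow A t ξ) atBot (𝓝 0) := by
    have h1 := (φ.continuousAt hps).tendsto.comp hp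
    rw [hφp] at h1
    refine h1.congr' ?_
    filter_upwards [eventually_le_atBot 0] with t ht using h.curve hγ hs ht
  obtain ⟨Λ, B, hΛ, hB, hΛξ⟩ := exists_linear_normalForm_apply ha hτ hδ hA hξ0 hlim
  obtain ⟨H, DH, hH, hH1, hH0, hHd⟩ := exists_planar_conjugacy hδ hτ hB (Y₀ := (1, 0)) (by simp)
  have ha' : 0 < a⁻¹ := inv_pos.2 ha
  -- The power `a⁻¹` turns the stable rate `-a` into `-1`; `H` turns the planar flow into dilation
  -- and fixes `(1, 0)`, so `ξ` goes to `(0, 1, 0)`.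
  let G : E3 ≃ₜ ℝ × ℝ × ℝ := Λ.toHomeomorph.trans ((signedPowHomeomorph ha').prodCongr H)
  have hG (y : E3) : G y = (signedPow a⁻¹ (Λ y).1, H (Λ y).2) := rfl
  have hΛ1 (t : ℝ) (y : E3) : (Λ (linearFlow A t y)).1 = Real.exp (t * -a) * (Λ y).1 := by
    have := map_linearFlow (A := A) (B := (-a) • (1 : ℝ →L[ℝ] ℝ))
      (C := (ContinuousLinearMap.fst ℝ ℝ (ℝ × ℝ)).comp (Λ : E3 →L[ℝ] ℝ × (ℝ × ℝ)))
      (fun y => by simp [hΛ]) t y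
    rw [linearFlow_smul, linearFlow_one] at this
    simpa using this
  have hΛ2 (t : ℝ) (y : E3) : (Λ (linearFlow A t y)).2 = linearFlow B t (Λ y).2 := by
    have := map_linearFlow (A := A) (B := B)
      (C := (ContinuousLinearMap.snd ℝ ℝ (ℝ × ℝ)).comp (Λ : E3 →L[ℝ] ℝ × (ℝ × ℝ)))
      (fun y => by simp [hΛ]) t y
    simpa using this
  have hGflow (t : ℝ) (y : E3) : G (linearFlow A t y) = modelFlow t (G y) := by
    rw [hG, hG, hΛ1, hΛ2, hH, mul_comm, signedPow_mul _ (Real.exp_pos _).le, ← Real.exp_mul]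
    have : t * -a * a⁻¹ = -t := by field_simp
    rw [this, mul_comm]
    rfl
  have hGξ : G ξ = (0, 1, 0) := by rw [hG, hΛξ, hH1, signedPow_zero ha']
  let P := φ.transHomeomorph G
  have hP (x : M) : P x = G (φ x) := rfl
  have hadapted : IsAdapted v p γ P := by
    refine ⟨fun c d κ hcd hκ => ?_, hps, ?_, hs, fun t ht => ?_⟩
    · rw [h.conjugates c d κ hcd hκ]
      simp only [hP, ← hGflow, G.injective.eq_iff]
    · rw [hP, hφp, hG, map_zero]
      simp only [Prod.fst_zero, Prod.snd_zero, hH0, signedPow_zero ha']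
      rfl
    · rw [hP, h.curve hγ hs ht, hGflow, ← hξ, hGξ]
      simp [modelFlow]
  set χ := extChartAt 𝓘(ℝ, E3) (γ 0) with hχ
  have hχx : χ.symm (χ (γ 0)) = γ 0 := extChartAt_to_inv (γ 0)
  let D : E3 →L[ℝ] E3 := mfderiv 𝓘(ℝ, E3) 𝓘(ℝ, E3) φ (γ 0)
  have hD : HasStrictFDerivAt (fun y => φ (χ.symm y)) D (χ (γ 0)) := h.hasStrictFDerivAt h0
  have hΛD := ((Λ : E3 →L[ℝ] ℝ × (ℝ × ℝ)).hasStrictFDerivAt (x := φ (χ.symm (χ (γ 0))))).comp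
    (χ (γ 0)) hD
  have hY : HasStrictFDerivAt (fun y => (Λ (φ (χ.symm y))).2) _ (χ (γ 0)) := hΛD.snd
  -- The power `a` undoes the power `a⁻¹` in `G` and leaves the linear stable coordinate of the
  -- `C^1` chart.
  have hx : HasStrictFDerivAt (fun y => signedPow a (P (χ.symm y)).1) _ (χ (γ 0)) :=
    hΛD.fst.congr_of_eventuallyEq (by
      filter_upwards with y
      rw [hP, hG]
      exact (signedPow_signedPow ha ha' (inv_mul_cancel₀ ha.ne') _).symm)
  have hHY : HasStrictFDerivAt (fun y => H (Λ (φ (χ.symm y))).2) _ (χ (γ 0)) :=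
    HasStrictFDerivAt.comp (f := fun y => (Λ (φ (χ.symm y))).2) (χ (γ 0)) (g := H)
      (g' := DH) (by simpa only [hχx, ← hξ, hΛξ] using hHd) hY
  have hy : HasStrictFDerivAt (fun y => (P (χ.symm y)).2.1) _ (χ (γ 0)) := hHY.fst
  refine ⟨P, _, _, hadapted, ha, hadapted.curve_zero, hx, hy, ?_, ?_, ?_, ?_⟩
  · intro h'
    have h1 := h.mfderiv_mfderiv_symm h0 (Λ.symm (1, 0))
    have h2 := DFunLike.congr_fun h'
      (mfderiv 𝓘(ℝ, E3) 𝓘(ℝ, E3) φ.symm (φ (γ 0)) (Λ.symm (1, 0)))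
    change (Λ (mfderiv 𝓘(ℝ, E3) 𝓘(ℝ, E3) φ (γ 0)
      (mfderiv 𝓘(ℝ, E3) 𝓘(ℝ, E3) φ.symm (φ (γ 0)) (Λ.symm (1, 0))))).1 = 0 at h2
    rw [h1] at h2
    simp at h2
  · rintro u hu
    have h1 := hasDerivWithinAt_extChartAt_comp hγ (f := fun m => signedPow a (P m).1)
      hx.hasFDerivAt hu (F := fun _ => 0)
      fun t ht => by rw [hadapted.curve t ht]; exact signedPow_zero ha
    exact (uniqueDiffWithinAt_Iic (0 : ℝ)).eq_deriv _ h1 (hasDerivWithinAt_const 0 _ 0)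
  · rintro u hu
    have h1 := hasDerivWithinAt_extChartAt_comp hγ (f := fun m => (P m).2.1)
      hy.hasFDerivAt hu (F := Real.exp)
      fun t ht => by rw [hadapted.curve t ht]
    have h2 := (uniqueDiffWithinAt_Iic (0 : ℝ)).eq_deriv _ h1 (Real.hasDerivAt_exp 0).hasDerivWithinAt
    rw [h2, Real.exp_zero]
  · obtain ⟨e⟩ : Nonempty (EuclideanSpace ℝ (Fin 2) ≃L[ℝ] ℝ × ℝ) :=
      ⟨ContinuousLinearEquiv.ofFinrankEq (by simp)⟩
    -- The tangent disc is a piece of the unstable plane through `ξ`, pulled back by `φ`; in `P` it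
    -- lies in the plane `x = 0`.
    let l : EuclideanSpace ℝ (Fin 2) →L[ℝ] E3 := (Λ.symm : ℝ × (ℝ × ℝ) →L[ℝ] E3).comp
      ((ContinuousLinearMap.inr ℝ ℝ (ℝ × ℝ)).comp
        (e : EuclideanSpace ℝ (Fin 2) →L[ℝ] ℝ × ℝ))
    let g : EuclideanSpace ℝ (Fin 2) → E3 := fun u => ξ + l u
    have hg0 : g 0 = ξ := by simp [g]
    have hgd : HasFDerivAt g l 0 := l.hasFDerivAt.const_add ξ
    let D' : E3 →L[ℝ] E3 := mfderiv 𝓘(ℝ, E3) 𝓘(ℝ, E3) φ.symm (φ (γ 0))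
    have hξt : ξ ∈ φ.target := φ.map_source h0
    have hDD' (u : E3) : D (D' u) = u := h.mfderiv_mfderiv_symm h0 u
    have hl (u) : Λ (l u) = (0, e u) := by simp [l]
    have hgt : ∀ᶠ u in 𝓝 0, g u ∈ φ.target :=
      hgd.continuousAt.eventually_mem (by rw [hg0]; exact φ.open_target.mem_nhds hξt)
    let σ : EuclideanSpace ℝ (Fin 2) → M := fun u => φ.symm (g u)
    have hσ0 : σ 0 = γ 0 := by simp only [σ, hg0, hξ, φ.left_inv h0]
    refine ⟨LinearMap.range ((D'.comp l : EuclideanSpace ℝ (Fin 2) →L[ℝ] E3) :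
      EuclideanSpace ℝ (Fin 2) →ₗ[ℝ] E3), ⟨σ, D'.comp l, hσ0, ?_, ?_, ?_, ?_, rfl⟩, ?_⟩
    · have h1 : ContMDiffAt 𝓘(ℝ, E3) 𝓘(ℝ, E3) 1 φ.symm (g 0) := by
        rw [hg0]; exact h.contMDiffAt_symm ξ hξt
      have h2 : ContDiff ℝ 1 g := by fun_prop
      exact h1.comp 0 h2.contMDiff.contMDiffAt
    · have h1 : Tendsto (fun u => H ((1, 0) + e u)) (𝓝 0) (𝓝 (1, 0)) := by
        have : Continuous fun u => H ((1, 0) + e u) := by fun_prop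
        simpa [hH1] using this.tendsto 0
      filter_upwards [hgt, h1.eventually hadapted.eventually_mem_unstableManifold] with u hu hu'
      have h2 : P (σ u) = (0, H ((1, 0) + e u)) := by
        rw [hP, φ.right_inv hu, hG, map_add, hl, hΛξ]
        simp [signedPow_zero ha']
      rw [← h2, P.left_inv (φ.map_target hu)] at hu'
      exact hu'
    · have h1 : HasMFDerivAt 𝓘(ℝ, E3) 𝓘(ℝ, E3) φ.symm (g 0) D' := by
        rw [hg0]; exact h.hasMFDerivAt_symm hξt
      exact h1.comp 0 hgd.hasMFDerivAt
    · intro u u' huu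
      have h1 : D (D' (l u)) = D (D' (l u')) := congrArg D huu
      rw [hDD', hDD'] at h1
      have h2 := congrArg Λ h1
      rw [hl, hl] at h2
      exact e.injective (Prod.ext_iff.1 h2).2
    · rintro _ ⟨u, rfl⟩ u' hu'
      change (Λ (D u')).1 = 0
      rw [show u' = D' (l u) from hu', hDD', hl]

end IsLinearisingChart

end Existence


/-! ### The linear part read in a linearising chart -/

section LinearPart

/-- At a zero of `k` the product rule needs only continuity of `T`. This suits `C^1` coordinates,
whose derivative need not be differentiable. -/
theorem hasFDerivAt_clm_apply_of_eq_zero {E F G : Type*} [NormedAddCommGroup E] [NormedSpace ℝ E]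
    [NormedAddCommGroup F] [NormedSpace ℝ F] [NormedAddCommGroup G] [NormedSpace ℝ G]
    {T : E → F →L[ℝ] G} {k : E → F} {k' : E →L[ℝ] F} {x : E} (hT : ContinuousAt T x)
    (hk : HasFDerivAt k k' x) (hk0 : k x = 0) :
    HasFDerivAt (fun y => T y (k y)) ((T x).comp k') x := by
  rw [hasFDerivAt_iff_isLittleO]
  have h1 : (fun y => (T x) (k y - k x - k' (y - x))) =o[𝓝 x] fun y => y - x :=
    ((T x).isBigO_comp _ _).trans_isLittleO (hasFDerivAt_iff_isLittleO.1 hk)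
  have h2 : (fun y => (T y - T x) (k y - k x)) =o[𝓝 x] fun y => y - x := by
    have h3 : (fun y => ‖T y - T x‖) =o[𝓝 x] fun _ => (1 : ℝ) := by
      rw [Asymptotics.isLittleO_one_iff]
      exact tendsto_iff_norm_sub_tendsto_zero.1 hT
    have h4 : (fun y => ‖k y - k x‖) =O[𝓝 x] fun y => ‖y - x‖ := hk.isBigO_sub.norm_norm
    have h5 := h3.mul_isBigO h4
    simp only [one_mul] at h5
    refine (Asymptotics.IsBigO.of_bound 1 ?_).trans_isLittleO h5.of_norm_right
    filter_upwards with y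
    rw [one_mul, norm_mul, norm_norm, norm_norm]
    exact (T y - T x).le_opNorm _
  refine (h1.add h2).congr_left fun y => ?_
  simp only [hk0, map_sub, sub_zero, sub_apply, ContinuousLinearMap.comp_apply,
    map_zero]
  abel

variable {M : Type*} [TopologicalSpace M] [ChartedSpace E3 M] [IsManifold 𝓘(ℝ, E3) ∞ M]
  {v : (x : M) → TangentSpace 𝓘(ℝ, E3) x} {p : M} {A : E3 →L[ℝ] E3}
  {φ : OpenPartialHomeomorph M E3}

theorem mpullback_extChartAt_symm {y : E3} (hy : y ∈ (extChartAt 𝓘(ℝ, E3) p).target) :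
    VectorField.mpullback 𝓘(ℝ, E3) 𝓘(ℝ, E3) (extChartAt 𝓘(ℝ, E3) p).symm v y =
      mfderiv 𝓘(ℝ, E3) 𝓘(ℝ, E3) (extChartAt 𝓘(ℝ, E3) p) ((extChartAt 𝓘(ℝ, E3) p).symm y)
        (v ((extChartAt 𝓘(ℝ, E3) p).symm y)) := by
  have : IsManifold 𝓘(ℝ, E3) 1 M := IsManifold.of_le (n := ∞) (by norm_num)
  have h1 := mfderiv_extChartAt_comp_mfderivWithin_extChartAt_symm (I := 𝓘(ℝ, E3)) hy
  have h2 := mfderivWithin_extChartAt_symm_comp_mfderiv_extChartAt (I := 𝓘(ℝ, E3)) hy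
  rw [ModelWithCorners.Boundaryless.range_eq_univ, mfderivWithin_univ] at h1 h2
  rw [VectorField.mpullback_apply]
  exact DFunLike.congr_fun (ContinuousLinearMap.inverse_eq h2 h1) _

/-- In the preferred chart the field is `T y (A (g y))`, where `g` is the change of coordinates and
`T` the derivative of its inverse. Since `g` vanishes at the base point, the linear part is `D⁻¹ A
D`. -/
theorem IsLinearisingChart.charpoly_linearPart (h : IsLinearisingChart v A φ) (hp : p ∈ φ.source)
    (hφp : φ p = 0) :
    (linearPart v p : E3 →ₗ[ℝ] E3).charpoly = (A : E3 →ₗ[ℝ] E3).charpoly := by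
  have : IsManifold 𝓘(ℝ, E3) 1 M := IsManifold.of_le (n := ∞) (by norm_num)
  set χ := extChartAt 𝓘(ℝ, E3) p with hχ
  have hχp : χ.symm (χ p) = p := extChartAt_to_inv p
  let g : E3 → E3 := fun y => φ (χ.symm y)
  let s : E3 → E3 := fun z => χ (φ.symm z)
  let D : E3 →L[ℝ] E3 := mfderiv 𝓘(ℝ, E3) 𝓘(ℝ, E3) φ p
  have hg : HasStrictFDerivAt g D (χ p) := h.hasStrictFDerivAt hp
  have hgp : g (χ p) = 0 := by simp only [g, hχp, hφp]
  have hps : φ.symm 0 = p := by rw [← hφp, φ.left_inv hp]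
  have h0t : (0 : E3) ∈ φ.target := hφp ▸ φ.map_source hp
  have hsc : ContDiffAt ℝ 1 s 0 := by
    have h1 : ContMDiffAt 𝓘(ℝ, E3) 𝓘(ℝ, E3) 1 (extChartAt 𝓘(ℝ, E3) p) (φ.symm 0) := by
      rw [hps]; exact contMDiffAt_extChartAt
    exact (h1.comp 0 (h.contMDiffAt_symm 0 h0t)).contDiffAt
  have hgs : ∀ᶠ y in 𝓝 (χ p), s (g y) = y := by
    have h1 := (continuousAt_extChartAt_symm (I := 𝓘(ℝ, E3)) p).eventually_mem (by
      rw [← hχ, hχp]; exact φ.open_source.mem_nhds hp)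
    filter_upwards [h1, extChartAt_target_mem_nhds (I := 𝓘(ℝ, E3)) p] with y hy hy'
    simp only [s, g]
    rw [φ.left_inv hy, χ.right_inv hy']
  let T : E3 → E3 →L[ℝ] E3 := fun y => fderiv ℝ s (g y)
  have hT : ContinuousAt T (χ p) := by
    have h1 : ContinuousAt (fderiv ℝ s) (g (χ p)) := by
      rw [hgp]; exact hsc.continuousAt_fderiv one_ne_zero
    exact h1.comp hg.hasFDerivAt.continuousAt
  have hV : (fun y : E3 => (VectorField.mpullback 𝓘(ℝ, E3) 𝓘(ℝ, E3) χ.symm v y : E3)) =ᶠ[𝓝 (χ p)]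
      fun y => T y (A (g y)) := by
    have h1 := (continuousAt_extChartAt_symm (I := 𝓘(ℝ, E3)) p).eventually_mem (by
      rw [← hχ, hχp]; exact φ.open_source.mem_nhds hp)
    filter_upwards [h1, extChartAt_target_mem_nhds (I := 𝓘(ℝ, E3)) p] with y hy hy'
    rw [mpullback_extChartAt_symm hy']
    set x := χ.symm y with hx
    have hxs : x ∈ χ.source := χ.map_target hy'
    have h2 := h.mfderiv_symm_apply (φ.map_source hy)
    have h3 : φ.symm (φ x) = x := φ.left_inv hy
    have h4 : MDifferentiableAt 𝓘(ℝ, E3) 𝓘(ℝ, E3) χ (φ.symm (φ x)) := by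
      rw [h3]
      exact mdifferentiableAt_extChartAt (by rwa [hχ, extChartAt_source] at hxs)
    have h5 := (h4.hasMFDerivAt.comp (φ x) (h.hasMFDerivAt_symm (φ.map_source hy))).mfderiv
    rw [mfderiv_eq_fderiv] at h5
    have h6 : T y (A (g y)) = mfderiv 𝓘(ℝ, E3) 𝓘(ℝ, E3) χ (φ.symm (φ x))
      (mfderiv 𝓘(ℝ, E3) 𝓘(ℝ, E3) φ.symm (φ x) (A (φ x))) := DFunLike.congr_fun h5 _
    rw [h6, h2, h3]
  have hAg := (A.hasFDerivAt (x := g (χ p))).comp (χ p) hg.hasFDerivAt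
  have hlin := ((hasFDerivAt_clm_apply_of_eq_zero hT hAg (by
    rw [Function.comp_apply, hgp, map_zero])).congr_of_eventuallyEq hV).fderiv
  change linearPart v p = _ at hlin
  have hs0 : HasFDerivAt s (T (χ p)) (g (χ p)) := by
    have := (hsc.differentiableAt one_ne_zero).hasFDerivAt
    simp only [T, hgp]
    exact this
  have hid := (hs0.comp (χ p) hg.hasFDerivAt).unique
    ((hasFDerivAt_id (χ p)).congr_of_eventuallyEq hgs)
  have hTD : ((T (χ p)) : E3 →ₗ[ℝ] E3) ∘ₗ (D : E3 →ₗ[ℝ] E3) = LinearMap.id :=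
    congrArg (fun l : E3 →L[ℝ] E3 => (l : E3 →ₗ[ℝ] E3)) hid
  have hDT := (LinearMap.comp_eq_id_comm ℝ E3).1 hTD
  let e : E3 ≃ₗ[ℝ] E3 := LinearEquiv.ofLinearMap _ _ hTD hDT
  rw [hlin, ← LinearEquiv.charpoly_conj e (A : E3 →ₗ[ℝ] E3)]
  rfl

theorem charpoly_neg_E3 (A : E3 →ₗ[ℝ] E3) : (-A).charpoly = -A.charpoly.comp (-Polynomial.X) := by
  refine Polynomial.funext fun t => ?_
  rw [LinearMap.eval_charpoly, Polynomial.eval_neg, Polynomial.eval_comp, LinearMap.eval_charpoly]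
  have : algebraMap ℝ (Module.End ℝ E3) t - -A =
      (-1 : ℝ) • (algebraMap ℝ (Module.End ℝ E3) (Polynomial.eval t (-Polynomial.X)) - A) := by
    rw [Polynomial.eval_neg, Polynomial.eval_X, map_neg]
    module
  rw [this, LinearMap.det_smul]
  simp
  ring

end LinearPart

/-! ### Characteristic polynomial at a saddle of index one -/

section Index

open Polynomial

theorem card_aroots_charpoly (A : E3 →L[ℝ] E3) :
    ((A : E3 →ₗ[ℝ] E3).charpoly.aroots ℂ).card = 3 := by
  rw [aroots_def, ← (IsAlgClosed.splits _).natDegree_eq_card_roots,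
    natDegree_map, LinearMap.charpoly_natDegree]
  simp

/-- The characteristic polynomial of a linear map with one eigenvalue in the left half plane and two
in the right one. -/
theorem exists_charpoly_eq_of_card_one {A : E3 →L[ℝ] E3}
    {s : Multiset ℂ} {t : Multiset ℂ} (hst : (A : E3 →ₗ[ℝ] E3).charpoly.aroots ℂ = s + t)
    (hs : ∀ z ∈ s, z.re < 0) (ht : ∀ z ∈ t, 0 < z.re) (hcard : s.card = 1) :
    ∃ a τ δ : ℝ, 0 < a ∧ 0 < τ ∧ 0 < δ ∧
      (A : E3 →ₗ[ℝ] E3).charpoly = (X + C a) * (X ^ 2 - C τ * X + C δ) := by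
  have h3 := card_aroots_charpoly A
  rw [hst, Multiset.card_add, hcard] at h3
  obtain ⟨r, rfl⟩ := Multiset.card_eq_one.1 hcard
  obtain ⟨z, w, rfl⟩ := Multiset.card_eq_two.1 (show t.card = 2 by omega)
  have hr := hs r (by simp)
  have hz := ht z (by simp)
  have hw := ht w (by simp)
  obtain ⟨δ, hδ, h⟩ := eq_mul_quadratic_of_aroots (LinearMap.charpoly_monic _) (r := r) (z := z)
    (w := w) hst (mul_neg_of_neg_of_pos hr hz) (mul_pos hz hw)
  exact ⟨-r.re, z.re + w.re, δ, by linarith, by linarith, hδ, by simp [h, sub_eq_add_neg]⟩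

end Index


/-! ### Characteristic polynomial at a saddle of index two, with time reversed -/

section Index

open Polynomial

/-- The characteristic polynomial of the opposite of a linear map with two eigenvalues in the left
half plane and one in the right one. -/
theorem exists_charpoly_neg_eq_of_card_two {A : E3 →L[ℝ] E3}
    {s t : Multiset ℂ} (hst : (A : E3 →ₗ[ℝ] E3).charpoly.aroots ℂ = s + t)
    (hs : ∀ z ∈ s, z.re < 0) (ht : ∀ z ∈ t, 0 < z.re) (hcard : s.card = 2) :
    ∃ a τ δ : ℝ, 0 < a ∧ 0 < τ ∧ 0 < δ ∧
      ((-A : E3 →L[ℝ] E3) : E3 →ₗ[ℝ] E3).charpoly = (X + C a) * (X ^ 2 - C τ * X + C δ) := by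
  have h3 := card_aroots_charpoly A
  rw [hst, Multiset.card_add, hcard] at h3
  obtain ⟨r, rfl⟩ := Multiset.card_eq_one.1 (show t.card = 1 by omega)
  obtain ⟨z, w, rfl⟩ := Multiset.card_eq_two.1 hcard
  have hr := ht r (by simp)
  have hz := hs z (by simp)
  have hw := hs w (by simp)
  obtain ⟨δ, hδ, h⟩ := eq_mul_quadratic_of_aroots (LinearMap.charpoly_monic _) (r := r) (z := z)
    (w := w) (by rw [hst, add_comm]; rfl) (mul_neg_of_pos_of_neg hr hz) (mul_pos_of_neg_of_neg hz hw)
  refine ⟨r.re, -(z.re + w.re), δ, hr, by linarith, hδ, ?_⟩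
  change (-(A : E3 →ₗ[ℝ] E3)).charpoly = _
  rw [charpoly_neg_E3, h]
  simp only [mul_comp, sub_comp, add_comp, X_comp, C_comp, pow_comp, map_neg]
  ring

end Index

/-! ### Heteroclinic orbits and their standard charts -/

section Connection

variable {M : Type*} [TopologicalSpace M] [ChartedSpace E3 M]
  {v : (x : M) → TangentSpace 𝓘(ℝ, E3) x} {p q : M} {Γ : Set M}

theorem IsC1Linearisable.exists_isLinearisingChart (h : IsC1Linearisable v p) :
    ∃ φ A, IsLinearisingChart v A φ ∧ p ∈ φ.source ∧ φ p = 0 := by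
  obtain ⟨φ, A, hp, hφp, h1, h2, h3⟩ := h
  exact ⟨φ, A, ⟨fun x hx => h1.contMDiffAt (φ.open_source.mem_nhds hx),
    fun y hy => h2.contMDiffAt (φ.open_target.mem_nhds hy), h3⟩, hp, hφp⟩

theorem IsLinearisingChart.neg {A : E3 →L[ℝ] E3} {φ : OpenPartialHomeomorph M E3}
    (h : IsLinearisingChart v A φ) : IsLinearisingChart (-v) (-A) φ where
  contMDiffAt := h.contMDiffAt
  contMDiffAt_symm := h.contMDiffAt_symm
  mfderiv_apply x hx := by
    rw [neg_apply, ← h.mfderiv_apply x hx]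
    exact map_neg (mfderiv 𝓘(ℝ, E3) 𝓘(ℝ, E3) φ x) (v x)

theorem eigenvalues_eq_add (h : IsHyperbolicSaddle v p) :
    ∃ s t, eigenvalues v p = s + t ∧ (∀ z ∈ s, z.re < 0) ∧ (∀ z ∈ t, 0 < z.re) ∧
      s.card = morseIndex v p := by
  classical
  refine ⟨(eigenvalues v p).filter (fun z => z.re < 0),
    (eigenvalues v p).filter (fun z => ¬ z.re < 0), (Multiset.filter_add_not _ _).symm,
    fun z hz => (Multiset.mem_filter.1 hz).2, fun z hz => ?_, ?_⟩
  · obtain ⟨h1, h2⟩ := Multiset.mem_filter.1 hz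
    exact lt_of_le_of_ne (not_lt.1 h2) (h.hyperbolic z h1).symm
  · rw [morseIndex]

/-- A parametrisation of a connection between two zeros of a vector field. -/
structure IsHeteroclinic (v : (x : M) → TangentSpace 𝓘(ℝ, E3) x) (p q : M) (γ : ℝ → M) :
    Prop where
  integral : IsMIntegralCurve γ v
  tendsto_atBot : Tendsto γ atBot (𝓝 p)
  tendsto_atTop : Tendsto γ atTop (𝓝 q)
  ne_p : ∀ t, γ t ≠ p
  ne_q : ∀ t, γ t ≠ q
  ne : p ≠ q
  injective : Function.Injective γ

/-- An orbit through a zero is constant and cannot have two distinct limits; a periodic orbit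
tending to `p` would pass through `p`. -/
theorem isHeteroclinic_of_ne [T2Space M] [IsManifold 𝓘(ℝ, E3) ∞ M] (hv : IsSmoothVectorField v)
    {γ : ℝ → M} (hγ : IsMIntegralCurve γ v) (hγp : Tendsto γ atBot (𝓝 p))
    (hγq : Tendsto γ atTop (𝓝 q)) (hp : v p = 0) (hq : v q = 0) (hpq : p ≠ q) :
    IsHeteroclinic v p q γ := by
  have : IsManifold 𝓘(ℝ, E3) 1 M := IsManifold.of_le (n := ∞) (by norm_num)
  have key : ∀ x, v x = 0 → ∀ t, γ t ≠ x := by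
    intro x hx t ht
    have h1 : γ = fun _ => x := isMIntegralCurve_Ioo_eq_of_contMDiff_boundaryless (t₀ := t)
      hv.contMDiff_one hγ (isMIntegralCurve_const hx) ht
    rw [h1] at hγp hγq
    exact hpq ((tendsto_nhds_unique hγp tendsto_const_nhds).trans
      (tendsto_nhds_unique tendsto_const_nhds hγq))
  refine ⟨hγ, hγp, hγq, key p hp, key q hq, hpq, ?_⟩
  rcases hγ.periodic_xor_injective hv.contMDiff_one with ⟨⟨T, hT, hper⟩, -⟩ | ⟨h, -⟩
  · refine absurd ?_ (key p hp 0)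
    have h1 : Tendsto (fun n : ℕ => γ (-(n * T))) atTop (𝓝 p) :=
      hγp.comp (tendsto_neg_atTop_atBot.comp (tendsto_natCast_atTop_atTop.atTop_mul_const hT))
    have h2 : ∀ n : ℕ, γ (-(n * T)) = γ 0 := fun n => by
      have := hper.nat_mul n (-(n * T))
      rw [neg_add_cancel] at this
      exact this.symm
    simp only [h2] at h1
    exact tendsto_nhds_unique tendsto_const_nhds h1
  · exact h

theorem IsHeteroclinic.neg {γ : ℝ → M} (h : IsHeteroclinic v p q γ) :
    IsHeteroclinic (-v) q p (fun t => γ (-t)) where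
  integral := isMIntegralCurve_neg_iff.2 h.integral
  tendsto_atBot := h.tendsto_atTop.comp tendsto_neg_atBot_atTop
  tendsto_atTop := h.tendsto_atBot.comp tendsto_neg_atTop_atBot
  ne_p _ := h.ne_q _
  ne_q _ := h.ne_p _
  ne := h.ne.symm
  injective := h.injective.comp neg_injective

theorem IsHeteroclinic.comp_add {γ : ℝ → M} (h : IsHeteroclinic v p q γ) (s : ℝ) :
    IsHeteroclinic v p q (fun t => γ (t + s)) where
  integral := h.integral.comp_add s
  tendsto_atBot := h.tendsto_atBot.comp (tendsto_atBot_add_const_right _ s tendsto_id)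
  tendsto_atTop := h.tendsto_atTop.comp (tendsto_atTop_add_const_right _ s tendsto_id)
  ne_p _ := h.ne_p _
  ne_q _ := h.ne_q _
  ne := h.ne
  injective := h.injective.comp (add_left_injective s)

theorem IsHeteroclinic.range_union_eq_closure [T2Space M] {γ : ℝ → M}
    (h : IsHeteroclinic v p q γ) :
    closure (range γ) = insert p (γ '' Iic 0) ∪ insert q (γ '' Ici 0) := by
  have hc : Continuous γ := h.integral.continuous
  have h1 : IsCompact (insert p (γ '' Iic 0)) := isCompact_insert_image_Iic hc h.tendsto_atBot
  have h2 : IsCompact (insert q (γ '' Ici 0)) := by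
    have := isCompact_insert_image_Iic (b := 0) (hc.comp continuous_neg) h.neg.tendsto_atBot
    rw [image_comp, image_neg_Iic, neg_zero] at this
    exact this
  apply subset_antisymm
  · refine closure_minimal ?_ (h1.union h2).isClosed
    rintro _ ⟨t, rfl⟩
    rcases le_total t 0 with ht | ht
    · exact Or.inl (Or.inr ⟨t, ht, rfl⟩)
    · exact Or.inr (Or.inr ⟨t, ht, rfl⟩)
  · have hp : p ∈ closure (range γ) :=
      mem_closure_of_tendsto h.tendsto_atBot (Eventually.of_forall mem_range_self)
    have hq : q ∈ closure (range γ) :=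
      mem_closure_of_tendsto h.tendsto_atTop (Eventually.of_forall mem_range_self)
    exact union_subset
      (insert_subset hp ((image_subset_range _ _).trans subset_closure))
      (insert_subset hq ((image_subset_range _ _).trans subset_closure))

/-- A generic connection has standard charts near its two halves. -/
theorem IsGeneric12.exists_standard_charts [T2Space M] [IsManifold 𝓘(ℝ, E3) ∞ M]
    (hv : IsSmoothVectorField v) (h : IsGeneric12 v p q Γ) :
    ∃ γ P Q, IsHeteroclinic v p q γ ∧ Γ = closure (range γ) ∧ IsAdapted v p γ P ∧
      IsAdapted (-v) q (fun t => γ (-t)) Q ∧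
      ∀ᶠ m in 𝓝 (γ 0), Q m = ((P m).2.2, ((P m).2.1)⁻¹, (P m).1) := by
  have hpq : p ≠ q := by
    rintro rfl
    have := h.index_p.symm.trans h.index_q
    omega
  obtain ⟨γ₀, hγ₀, hγ₀p, hγ₀q, hΓ₀⟩ := h.connection
  have hh₀ := isHeteroclinic_of_ne hv hγ₀ hγ₀p hγ₀q h.saddle_p.zero h.saddle_q.zero hpq
  obtain ⟨φ₀, A, hφ₀, hpφ₀, hφ₀p⟩ := h.linearisable_p.exists_isLinearisingChart
  obtain ⟨ψ, B, hψ, hqψ, hψq⟩ := h.linearisable_q.exists_isLinearisingChart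
  obtain ⟨s, hs⟩ := eventually_atTop.1 (hγ₀q.eventually_mem (ψ.open_source.mem_nhds hqψ))
  -- From time `s` on the orbit lies in the chart at `q`; the chart at `p` is extended up to time
  -- `s`, which then becomes the new origin of time.
  obtain ⟨φ, hφ, hpφ, hφp, hφγ⟩ := hφ₀.exists_extension hv hγ₀ hh₀.injective hγ₀p hh₀.ne_p hpφ₀
    hφ₀p s
  set γ : ℝ → M := fun t => γ₀ (t + s) with hγdef
  have hh : IsHeteroclinic v p q γ := hh₀.comp_add s
  have hΓ : Γ = closure (range γ) := by
    rw [hΓ₀, hγdef]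
    exact congrArg closure ((add_right_surjective s).range_comp γ₀).symm
  obtain ⟨s₁, t₁, hst₁, hs₁, ht₁, hc₁⟩ := eigenvalues_eq_add h.saddle_p
  obtain ⟨s₂, t₂, hst₂, hs₂, ht₂, hc₂⟩ := eigenvalues_eq_add h.saddle_q
  rw [eigenvalues, hφ.charpoly_linearPart hpφ hφp] at hst₁
  rw [eigenvalues, hψ.charpoly_linearPart hqψ hψq] at hst₂
  obtain ⟨a, τ, δ, ha, hτ, hδ, hA⟩ := exists_charpoly_eq_of_card_one hst₁ hs₁ ht₁
    (hc₁.trans h.index_p)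
  obtain ⟨b, τ', δ', hb, hτ', hδ', hB⟩ := exists_charpoly_neg_eq_of_card_two hst₂ hs₂ ht₂
    (hc₂.trans h.index_q)
  obtain ⟨P, Dx, Dy, hP, hPr⟩ := hφ.exists_isAdapted hh.integral
    (fun t ht => hφγ _ (by linarith)) hh.tendsto_atBot (hh.ne_p 0) hpφ hφp ha hτ hδ hA
  obtain ⟨Q, Dz, Dk, hQ, hQr⟩ := hψ.neg.exists_isAdapted hh.neg.integral
    (fun t ht => hs _ (by linarith)) hh.neg.tendsto_atBot (hh.neg.ne_p 0) hqψ hψq hb hτ' hδ' hB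
  rw [neg_zero] at hQr
  have hPs : γ 0 ∈ P.source := hP.mem_curve 0 le_rfl
  have hQs : γ 0 ∈ Q.source := by simpa using hQ.mem_curve 0 le_rfl
  have hx : γ 0 ∈ Γ \ {p, q} := by
    refine ⟨hΓ ▸ subset_closure (mem_range_self 0), ?_⟩
    simp only [mem_insert_iff, mem_singleton_iff, not_or]
    exact ⟨hh.ne_p 0, hh.ne_q 0⟩
  have htr := h.transverse _ hx
  rw [← unstableManifold_neg] at htr
  have hPr' : IsRegularAt (-(-v)) p (γ 0) P a Dx Dy := by rwa [neg_neg]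
  obtain ⟨P', Q', hP', hQ', hPQ⟩ := hP.exists_matched hQ (hPr.exists_injOn hQr hQs htr)
    (hQr.exists_injOn hPr' hPs fun V W hV hW => by
      rw [neg_neg] at hW
      rw [sup_comm]
      exact htr W V hW hV)
  exact ⟨γ, P', Q', hh, hΓ, hP', hQ', hPQ⟩

end Connection


/-! ### Maps preserving integral curves -/

section Gluing

variable {M : Type*} [TopologicalSpace M] [ChartedSpace E3 M]
  {N : Type*} [TopologicalSpace N] [ChartedSpace E3 N]
  {v : (x : M) → TangentSpace 𝓘(ℝ, E3) x} {w : (x : N) → TangentSpace 𝓘(ℝ, E3) x}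

/-- The map `f` sends integral curves to integral curves. -/
def MapsCurves (v : (x : M) → TangentSpace 𝓘(ℝ, E3) x)
    (w : (y : N) → TangentSpace 𝓘(ℝ, E3) y) (f : OpenPartialHomeomorph M N) : Prop :=
  ∀ (a b : ℝ) (γ : ℝ → M), a ≤ b → IsMIntegralCurveOn γ v (Icc a b) →
    (∀ t ∈ Icc a b, γ t ∈ f.source) → IsMIntegralCurveOn (f ∘ γ) w (Icc a b)

theorem Conjugates.mapsCurves {Y : Type*} [TopologicalSpace Y] {S : ℝ → Y → Y}
    {P : OpenPartialHomeomorph M Y} {P' : OpenPartialHomeomorph N Y} (h : Conjugates v S P)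
    (h' : Conjugates w S P') : MapsCurves v w (P.trans P'.symm) := by
  intro a b γ hab hγ hs
  have hs' : ∀ t ∈ Icc a b, γ t ∈ P.source ∧ P (γ t) ∈ P'.target := fun t ht => by
    simpa using hs t ht
  have h1 := (h a b γ hab fun t ht => (hs' t ht).1).1 hγ
  have ha : a ∈ Icc a b := ⟨le_rfl, hab⟩
  refine (h' a b _ hab fun t ht => by simpa using P'.map_target (hs' t ht).2).2 fun t ht => ?_
  simp only [Function.comp_apply, OpenPartialHomeomorph.coe_trans]
  rw [P'.right_inv (hs' t ht).2, P'.right_inv (hs' a ha).2, h1 t ht]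

/-- A homeomorphism which locally sends integral curves to integral curves maps orbits to orbits. -/
theorem mapsOrbits_of_locally {h : OpenPartialHomeomorph M N}
    (hloc : ∀ x ∈ h.source, ∃ f : OpenPartialHomeomorph M N, MapsCurves v w f ∧ x ∈ f.source ∧
      h =ᶠ[𝓝 x] f) : MapsOrbits v w h := by
  intro a b γ _ hγ hs
  -- The local models preserve time, so no reparametrisation is needed.
  refine ⟨id, h ∘ γ, continuousOn_id, strictMonoOn_id, fun t ht => ?_, fun t _ => rfl⟩
  have ht : t ∈ Icc a b := ht
  obtain ⟨f, hf, hft, hhf⟩ := hloc (γ t) (hs t ht)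
  have h1 : ∀ᶠ s in 𝓝[Icc a b] t, γ s ∈ f.source ∧ h (γ s) = f (γ s) :=
    (hγ.continuousWithinAt ht).eventually
      ((Filter.eventually_of_mem (f.open_source.mem_nhds hft) fun _ h => h).and hhf)
  rw [eventually_nhdsWithin_iff] at h1
  obtain ⟨ε, hε, h1⟩ := Metric.eventually_nhds_iff.1 h1
  have hε2 : 0 < ε / 2 := by positivity
  have hmem {s : ℝ} (hs : s ∈ Icc (max a (t - ε / 2)) (min b (t + ε / 2))) :
      s ∈ Icc a b ∧ γ s ∈ f.source ∧ h (γ s) = f (γ s) := by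
    have e1 : s ∈ Icc a b := ⟨(le_max_left _ _).trans hs.1, hs.2.trans (min_le_left _ _)⟩
    have e2 := (le_max_right _ _).trans hs.1
    have e3 := hs.2.trans (min_le_right _ _)
    refine ⟨e1, h1 ?_ e1⟩
    rw [Real.dist_eq, abs_lt]
    constructor <;> linarith
  have htm : t ∈ Icc (max a (t - ε / 2)) (min b (t + ε / 2)) :=
    ⟨max_le ht.1 (by linarith), le_min ht.2 (by linarith)⟩
  have h2 := hf _ _ γ (htm.1.trans htm.2) (hγ.mono fun s hs => (hmem hs).1)
    fun s hs => (hmem hs).2.1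
  have h3 : Icc (max a (t - ε / 2)) (min b (t + ε / 2)) ∈ 𝓝[Icc a b] t := by
    have : Icc (t - ε / 2) (t + ε / 2) ∈ 𝓝 t := Icc_mem_nhds (by linarith) (by linarith)
    filter_upwards [self_mem_nhdsWithin, mem_nhdsWithin_of_mem_nhds this] with s hs hs'
    exact ⟨max_le hs.1 hs'.1, le_min hs.2 hs'.2⟩
  have h4 := (h2 t htm).mono_of_mem_nhdsWithin h3
  have h5 : (h ∘ γ) =ᶠ[𝓝[Icc a b] t] (f ∘ γ) :=
    Filter.eventually_of_mem h3 fun s hs => (hmem hs).2.2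
  have h6 := h4.congr_of_eventuallyEq h5 (hmem htm).2.2
  rw [← show (h ∘ γ) t = (f ∘ γ) t from (hmem htm).2.2] at h6
  exact h6

theorem eventuallyEq_symm {X Y : Type*} [TopologicalSpace X] [TopologicalSpace Y]
    {h f : OpenPartialHomeomorph X Y} {x : X} (hx : x ∈ h.source) (hf : x ∈ f.source)
    (hhf : h =ᶠ[𝓝 x] f) : h.symm =ᶠ[𝓝 (h x)] f.symm := by
  have h1 := (h.tendsto_symm hx).eventually
    (hhf.and (Filter.eventually_of_mem (f.open_source.mem_nhds hf) fun _ h => h))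
  filter_upwards [h1, h.open_target.mem_nhds (h.map_source hx)] with y hy hy'
  rw [h.right_inv hy'] at hy
  exact (f.left_inv hy.2).symm.trans (congrArg f.symm hy.1.symm)

end Gluing

/-! ### Equivalence of two connections -/

section Main

variable {M : Type*} [TopologicalSpace M] [T2Space M] [ChartedSpace E3 M]
  {N : Type*} [TopologicalSpace N] [T2Space N] [ChartedSpace E3 N]
  {v : (x : M) → TangentSpace 𝓘(ℝ, E3) x} {w : (x : N) → TangentSpace 𝓘(ℝ, E3) x}
  {p q : M} {p' q' : N} {γ : ℝ → M} {γ' : ℝ → N}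

omit [T2Space M] [T2Space N] in
theorem IsAdapted.trans_symm {P : OpenPartialHomeomorph M (ℝ × ℝ × ℝ)}
    {P' : OpenPartialHomeomorph N (ℝ × ℝ × ℝ)} (h : IsAdapted v p γ P) (h' : IsAdapted w p' γ' P') :
    (p ∈ (P.trans P'.symm).source ∧ P.trans P'.symm p = p') ∧
      ∀ t ≤ 0, γ t ∈ (P.trans P'.symm).source ∧ P.trans P'.symm (γ t) = γ' t := by
  have h1 : P p = P' p' := by rw [h.apply_eq, h'.apply_eq]
  have h2 : ∀ t ≤ 0, P (γ t) = P' (γ' t) := fun t ht => by rw [h.curve t ht, h'.curve t ht]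
  refine ⟨⟨?_, ?_⟩, fun t ht => ⟨?_, ?_⟩⟩
  · simpa [h1] using ⟨h.mem, P'.map_source h'.mem⟩
  · simp [h1, P'.left_inv h'.mem]
  · simpa [h2 t ht] using ⟨h.mem_curve t ht, P'.map_source (h'.mem_curve t ht)⟩
  · simp [h2 t ht, P'.left_inv (h'.mem_curve t ht)]

/-- The comparison maps `f₁` and `f₂` agree near `γ 0` because the passage from `P` to `Q` and that
from `P'` to `Q'` obey the same formula. Each sends `γ t` to `γ' t` on its half orbit, so
injectivity of `γ'` and its avoidance of `p'` and `q'` give the injectivity needed for gluing. -/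
theorem topologicallyEquivalent_of_standard_charts {Γ : Set M} {Δ : Set N}
    {P Q : OpenPartialHomeomorph M (ℝ × ℝ × ℝ)} {P' Q' : OpenPartialHomeomorph N (ℝ × ℝ × ℝ)}
    (hγ : IsHeteroclinic v p q γ) (hΓ : Γ = closure (range γ)) (hP : IsAdapted v p γ P)
    (hQ : IsAdapted (-v) q (fun t => γ (-t)) Q)
    (hPQ : ∀ᶠ m in 𝓝 (γ 0), Q m = ((P m).2.2, ((P m).2.1)⁻¹, (P m).1))
    (hγ' : IsHeteroclinic w p' q' γ') (hΔ : Δ = closure (range γ')) (hP' : IsAdapted w p' γ' P')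
    (hQ' : IsAdapted (-w) q' (fun t => γ' (-t)) Q')
    (hPQ' : ∀ᶠ m in 𝓝 (γ' 0), Q' m = ((P' m).2.2, ((P' m).2.1)⁻¹, (P' m).1)) :
    TopologicallyEquivalent v Γ w Δ := by
  obtain ⟨⟨hps, hpe⟩, hcp⟩ := hP.trans_symm hP'
  obtain ⟨⟨hqs, hqe⟩, hcq⟩ := hQ.trans_symm hQ'
  set f₁ := P.trans P'.symm with hf₁
  set f₂ := Q.trans Q'.symm with hf₂
  have hcq' : ∀ t, 0 ≤ t → γ t ∈ f₂.source ∧ f₂ (γ t) = γ' t := fun t ht => by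
    simpa using hcq (-t) (neg_nonpos.2 ht)
  have hc : Continuous γ := hγ.integral.continuous
  have hK₁ : IsCompact (insert p (γ '' Iic 0)) := isCompact_insert_image_Iic hc hγ.tendsto_atBot
  have hK₂ : IsCompact (insert q (γ '' Ici 0)) := by
    have := isCompact_insert_image_Iic (b := 0) (hc.comp continuous_neg) hγ.neg.tendsto_atBot
    rw [image_comp, image_neg_Iic, neg_zero] at this
    exact this
  have hagree : f₁ =ᶠ[𝓝 (γ 0)] f₂ := by
    have h0 := hcp 0 le_rfl
    have h1 : Tendsto f₁ (𝓝 (γ 0)) (𝓝 (γ' 0)) := by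
      have := f₁.continuousAt h0.1
      rwa [ContinuousAt, h0.2] at this
    have hs : γ' 0 ∈ Q'.source := by simpa using hQ'.mem_curve 0 le_rfl
    filter_upwards [hPQ, h1.eventually hPQ', h1.eventually_mem (Q'.open_source.mem_nhds hs),
      f₁.open_source.mem_nhds h0.1] with m e1 e2 e3 e4
    have e5 : P m ∈ P'.target := by
      rw [hf₁] at e4
      simpa using e4.2
    have e6 : P' (f₁ m) = P m := by
      rw [hf₁, OpenPartialHomeomorph.coe_trans, Function.comp_apply, P'.right_inv e5]
    rw [e6, ← e1] at e2
    change f₁ m = Q'.symm (Q m)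
    rw [← e2, Q'.left_inv e3]
  obtain ⟨h, hsub, h₁, h₂, hloc⟩ := exists_glued_openPartialHomeomorph f₁ f₂ hK₁ hK₂
    (by
      rintro _ (rfl | ⟨t, ht, rfl⟩)
      · exact hps
      · exact (hcp t ht).1)
    (by
      rintro _ (rfl | ⟨t, ht, rfl⟩)
      · exact hqs
      · exact (hcq' t ht).1)
    (by
      rintro _ ⟨rfl | ⟨t, ht, rfl⟩, h⟩
      · rcases h with h | ⟨t, ht, h⟩
        · exact absurd h hγ.ne
        · exact absurd h (hγ.ne_p t)
      · rcases h with h | ⟨s, hs, h⟩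
        · exact absurd h (hγ.ne_q t)
        · have hst : s = t := hγ.injective h
          subst hst
          rw [show s = 0 from le_antisymm ht hs]
          exact hagree)
    (by
      rintro _ (rfl | ⟨t, ht, rfl⟩) _ (rfl | ⟨s, hs, rfl⟩) h
      · rw [hpe, hqe] at h
        exact absurd h hγ'.ne
      · rw [hpe, (hcq' s hs).2] at h
        exact absurd h.symm (hγ'.ne_p s)
      · rw [(hcp t ht).2, hqe] at h
        exact absurd h (hγ'.ne_q t)
      · rw [(hcp t ht).2, (hcq' s hs).2] at h
        rw [hγ'.injective h])
  have hconjQ := hQ.conj.neg modelFlow_zero modelFlow_add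
  have hconjQ' := hQ'.conj.neg modelFlow_zero modelFlow_add
  rw [neg_neg] at hconjQ hconjQ'
  have hf : ∀ x ∈ h.source, ∃ f : OpenPartialHomeomorph M N, (MapsCurves v w f ∧
      MapsCurves w v f.symm) ∧ x ∈ f.source ∧ h =ᶠ[𝓝 x] f := by
    intro x hx
    rcases hloc x hx with ⟨hx1, hx2⟩ | ⟨hx1, hx2⟩
    · refine ⟨f₁, ⟨hP.conj.mapsCurves hP'.conj, ?_⟩, hx1, hx2⟩
      rw [hf₁, OpenPartialHomeomorph.trans_symm_eq_symm_trans_symm, OpenPartialHomeomorph.symm_symm]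
      exact hP'.conj.mapsCurves hP.conj
    · refine ⟨f₂, ⟨hconjQ.mapsCurves hconjQ', ?_⟩, hx1, hx2⟩
      rw [hf₂, OpenPartialHomeomorph.trans_symm_eq_symm_trans_symm, OpenPartialHomeomorph.symm_symm]
      exact hconjQ'.mapsCurves hconjQ
  have himage : h '' Γ = Δ := by
    rw [hΓ, hΔ, hγ.range_union_eq_closure, hγ'.range_union_eq_closure, image_union, image_insert_eq,
      image_insert_eq, image_image, image_image, (h₁ p (mem_insert _ _)).eq_of_nhds,
      (h₂ q (mem_insert _ _)).eq_of_nhds, hpe, hqe,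
      image_congr fun t ht => ((h₁ (γ t) (Or.inr ⟨t, ht, rfl⟩)).eq_of_nhds.trans (hcp t ht).2),
      image_congr fun t ht => ((h₂ (γ t) (Or.inr ⟨t, ht, rfl⟩)).eq_of_nhds.trans (hcq' t ht).2)]
  have hΓs : Γ ⊆ h.source := by rwa [hΓ, hγ.range_union_eq_closure]
  refine ⟨h, hΓs, ?_, himage, mapsOrbits_of_locally fun x hx => ?_,
    mapsOrbits_of_locally fun y hy => ?_⟩
  · rw [← himage]
    rintro _ ⟨x, hx, rfl⟩
    exact h.map_source (hΓs hx)
  · obtain ⟨f, hf1, hf2, hf3⟩ := hf x hx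
    exact ⟨f, hf1.1, hf2, hf3⟩
  · have hx := h.map_target hy
    obtain ⟨f, hf1, hf2, hf3⟩ := hf _ hx
    have hfy := hf3.eq_of_nhds
    have he := eventuallyEq_symm hx hf2 hf3
    rw [h.right_inv hy] at hfy he
    exact ⟨f.symm, hf1.2, by rw [hfy]; exact f.map_source hf2, he⟩

end Main

end SaddleConnection

theorem theorem1
    {M : Type*} [TopologicalSpace M] [T2Space M] [ChartedSpace E3 M]
    [IsManifold 𝓘(ℝ, E3) ∞ M]
    {N : Type*} [TopologicalSpace N] [T2Space N] [ChartedSpace E3 N]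
    [IsManifold 𝓘(ℝ, E3) ∞ N]
    (v : (x : M) → TangentSpace 𝓘(ℝ, E3) x) (w : (y : N) → TangentSpace 𝓘(ℝ, E3) y)
    (hv : SaddleConnection.IsSmoothVectorField v) (hw : SaddleConnection.IsSmoothVectorField w)
    (p q : M) (Γ : Set M) (hΓ : SaddleConnection.IsGeneric12 v p q Γ)
    (p' q' : N) (Δ : Set N) (hΔ : SaddleConnection.IsGeneric12 w p' q' Δ) :
    SaddleConnection.TopologicallyEquivalent v Γ w Δ := by
  obtain ⟨γ, P, Q, hγ, hΓγ, hP, hQ, hPQ⟩ := hΓ.exists_standard_charts hv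
  obtain ⟨γ', P', Q', hγ', hΔγ, hP', hQ', hPQ'⟩ := hΔ.exists_standard_charts hw
  exact SaddleConnection.topologicallyEquivalent_of_standard_charts hγ hΓγ hP hQ hPQ hγ' hΔγ hP'
    hQ' hPQ'
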